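/- Let $m\ge 2$ be an integer. Consider the $m$-corotational harmonic map heat flow $$u_t=\Delta_m u+F(u),\quad u(0)=u_0,\qquad \Delta_m=\partial_r^2+\tfrac1r\partial_r-\tfrac{m^2}{r^2},\quad F(u)=\tfrac{m^2}{r^2}\bigl(u-\tfrac{\sin 2u}{2}\bigr),$$ for functions $u(t,r)$, $r>0$. Let $$\|u\|_{X^2}^2=\int_0^\infty\Bigl(u_r^2+m^2\frac{u^2}{r^2}\Bigr)r\,dr,\qquad E(u)=\frac12\int_0^\infty\Bigl(u_r^2+m^2\frac{\sin^2u}{r^2}\Bigr)r\,dr,\qquad Q(r)=\pi-2\arctan(r^m),$$ where $u_r$ is the weak derivative; functions with locally integrable weak derivative are identified with their locally absolutely continuous representatives on $(0,\infty)$. Let $$E_0=\{u:\ E(u)<2E(Q),\ \lim_{r\to0^+}u(r)=\lim_{r\to\infty}u(r)=0\}.$$ A solution on $[0,T)$, $T\le\infty$, with datum $u_0\in X^2$ is a function $u\in C_tX^2\cap L^4_t\,rL^4(K)$ for every compact $K\subset[0,T)$, with $u(t)=e^{t\Delta_m}u_0+\int_0^te^{(t-s)\Delta_m}F(u(s))\,ds$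 for all $t\in[0,T)$, where $$\|u\|_{L^4(I;rL^4)}^4=\int_I\int_0^\infty\Bigl|\frac{u(t,r)}{r}\Bigr|^4r\,dr\,dt.$$ Let $T_{\max}(u_0)\in[0,\infty]$ be the maximal existence time, and let $$E_c=\inf\{E(u_0):\ u_0\in E_0,\ \text{the solution } u \text{ with } u(0)=u_0 \text{ has } \|u\|_{L^4([0,T_{\max}(u_0));rL^4)}=\infty\}\in[0,\infty]$$ (with $\inf\emptyset=\infty$). Then there is no critical element: there is no $u_{0,c}\in X^2$ with $E(u_{0,c})=E_c$ such that the solution $u_c$ with datum $u_{0,c}$ on its maximal interval $[0,T_{\max}(u_{0,c}))$ satisfies $\|u_c\|_{L^4([0,T_{\max}(u_{0,c}));rL^4)}=\infty$. -/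

import Mathlib

open Set Filter Topology MeasureTheory
open scoped ENNReal

noncomputable section

namespace CorotationalHeatFlow

/-- Functions of the radial variable live on `(0, ∞)`: only the values at `r > 0` matter.
`u` is locally absolutely continuous on `(0, ∞)`, that is, it is the continuous representative of
a function with a locally integrable weak derivative `u_r`, which is a.e. equal to `deriv u`. -/
def LocAC (u : ℝ → ℝ) : Prop :=
  ∀ a b : ℝ, 0 < a → a < b → AbsolutelyContinuousOnInterval u a b

/-- The squared norm `‖u‖²_{X²} = ∫₀^∞ (u_r² + m² u² / r²) r dr`. -/
def X2NormSq (m : ℕ) (u : ℝ → ℝ) : ℝ≥0∞ :=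
  ∫⁻ r in Ioi (0 : ℝ),
    ENNReal.ofReal (((deriv u r) ^ 2 + (m : ℝ) ^ 2 * (u r) ^ 2 / r ^ 2) * r)

/-- Membership in the energy space `X²`. -/
def MemX2 (m : ℕ) (u : ℝ → ℝ) : Prop :=
  LocAC u ∧ X2NormSq m u < ⊤

/-- The energy `E(u) = 1/2 ∫₀^∞ (u_r² + m² sin² u / r²) r dr`, for locally absolutely
continuous `u`. -/
def energy (m : ℕ) (u : ℝ → ℝ) : ℝ≥0∞ :=
  ∫⁻ r in Ioi (0 : ℝ),
    ENNReal.ofReal ((1 / 2) * ((deriv u r) ^ 2 + (m : ℝ) ^ 2 * Real.sin (u r) ^ 2 / r ^ 2) * r)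

/-- The harmonic map profile `Q(r) = π - 2 arctan (r^m)`. -/
def harmonicMap (m : ℕ) (r : ℝ) : ℝ :=
  Real.pi - 2 * Real.arctan (r ^ m)

/-- The class `E₀` of below-threshold data: `E(u) < 2 E(Q)`, and `u → 0` at `r = 0` and at
infinity. -/
def MemE0 (m : ℕ) (u : ℝ → ℝ) : Prop :=
  LocAC u ∧ energy m u < 2 * energy m (harmonicMap m) ∧
    Tendsto u (𝓝[>] 0) (𝓝 0) ∧ Tendsto u atTop (𝓝 0)

/-- The integral kernel, with respect to `s ds`, of `e^{tΔ_m}`, where `Δ_m = ∂_r² + ∂_r / r - m² / r²`: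
the Gaussian heat kernel of `ℝ²` in polar coordinates, projected onto the angular mode `e^{imθ}`.
It equals `(2t)⁻¹ exp (-(r² + s²) / (4t)) I_m (r s / (2t))`, with `I_m` the modified Bessel
function. -/
def heatKernel (m : ℕ) (t r s : ℝ) : ℝ :=
  (1 / (4 * Real.pi * t)) *
    ∫ θ in (-Real.pi)..Real.pi,
      Real.exp (-(r ^ 2 + s ^ 2 - 2 * r * s * Real.cos θ) / (4 * t)) * Real.cos (m * θ)

/-- The linear propagator `e^{tΔ_m}`, `t ≥ 0`: `e^{tΔ_m} φ (r)` is the value at the point of polar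
coordinates `(r, 0)` of the solution at time `t` of the heat equation on `ℝ²` that starts from
`φ(|x|) e^{imθ}`. -/
def heatFlow (m : ℕ) (t : ℝ) (φ : ℝ → ℝ) (r : ℝ) : ℝ :=
  if t = 0 then φ r else ∫ s in Ioi (0 : ℝ), heatKernel m t r s * φ s * s

/-- The nonlinearity `F(u) = (m² / r²) (u - sin (2u) / 2)`. -/
def nonlinearity (m : ℕ) (u : ℝ → ℝ) (r : ℝ) : ℝ :=
  (m : ℝ) ^ 2 / r ^ 2 * (u r - Real.sin (2 * u r) / 2)

/-- The time interval `[0, T)`, `T ≤ ∞`. -/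
def timeInterval (T : ℝ≥0∞) : Set ℝ :=
  {t : ℝ | 0 ≤ t ∧ ENNReal.ofReal t < T}

/-- The space-time norm `‖u‖_{L⁴_t(I; r L⁴)} = ‖u / r‖_{L⁴(I × (0, ∞); dt r dr)}`. -/
def L4rL4Norm (I : Set ℝ) (u : ℝ → ℝ → ℝ) : ℝ≥0∞ :=
  (∫⁻ t in I, ∫⁻ r in Ioi (0 : ℝ), ENNReal.ofReal (|u t r / r| ^ 4 * r)) ^ (1 / 4 : ℝ)

/-- `u` (written `u t r`) is a solution on `[0, T)` of `u_t = Δ_m u + F(u)` with datum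
`u(0) = u₀ ∈ X²`: it lies in `C_t X² ∩ L⁴_t r L⁴` on compact time intervals and satisfies the
Duhamel formula. For functions in `C_t X²` the integrals in it converge absolutely at every
`r > 0`. -/
structure IsSolution (m : ℕ) (u₀ : ℝ → ℝ) (T : ℝ≥0∞) (u : ℝ → ℝ → ℝ) : Prop where
  data_mem : MemX2 m u₀
  mem : ∀ t ∈ timeInterval T, MemX2 m (u t)
  cont : ∀ t₀ ∈ timeInterval T,
    Tendsto (fun t => X2NormSq m (fun r => u t r - u t₀ r)) (𝓝[timeInterval T] t₀) (𝓝 0)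
  norm_lt_top : ∀ K : Set ℝ, IsCompact K → K ⊆ timeInterval T → L4rL4Norm K u < ⊤
  duhamel : ∀ t ∈ timeInterval T, ∀ r : ℝ, 0 < r →
    u t r = heatFlow m t u₀ r +
      ∫ s in (0 : ℝ)..t, heatFlow m (t - s) (nonlinearity m (u s)) r

/-- The maximal existence time `T_max(u₀) ∈ [0, ∞]`. -/
def maximalTime (m : ℕ) (u₀ : ℝ → ℝ) : ℝ≥0∞ :=
  sSup {T : ℝ≥0∞ | ∃ u : ℝ → ℝ → ℝ, IsSolution m u₀ T u}

/-- `u` is a solution with datum `u₀`, on its maximal interval `[0, T_max(u₀))`, whose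
space-time norm there is infinite: it fails to be global or fails to decay. -/
def HasInfiniteNorm (m : ℕ) (u₀ : ℝ → ℝ) (u : ℝ → ℝ → ℝ) : Prop :=
  IsSolution m u₀ (maximalTime m u₀) u ∧
    L4rL4Norm (timeInterval (maximalTime m u₀)) u = ⊤

/-- The critical energy `E_c`: the infimum in `[0, ∞]` of the energies of the data in `E₀` that
lead to solutions with infinite space-time norm (`∞` if there are none). -/
def criticalEnergy (m : ℕ) : ℝ≥0∞ :=
  sInf {e : ℝ≥0∞ | ∃ (u₀ : ℝ → ℝ) (u : ℝ → ℝ → ℝ),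
    MemE0 m u₀ ∧ HasInfiniteNorm m u₀ u ∧ e = energy m u₀}

/-- A critical element: a solution with infinite space-time norm on its maximal interval, from a
datum in `X²` of energy exactly `E_c`. -/
def IsCriticalElement (m : ℕ) (u₀ : ℝ → ℝ) (u : ℝ → ℝ → ℝ) : Prop :=
  MemX2 m u₀ ∧ energy m u₀ = criticalEnergy m ∧ HasInfiniteNorm m u₀ u

end CorotationalHeatFlow

end

noncomputable section

namespace CorotationalHeatFlow

/-! Consider a solution with infinite space-time norm whose datum has energy exactly E_c. Since the
datum lies in X², E_c is finite. The infimum is thus taken over a nonempty set, and E_c < 2E(Q).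
Either the energy drops below E_c at some time, or it never does.

If E(u(t)) < E_c, then u(t) is admissible in the definition of E_c. Elements of X² tend to 0 at both
ends (`MemX2.tendsto_zero`, `MemX2.tendsto_infty`), so u(t) lies in E_0. The solution restarted from
u(t) still has infinite norm on its maximal interval (`IsSolution.hasInfiniteNorm_restart`). Hence
E_c ≤ E(u(t)), a contradiction. If the energy never drops, u(t) is a critical point of the energy
for every t, hence 0, and the space-time norm is 0 instead of infinite.

The main work is the strict decrease of the energy (`IsMildCurve.norm_jetSinLp_lt`) for solutions
known only to be continuous in X² and locally in L⁴ rL⁴. No smoothing estimate is used. By duality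
the propagator is moved onto test functions, where the heat equation is checked on the planar
Gaussian in polar coordinates; this gives the weak form (`IsMildCurve.weak`). The weak form over [t,
t+h] is then tested against the increment w(t+h) - w(t) (`IsMildCurve.integral_sq_sub_le`). The
quadratic part of the energy becomes the derivative of half the squared norm of the window integral
over [t, t+h]. The potential part is a linearisation whose error is the modulus of continuity ω
times m² (w/r)² times the increment. Young's inequality pays for it with half of the squared
increment and a term h² ω² times the integral of (w/r)⁴, which is finite by the L⁴ hypothesis.
Integrating in t, dividing by h² and letting h → 0 with ω small turns a lower bound κ h² on the
squared increments into a strict loss of energy (`IsMildCurve.integrated_energy_ineq`). Such a lower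
bound holds for a short time after any time at which w is not a critical point
(`IsMildCurve.exists_le_integral_sq_sub`).

A critical point v solves r v' = p, p' = m² sin v cos v / r, and p² - m² sin² v is a constant, which
finite energy forces to be 0. At a maximum of |v| one gets p = 0, so sin v = 0 there. Gronwall's
inequality keeps sin v = 0 to the right, so v is constant there, and its limit 0 at infinity gives v
= 0 (`IsStationary.eq_zero`).

X² is handled through the map u ↦ (u_r, m u / r) into L²(r dr; ℂ), an isometry for the X² norm
(`jetLp`). With sin u in the second slot (`jetSinLp`), half the squared norm is the energy. -/

/-! ### The measure `r dr` and the energy space -/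

/-- The measure `r dr` on `(0, ∞)`. -/
def radialMeasure : Measure ℝ :=
  (volume.restrict (Ioi (0 : ℝ))).withDensity (fun r => ENNReal.ofReal r)

local notation "ν" => radialMeasure

instance : SFinite ν := by unfold radialMeasure; infer_instance

/-- The density is finite everywhere, so no measurability of the integrand is needed; this matters
because the norm and the energy are defined for arbitrary functions. -/
lemma lintegral_radialMeasure (f : ℝ → ℝ≥0∞) :
    ∫⁻ r, f r ∂ν = ∫⁻ r in Ioi (0 : ℝ), ENNReal.ofReal r * f r := by
  rw [radialMeasure, lintegral_withDensity_eq_lintegral_mul_non_measurable _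
    ENNReal.measurable_ofReal (by simp)]
  rfl

lemma integral_radialMeasure (f : ℝ → ℝ) :
    ∫ r, f r ∂ν = ∫ r in Ioi (0 : ℝ), f r * r := by
  rw [radialMeasure, integral_withDensity_eq_integral_toReal_smul ENNReal.measurable_ofReal
    (by simp)]
  refine setIntegral_congr_fun measurableSet_Ioi fun r (hr : 0 < r) => ?_
  simp [ENNReal.toReal_ofReal hr.le, mul_comm]

lemma integrable_radialMeasure_iff (f : ℝ → ℝ) :
    Integrable f ν ↔ IntegrableOn (fun r => f r * r) (Ioi 0) := by
  rw [radialMeasure, integrable_withDensity_iff_integrable_smul' ENNReal.measurable_ofReal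
    (by simp)]
  refine integrableOn_congr_fun (fun r (hr : 0 < r) => ?_) measurableSet_Ioi
  simp [ENNReal.toReal_ofReal hr.le, mul_comm]

lemma radialMeasure_ac : ν ≪ volume.restrict (Ioi (0 : ℝ)) := withDensity_absolutelyContinuous _ _

lemma ae_radialMeasure {p : ℝ → Prop} (h : ∀ᵐ r : ℝ, 0 < r → p r) : ∀ᵐ r ∂ν, p r :=
  radialMeasure_ac.ae_le ((ae_restrict_iff' measurableSet_Ioi).2 h)

lemma ae_radialMeasure_pos : ∀ᵐ r ∂ν, 0 < r := ae_radialMeasure (by simp)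

lemma ae_radialMeasure_of_forall {p : ℝ → Prop} (h : ∀ r : ℝ, 0 < r → p r) : ∀ᵐ r ∂ν, p r :=
  ae_radialMeasure (.of_forall h)

lemma integral_radialMeasure_congr {f g : ℝ → ℝ} (h : ∀ r, 0 < r → f r = g r) :
    ∫ r, f r ∂ν = ∫ r, g r ∂ν :=
  integral_congr_ae (ae_radialMeasure_of_forall h)

lemma lintegral_radialMeasure_congr {f g : ℝ → ℝ≥0∞} (h : ∀ r, 0 < r → f r = g r) :
    ∫⁻ r, f r ∂ν = ∫⁻ r, g r ∂ν :=
  lintegral_congr_ae (ae_radialMeasure_of_forall h)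

lemma aestronglyMeasurable_radial {E : Type*} [TopologicalSpace E]
    [TopologicalSpace.PseudoMetrizableSpace E] {f : ℝ → E}
    (h : ContinuousOn f (Ioi 0)) : AEStronglyMeasurable f ν :=
  (h.aestronglyMeasurable measurableSet_Ioi).mono_ac radialMeasure_ac

lemma radialMeasure_Icc_lt_top (a b : ℝ) : ν (Icc a b) < ⊤ := by
  rw [← lintegral_indicator_one measurableSet_Icc, lintegral_radialMeasure]
  calc ∫⁻ r in Ioi (0 : ℝ), ENNReal.ofReal r * (Icc a b).indicator 1 r
      ≤ ∫⁻ r, (Icc a b).indicator (fun _ => ENNReal.ofReal |b|) r := by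
        refine (setLIntegral_le_lintegral _ _).trans (lintegral_mono fun r => ?_)
        by_cases hr : r ∈ Icc a b
        · simp only [hr, indicator_of_mem, Pi.one_apply, mul_one]
          exact ENNReal.ofReal_le_ofReal (hr.2.trans (le_abs_self b))
        · simp [hr]
    _ < ⊤ := by
        rw [lintegral_indicator measurableSet_Icc]
        simp [ENNReal.mul_lt_top_iff]

namespace LocAC

variable {u v : ℝ → ℝ}

lemma ac (hu : LocAC u) {a b : ℝ} (ha : 0 < a) (hb : 0 < b) :
    AbsolutelyContinuousOnInterval u a b := by
  rcases lt_trichotomy a b with h | h | h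
  · exact hu a b ha h
  · subst h
    refine (hu a (a + 1) ha (by linarith)).mono ?_
    rw [uIcc_self]
    simp
  · exact (hu b a hb h).symm

lemma continuousOn (hu : LocAC u) : ContinuousOn u (Ioi 0) := by
  intro r (hr : 0 < r)
  have h1 := (hu (r / 2) (r + 1) (by linarith) (by linarith)).continuousOn
  rw [uIcc_of_le (by linarith)] at h1
  exact (h1.continuousAt (Icc_mem_nhds (by linarith) (by linarith))).continuousWithinAt

/-- Absolutely continuous functions on a compact interval are differentiable almost everywhere, and
the intervals `[1/(n+1), n+1]` exhaust the half-line. -/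
lemma ae_differentiableAt_volume (hu : LocAC u) : ∀ᵐ r : ℝ, 0 < r → DifferentiableAt ℝ u r := by
  have h : ∀ n : ℕ, ∀ᵐ r : ℝ, r ∈ uIcc (1 / ((n : ℝ) + 1)) (n + 1) → DifferentiableAt ℝ u r :=
    fun n => (hu.ac (by positivity) (by positivity)).ae_differentiableAt
  filter_upwards [ae_all_iff.2 h] with r hr hr0
  obtain ⟨n, hn⟩ := exists_nat_gt (max r (1 / r))
  refine hr n ?_
  have h1 : r < n := (le_max_left _ _).trans_lt hn
  have h2 : 1 / r < n := (le_max_right _ _).trans_lt hn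
  have h3 : 1 / ((n : ℝ) + 1) ≤ r := by
    rw [div_le_iff₀ (by positivity)]
    rw [div_lt_iff₀ hr0] at h2
    nlinarith
  rw [uIcc_of_le (by linarith)]
  exact ⟨h3, by linarith⟩

lemma ae_differentiableAt (hu : LocAC u) : ∀ᵐ r ∂ν, DifferentiableAt ℝ u r :=
  ae_radialMeasure hu.ae_differentiableAt_volume

lemma sub (hu : LocAC u) (hv : LocAC v) : LocAC (fun r => u r - v r) :=
  fun a b ha hab => (hu a b ha hab).sub (hv a b ha hab)

lemma mul (hu : LocAC u) (hv : LocAC v) : LocAC (fun r => u r * v r) :=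
  fun a b ha hab => (hu a b ha hab).mul (hv a b ha hab)

lemma congr (hu : LocAC u) (h : ∀ r, 0 < r → v r = u r) : LocAC v := by
  intro a b ha hab
  have := hu a b ha hab
  refine Tendsto.congr' ?_ this
  filter_upwards [mem_inf_of_right (mem_principal_self _)] with E hE
  refine Finset.sum_congr rfl fun i hi => ?_
  have h1 := hE.1 i hi
  have hpos : ∀ x ∈ uIcc a b, 0 < x := fun x hx => by
    rw [uIcc_of_le hab.le] at hx; exact ha.trans_le hx.1
  rw [h _ (hpos _ h1.1), h _ (hpos _ h1.2)]

lemma of_contDiff (hu : ContDiff ℝ 1 u) : LocAC u :=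
  fun _ _ _ _ => hu.contDiffOn.absolutelyContinuousOnInterval

end LocAC

/-- The pair `(u_r, m u / r)`, as a complex number. -/
def jet (m : ℕ) (u : ℝ → ℝ) (r : ℝ) : ℂ := ⟨deriv u r, m * u r / r⟩

/-- The pair `(u_r, m sin u / r)`, as a complex number. -/
def jetSin (m : ℕ) (u : ℝ → ℝ) (r : ℝ) : ℂ := ⟨deriv u r, m * Real.sin (u r) / r⟩

lemma complex_norm_sq (a b : ℝ) : ‖(⟨a, b⟩ : ℂ)‖ ^ 2 = a ^ 2 + b ^ 2 := by
  rw [← Complex.normSq_eq_norm_sq, Complex.normSq_mk]; ring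

lemma norm_jet_sq (m : ℕ) (u : ℝ → ℝ) (r : ℝ) :
    ‖jet m u r‖ ^ 2 = (deriv u r) ^ 2 + (m : ℝ) ^ 2 * (u r) ^ 2 / r ^ 2 := by
  rw [jet, complex_norm_sq]; ring

lemma norm_jetSin_sq (m : ℕ) (u : ℝ → ℝ) (r : ℝ) :
    ‖jetSin m u r‖ ^ 2 = (deriv u r) ^ 2 + (m : ℝ) ^ 2 * Real.sin (u r) ^ 2 / r ^ 2 := by
  rw [jetSin, complex_norm_sq]; ring

lemma aestronglyMeasurable_complex_mk {μ : Measure ℝ} {f g : ℝ → ℝ} (hf : AEStronglyMeasurable f μ)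
    (hg : AEStronglyMeasurable g μ) : AEStronglyMeasurable (fun r => (⟨f r, g r⟩ : ℂ)) μ := by
  have h : (fun r => (⟨f r, g r⟩ : ℂ)) = fun r => Complex.equivRealProdCLM.symm (f r, g r) := by
    rfl
  rw [h]
  exact Complex.equivRealProdCLM.symm.continuous.comp_aestronglyMeasurable (hf.prodMk hg)

lemma LocAC.aesm {u : ℝ → ℝ} (hu : LocAC u) : AEStronglyMeasurable u ν :=
  aestronglyMeasurable_radial hu.continuousOn

lemma aestronglyMeasurable_jet (m : ℕ) {u : ℝ → ℝ} (hu : LocAC u) :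
    AEStronglyMeasurable (jet m u) ν :=
  aestronglyMeasurable_complex_mk (measurable_deriv u).aestronglyMeasurable
    (aestronglyMeasurable_radial ((continuousOn_const.mul hu.continuousOn).div continuousOn_id
      fun _ hr => (ne_of_gt hr)))

lemma aestronglyMeasurable_jetSin (m : ℕ) {u : ℝ → ℝ} (hu : LocAC u) :
    AEStronglyMeasurable (jetSin m u) ν :=
  aestronglyMeasurable_complex_mk (measurable_deriv u).aestronglyMeasurable
    (aestronglyMeasurable_radial ((continuousOn_const.mul
      (Real.continuous_sin.comp_continuousOn hu.continuousOn)).div continuousOn_id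
      fun _ hr => (ne_of_gt hr)))

lemma X2NormSq_eq_lintegral (m : ℕ) (u : ℝ → ℝ) :
    X2NormSq m u = ∫⁻ r, ENNReal.ofReal (‖jet m u r‖ ^ 2) ∂ν := by
  rw [lintegral_radialMeasure, X2NormSq]
  refine setLIntegral_congr_fun measurableSet_Ioi fun r (hr : 0 < r) => ?_
  simp only [norm_jet_sq]
  rw [← ENNReal.ofReal_mul hr.le, mul_comm]

lemma energy_eq_lintegral (m : ℕ) (u : ℝ → ℝ) :
    energy m u = ∫⁻ r, ENNReal.ofReal (1 / 2 * ‖jetSin m u r‖ ^ 2) ∂ν := by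
  rw [lintegral_radialMeasure, energy]
  refine setLIntegral_congr_fun measurableSet_Ioi fun r (hr : 0 < r) => ?_
  simp only [norm_jetSin_sq]
  rw [← ENNReal.ofReal_mul hr.le, mul_comm]

lemma memLp_two_iff_lintegral {f : ℝ → ℂ} (hf : AEStronglyMeasurable f ν) :
    MemLp f 2 ν ↔ ∫⁻ r, ENNReal.ofReal (‖f r‖ ^ 2) ∂ν < ⊤ := by
  rw [memLp_two_iff_integrable_sq_norm hf, Integrable, hasFiniteIntegral_iff_ofReal
    (.of_forall fun r => by positivity)]
  exact ⟨fun h => h.2, fun h => ⟨(hf.norm.pow 2), h⟩⟩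

lemma MemX2.memLp {m : ℕ} {u : ℝ → ℝ} (hu : MemX2 m u) : MemLp (jet m u) 2 ν := by
  rw [memLp_two_iff_lintegral (aestronglyMeasurable_jet m hu.1), ← X2NormSq_eq_lintegral]
  exact hu.2

lemma memX2_iff {m : ℕ} {u : ℝ → ℝ} (hu : LocAC u) : MemX2 m u ↔ MemLp (jet m u) 2 ν := by
  refine ⟨MemX2.memLp, fun h => ⟨hu, ?_⟩⟩
  rw [X2NormSq_eq_lintegral, ← memLp_two_iff_lintegral (aestronglyMeasurable_jet m hu)]
  exact h

lemma norm_jetSin_le (m : ℕ) (u : ℝ → ℝ) (r : ℝ) : ‖jetSin m u r‖ ≤ ‖jet m u r‖ := by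
  refine le_of_sq_le_sq ?_ (norm_nonneg _)
  rw [norm_jet_sq, norm_jetSin_sq]
  have := Real.sin_sq_le_sq (x := u r)
  gcongr

lemma MemX2.memLp_sin {m : ℕ} {u : ℝ → ℝ} (hu : MemX2 m u) : MemLp (jetSin m u) 2 ν :=
  hu.memLp.mono (aestronglyMeasurable_jetSin m hu.1) (.of_forall fun r => norm_jetSin_le m u r)

/-- The class of `(u_r, m u / r)` in `L²(r dr)`. -/
def jetLp (m : ℕ) (u : ℝ → ℝ) : Lp ℂ 2 ν :=
  open Classical in if h : MemLp (jet m u) 2 ν then h.toLp else 0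

/-- The class of `(u_r, m sin u / r)` in `L²(r dr)`. -/
def jetSinLp (m : ℕ) (u : ℝ → ℝ) : Lp ℂ 2 ν :=
  open Classical in if h : MemLp (jetSin m u) 2 ν then h.toLp else 0

lemma MemX2.coeFn_jetLp {m : ℕ} {u : ℝ → ℝ} (hu : MemX2 m u) : jetLp m u =ᵐ[ν] jet m u := by
  rw [jetLp, dif_pos hu.memLp]; exact hu.memLp.coeFn_toLp

lemma MemX2.coeFn_jetSinLp {m : ℕ} {u : ℝ → ℝ} (hu : MemX2 m u) :
    jetSinLp m u =ᵐ[ν] jetSin m u := by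
  rw [jetSinLp, dif_pos hu.memLp_sin]; exact hu.memLp_sin.coeFn_toLp

lemma norm_sq_Lp (f : Lp ℂ 2 ν) : ‖f‖ ^ 2 = ∫ r, ‖f r‖ ^ 2 ∂ν := by
  rw [← real_inner_self_eq_norm_sq, L2.inner_def]
  simp only [real_inner_self_eq_norm_sq]

lemma MemX2.norm_sq {m : ℕ} {u : ℝ → ℝ} (hu : MemX2 m u) :
    ‖jetLp m u‖ ^ 2 = ∫ r, ‖jet m u r‖ ^ 2 ∂ν := by
  rw [norm_sq_Lp]
  refine integral_congr_ae ?_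
  filter_upwards [hu.coeFn_jetLp] with r hr
  rw [hr]

lemma MemX2.integrable_sq {m : ℕ} {u : ℝ → ℝ} (hu : MemX2 m u) :
    Integrable (fun r => ‖jet m u r‖ ^ 2) ν := hu.memLp.integrable_norm_pow (by norm_num)

lemma MemX2.X2NormSq_eq {m : ℕ} {u : ℝ → ℝ} (hu : MemX2 m u) :
    X2NormSq m u = ENNReal.ofReal (‖jetLp m u‖ ^ 2) := by
  rw [hu.norm_sq, X2NormSq_eq_lintegral, ofReal_integral_eq_lintegral_ofReal hu.integrable_sq
    (.of_forall fun r => by positivity)]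

lemma MemX2.energy_eq {m : ℕ} {u : ℝ → ℝ} (hu : MemX2 m u) :
    energy m u = ENNReal.ofReal (1 / 2 * ‖jetSinLp m u‖ ^ 2) := by
  have h : ‖jetSinLp m u‖ ^ 2 = ∫ r, ‖jetSin m u r‖ ^ 2 ∂ν := by
    rw [norm_sq_Lp]
    refine integral_congr_ae ?_
    filter_upwards [hu.coeFn_jetSinLp] with r hr
    rw [hr]
  rw [h, energy_eq_lintegral, ← integral_const_mul, ofReal_integral_eq_lintegral_ofReal
    ((hu.memLp_sin.integrable_norm_pow (by norm_num)).const_mul _)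
    (.of_forall fun r => by positivity)]

/-- `deriv` respects differences only where both functions are differentiable, hence the restriction
to almost every r. -/
lemma jet_sub_ae (m : ℕ) {u v : ℝ → ℝ} (hu : LocAC u) (hv : LocAC v) :
    ∀ᵐ r ∂ν, jet m (fun r => u r - v r) r = jet m u r - jet m v r := by
  filter_upwards [hu.ae_differentiableAt, hv.ae_differentiableAt] with r h1 h2
  rw [jet, jet, jet, deriv_fun_sub h1 h2]
  apply Complex.ext
  · simp
  · simp; ring

lemma MemX2.sub {m : ℕ} {u v : ℝ → ℝ} (hu : MemX2 m u) (hv : MemX2 m v) :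
    MemX2 m (fun r => u r - v r) := by
  rw [memX2_iff (hu.1.sub hv.1)]
  exact (memLp_congr_ae (jet_sub_ae m hu.1 hv.1)).2 (hu.memLp.sub hv.memLp)

lemma jetLp_sub {m : ℕ} {u v : ℝ → ℝ} (hu : MemX2 m u) (hv : MemX2 m v) :
    jetLp m (fun r => u r - v r) = jetLp m u - jetLp m v := by
  refine Lp.ext ?_
  filter_upwards [(hu.sub hv).coeFn_jetLp, hu.coeFn_jetLp, hv.coeFn_jetLp,
    Lp.coeFn_sub (jetLp m u) (jetLp m v), jet_sub_ae m hu.1 hv.1] with r h1 h2 h3 h4 h5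
  rw [h1, h4, Pi.sub_apply, h2, h3, h5]

/-- The sine is 1-Lipschitz. Consequently the energy is continuous along continuous curves in X². -/
lemma norm_jetSinLp_sub_le {m : ℕ} {u v : ℝ → ℝ} (hu : MemX2 m u) (hv : MemX2 m v) :
    ‖jetSinLp m u - jetSinLp m v‖ ≤ ‖jetLp m u - jetLp m v‖ := by
  refine Lp.norm_le_norm_of_ae_le ?_
  filter_upwards [hu.coeFn_jetLp, hv.coeFn_jetLp, hu.coeFn_jetSinLp, hv.coeFn_jetSinLp,
    Lp.coeFn_sub (jetLp m u) (jetLp m v), Lp.coeFn_sub (jetSinLp m u) (jetSinLp m v)]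
    with r h1 h2 h3 h4 h5 h6
  rw [h5, h6, Pi.sub_apply, Pi.sub_apply, h1, h2, h3, h4]
  refine le_of_sq_le_sq ?_ (norm_nonneg _)
  have e1 : jetSin m u r - jetSin m v r =
      ⟨deriv u r - deriv v r, m / r * (Real.sin (u r) - Real.sin (v r))⟩ := by
    apply Complex.ext <;> simp [jetSin]; ring
  have e2 : jet m u r - jet m v r = ⟨deriv u r - deriv v r, m / r * (u r - v r)⟩ := by
    apply Complex.ext <;> simp [jet]; ring
  rw [e1, e2, complex_norm_sq, complex_norm_sq, mul_pow, mul_pow]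
  have h7 : (Real.sin (u r) - Real.sin (v r)) ^ 2 ≤ (u r - v r) ^ 2 := by
    refine sq_le_sq.2 ?_
    have := Real.lipschitzWith_sin.dist_le_mul (u r) (v r)
    simpa [Real.dist_eq] using this
  gcongr

lemma integral_inner_jet {m : ℕ} {u v : ℝ → ℝ} (hu : MemX2 m u) (hv : MemX2 m v) :
    inner ℝ (jetLp m u) (jetLp m v) =
      ∫ r, (deriv u r * deriv v r + (m : ℝ) ^ 2 * u r * v r / r ^ 2) ∂ν := by
  rw [L2.inner_def]
  refine integral_congr_ae ?_
  filter_upwards [hu.coeFn_jetLp, hv.coeFn_jetLp] with r h1 h2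
  rw [h1, h2, Complex.inner]
  simp [jet]; ring

/-! ### Pointwise bounds in the energy space -/

/-- AM-GM for r u_r and u; since m ≥ 1, the angular term dominates u²/r². The left side is the
absolute value of the derivative of u², which is thus controlled by the energy density. -/
lemma abs_mul_le_jet {m : ℕ} (hm : 1 ≤ m) (u : ℝ → ℝ) {r : ℝ} (hr : 0 < r) :
    |2 * (u r * deriv u r)| ≤ ‖jet m u r‖ ^ 2 * r := by
  rw [norm_jet_sq]
  have hm' : (1 : ℝ) ≤ (m : ℝ) ^ 2 := one_le_pow₀ (by exact_mod_cast hm)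
  have h1 : (1 : ℝ) * (u r) ^ 2 / r ^ 2 ≤ (m : ℝ) ^ 2 * (u r) ^ 2 / r ^ 2 := by gcongr
  have h2 : |2 * (u r * deriv u r)| ≤ ((deriv u r) ^ 2 + 1 * (u r) ^ 2 / r ^ 2) * r := by
    have e : ((deriv u r) ^ 2 + 1 * (u r) ^ 2 / r ^ 2) * r =
        ((deriv u r * r) ^ 2 + (u r) ^ 2) / r := by field_simp
    rw [e, le_div_iff₀ hr, abs_mul, abs_mul, abs_two]
    nlinarith [sq_nonneg (|deriv u r| * r - |u r|), sq_abs (u r), sq_abs (deriv u r)]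
  exact h2.trans (by gcongr)

lemma sq_div_le_jet {m : ℕ} (hm : 1 ≤ m) (u : ℝ → ℝ) {r : ℝ} (hr : 0 < r) :
    (u r) ^ 2 * r⁻¹ ≤ ‖jet m u r‖ ^ 2 * r := by
  rw [norm_jet_sq]
  have hm' : (1 : ℝ) ≤ (m : ℝ) ^ 2 := one_le_pow₀ (by exact_mod_cast hm)
  have h1 : (1 : ℝ) * (u r) ^ 2 / r ^ 2 ≤ (m : ℝ) ^ 2 * (u r) ^ 2 / r ^ 2 := by gcongr
  calc (u r) ^ 2 * r⁻¹ = (1 * (u r) ^ 2 / r ^ 2) * r := by field_simp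
    _ ≤ _ := by
        gcongr
        nlinarith [sq_nonneg (deriv u r)]

lemma MemX2.integrableOn {m : ℕ} {u : ℝ → ℝ} (hu : MemX2 m u) :
    IntegrableOn (fun r => ‖jet m u r‖ ^ 2 * r) (Ioi 0) :=
  (integrable_radialMeasure_iff _).1 hu.integrable_sq

lemma MemX2.abs_sq_sub_le {m : ℕ} (hm : 1 ≤ m) {u : ℝ → ℝ} (hu : MemX2 m u) {a b : ℝ}
    (ha : 0 < a) (hab : a ≤ b) :
    |u b ^ 2 - u a ^ 2| ≤ ∫ r in Ioc a b, ‖jet m u r‖ ^ 2 * r := by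
  have hac : AbsolutelyContinuousOnInterval (fun r => u r * u r) a b :=
    (hu.1.mul hu.1).ac ha (ha.trans_le hab)
  have h1 := hac.integral_deriv_eq_sub
  have h2 : u b ^ 2 - u a ^ 2 = ∫ r in a..b, deriv (fun r => u r * u r) r := by rw [h1]; ring
  have hsub : Ioc a b ⊆ Ioi 0 := fun r hr => ha.trans hr.1
  rw [h2, ← Real.norm_eq_abs, ← intervalIntegral.integral_of_le hab]
  refine intervalIntegral.norm_integral_le_of_norm_le hab ?_
    ((intervalIntegrable_iff_integrableOn_Ioc_of_le hab).2 (hu.integrableOn.mono_set hsub))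
  filter_upwards [hu.1.ae_differentiableAt_volume] with r hr hr1
  have hr0 : 0 < r := hsub hr1
  rw [deriv_fun_mul (hr hr0) (hr hr0), Real.norm_eq_abs]
  convert abs_mul_le_jet hm u hr0 using 2
  ring

/-- If u² ≥ ε near 0, then ε/r is dominated by the integrable density, but 1/r is not integrable at
0. -/
lemma MemX2.exists_small_near_zero {m : ℕ} (hm : 1 ≤ m) {u : ℝ → ℝ} (hu : MemX2 m u) {ε b : ℝ}
    (hε : 0 < ε) (hb : 0 < b) : ∃ a, 0 < a ∧ a < b ∧ u a ^ 2 < ε := by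
  by_contra! hcon
  have h1 : IntervalIntegrable (fun r : ℝ => r⁻¹) volume 0 b := by
    rw [intervalIntegrable_iff_integrableOn_Ioo_of_le hb.le]
    refine Integrable.mono' (g := fun r => ε⁻¹ * (‖jet m u r‖ ^ 2 * r))
      ((hu.integrableOn.mono_set Ioo_subset_Ioi_self).const_mul _)
      measurable_inv.aestronglyMeasurable ?_
    refine (ae_restrict_iff' measurableSet_Ioo).2 (.of_forall fun r hr => ?_)
    have h2 := sq_div_le_jet hm u hr.1
    have h3 := hcon r hr.1 hr.2
    rw [Real.norm_eq_abs, abs_of_pos (inv_pos.2 hr.1), ← div_eq_inv_mul, le_div_iff₀ hε]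
    refine le_trans ?_ h2
    rw [mul_comm]
    exact mul_le_mul_of_nonneg_right h3 (inv_nonneg.2 hr.1.le)
  rw [intervalIntegrable_inv_iff] at h1
  rcases h1 with h | h
  · exact hb.ne h
  · exact h left_mem_uIcc

lemma MemX2.exists_small_near_infty {m : ℕ} (hm : 1 ≤ m) {u : ℝ → ℝ} (hu : MemX2 m u) {ε a : ℝ}
    (hε : 0 < ε) (ha : 0 < a) : ∃ b, a < b ∧ u b ^ 2 < ε := by
  by_contra! hcon
  refine not_integrableOn_Ioi_inv (a := a) ?_
  refine Integrable.mono' (g := fun r => ε⁻¹ * (‖jet m u r‖ ^ 2 * r))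
      ((hu.integrableOn.mono_set (Ioi_subset_Ioi ha.le)).const_mul _)
      measurable_inv.aestronglyMeasurable ?_
  refine (ae_restrict_iff' measurableSet_Ioi).2 (.of_forall fun r (hr : a < r) => ?_)
  have h2 := sq_div_le_jet hm u (ha.trans hr)
  have h3 := hcon r hr
  have hr0 := ha.trans hr
  rw [Real.norm_eq_abs, abs_of_pos (inv_pos.2 hr0), ← div_eq_inv_mul, le_div_iff₀ hε]
  refine le_trans ?_ h2
  rw [mul_comm]
  exact mul_le_mul_of_nonneg_right h3 (inv_nonneg.2 hr0.le)

lemma MemX2.sq_le_Ioc {m : ℕ} (hm : 1 ≤ m) {u : ℝ → ℝ} (hu : MemX2 m u) {b : ℝ} (hb : 0 < b) :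
    u b ^ 2 ≤ ∫ r in Ioc 0 b, ‖jet m u r‖ ^ 2 * r := by
  refine le_of_forall_pos_le_add fun ε hε => ?_
  obtain ⟨a, ha, hab, hs⟩ := hu.exists_small_near_zero hm hε hb
  have h1 := hu.abs_sq_sub_le hm ha hab.le
  have h2 : ∫ r in Ioc a b, ‖jet m u r‖ ^ 2 * r ≤ ∫ r in Ioc 0 b, ‖jet m u r‖ ^ 2 * r := by
    refine setIntegral_mono_set (hu.integrableOn.mono_set Ioc_subset_Ioi_self) ?_
      (Ioc_subset_Ioc_left ha.le).eventuallyLE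
    refine (ae_restrict_iff' measurableSet_Ioc).2 (.of_forall fun r hr => ?_)
    have := hr.1.le
    positivity
  have := (abs_le.1 h1).2
  linarith

lemma MemX2.sq_le_Ioi {m : ℕ} (hm : 1 ≤ m) {u : ℝ → ℝ} (hu : MemX2 m u) {a : ℝ} (ha : 0 < a) :
    u a ^ 2 ≤ ∫ r in Ioi a, ‖jet m u r‖ ^ 2 * r := by
  refine le_of_forall_pos_le_add fun ε hε => ?_
  obtain ⟨b, hab, hs⟩ := hu.exists_small_near_infty hm hε ha
  have h1 := hu.abs_sq_sub_le hm ha hab.le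
  have h2 : ∫ r in Ioc a b, ‖jet m u r‖ ^ 2 * r ≤ ∫ r in Ioi a, ‖jet m u r‖ ^ 2 * r := by
    refine setIntegral_mono_set (hu.integrableOn.mono_set (Ioi_subset_Ioi ha.le)) ?_
      Ioc_subset_Ioi_self.eventuallyLE
    refine (ae_restrict_iff' measurableSet_Ioi).2 (.of_forall fun r (hr : a < r) => ?_)
    have := (ha.trans hr).le
    positivity
  have := (abs_le.1 h1).1
  linarith

/-- The embedding of X² into bounded functions, with constant 1: u² vanishes along a sequence going
to infinity, and its variation is bounded by the X² mass beyond r. -/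
lemma MemX2.abs_le {m : ℕ} (hm : 1 ≤ m) {u : ℝ → ℝ} (hu : MemX2 m u) {r : ℝ} (hr : 0 < r) :
    |u r| ≤ ‖jetLp m u‖ := by
  refine abs_le_of_sq_le_sq ?_ (norm_nonneg _)
  refine (hu.sq_le_Ioi hm hr).trans ?_
  rw [hu.norm_sq, integral_radialMeasure]
  refine setIntegral_mono_set hu.integrableOn ?_ (Ioi_subset_Ioi hr.le).eventuallyLE
  refine (ae_restrict_iff' measurableSet_Ioi).2 (.of_forall fun r (hr : 0 < r) => ?_)
  positivity

lemma MemX2.abs_sub_le {m : ℕ} (hm : 1 ≤ m) {u v : ℝ → ℝ} (hu : MemX2 m u) (hv : MemX2 m v) {r : ℝ}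
    (hr : 0 < r) : |u r - v r| ≤ ‖jetLp m u - jetLp m v‖ := by
  rw [← jetLp_sub hu hv]
  exact (hu.sub hv).abs_le hm hr

lemma tendsto_zero_of_sq_tendsto_zero {u : ℝ → ℝ} {l : Filter ℝ}
    (h : Tendsto (fun r => u r ^ 2) l (𝓝 0)) : Tendsto u l (𝓝 0) := by
  rw [tendsto_zero_iff_abs_tendsto_zero]
  have := (Real.continuous_sqrt.tendsto 0).comp h
  simpa [Function.comp_def, Real.sqrt_sq_eq_abs] using this

/-- The boundary conditions in the class `MemE0` are automatic for values of a solution: u(b)² is at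
most the X² mass in (0, b). -/
lemma MemX2.tendsto_zero {m : ℕ} (hm : 1 ≤ m) {u : ℝ → ℝ} (hu : MemX2 m u) :
    Tendsto u (𝓝[>] 0) (𝓝 0) := by
  refine tendsto_zero_of_sq_tendsto_zero ?_
  have h1 : Tendsto (fun b => ∫ r in Ioc 0 b, ‖jet m u r‖ ^ 2 * r) (𝓝[>] (0 : ℝ)) (𝓝 0) := by
    have hI : IntegrableOn (fun r => ‖jet m u r‖ ^ 2 * r) (Icc 0 1) := by
      rw [integrableOn_Icc_iff_integrableOn_Ioc]
      exact hu.integrableOn.mono_set Ioc_subset_Ioi_self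
    have h2 := (intervalIntegral.continuousOn_primitive hI) 0 (by simp)
    simp only [ContinuousWithinAt, Ioc_self, setIntegral_empty] at h2
    exact h2.mono_left (nhdsWithin_le_of_mem (Icc_mem_nhdsGT one_pos))
  refine tendsto_of_tendsto_of_tendsto_of_le_of_le' tendsto_const_nhds h1
    (.of_forall fun r => sq_nonneg _) ?_
  filter_upwards [self_mem_nhdsWithin] with b hb
  exact hu.sq_le_Ioc hm hb

lemma MemX2.tendsto_infty {m : ℕ} (hm : 1 ≤ m) {u : ℝ → ℝ} (hu : MemX2 m u) :
    Tendsto u atTop (𝓝 0) := by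
  refine tendsto_zero_of_sq_tendsto_zero ?_
  have h1 : Tendsto (fun b => ∫ r in Ioi b, ‖jet m u r‖ ^ 2 * r) atTop (𝓝 0) := by
    have h2 := intervalIntegral_tendsto_integral_Ioi 0 hu.integrableOn tendsto_id
    have h3 := (tendsto_const_nhds (x := ∫ r in Ioi 0, ‖jet m u r‖ ^ 2 * r)).sub h2
    rw [sub_self] at h3
    refine h3.congr' ?_
    filter_upwards [eventually_gt_atTop 0] with b hb
    rw [id, intervalIntegral.integral_of_le hb.le, ← Ioc_union_Ioi_eq_Ioi hb.le,
      setIntegral_union Ioc_disjoint_Ioi_same measurableSet_Ioi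
      (hu.integrableOn.mono_set Ioc_subset_Ioi_self)
      (hu.integrableOn.mono_set (Ioi_subset_Ioi hb.le))]
    ring
  refine tendsto_of_tendsto_of_tendsto_of_le_of_le' tendsto_const_nhds h1
    (.of_forall fun r => sq_nonneg _) ?_
  filter_upwards [eventually_gt_atTop 0] with b hb
  exact hu.sq_le_Ioi hm hb

lemma MemX2.energy_lt_top {m : ℕ} {u : ℝ → ℝ} (hu : MemX2 m u) : energy m u < ⊤ := by
  rw [hu.energy_eq]; exact ENNReal.ofReal_lt_top

/-! ### The heat kernel -/

/-- The heat kernel of `ℝ²` between the points of polar coordinates `(r, 0)` and `(s, θ)`. -/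
def polarGauss (t r s θ : ℝ) : ℝ :=
  1 / (4 * Real.pi * t) * Real.exp (-(r ^ 2 + s ^ 2 - 2 * r * s * Real.cos θ) / (4 * t))

/-- The heat kernel of `ℝ²`. -/
def planeGauss (t : ℝ) (p q : ℝ × ℝ) : ℝ :=
  1 / (4 * Real.pi * t) * Real.exp (-((p.1 - q.1) ^ 2 + (p.2 - q.2) ^ 2) / (4 * t))

lemma continuous_polarGauss (t r : ℝ) : Continuous fun p : ℝ × ℝ => polarGauss t r p.1 p.2 := by
  unfold polarGauss; fun_prop

lemma continuous_polarGauss_angle (t r s : ℝ) : Continuous fun θ => polarGauss t r s θ := by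
  unfold polarGauss; fun_prop

lemma heatKernel_eq (m : ℕ) (t r s : ℝ) :
    heatKernel m t r s = ∫ θ in (-Real.pi)..Real.pi, polarGauss t r s θ * Real.cos (m * θ) := by
  simp only [heatKernel, polarGauss, mul_assoc, intervalIntegral.integral_const_mul]

lemma polarGauss_pos {t : ℝ} (ht : 0 < t) (r s θ : ℝ) : 0 < polarGauss t r s θ := by
  unfold polarGauss; have := Real.pi_pos; positivity

lemma polarGauss_le {t : ℝ} (ht : 0 < t) {r s : ℝ} (hr : 0 ≤ r) (hs : 0 ≤ s) (θ : ℝ) :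
    polarGauss t r s θ ≤ 1 / (4 * Real.pi * t) * Real.exp (-(r - s) ^ 2 / (4 * t)) := by
  unfold polarGauss
  have := Real.pi_pos
  have h1 : r * s * Real.cos θ ≤ r * s * 1 := by
    gcongr; exact Real.cos_le_one θ
  gcongr
  nlinarith

lemma polarGauss_eq_planeGauss (t r s θ : ℝ) :
    polarGauss t r s θ = planeGauss t (r, 0) (polarCoord.symm (s, θ)) := by
  simp only [polarGauss, planeGauss, polarCoord_symm_apply]
  congr 4
  linear_combination -(s ^ 2) * Real.sin_sq_add_cos_sq θ

lemma polarGauss_sub_eq_planeGauss (t s s' θ β : ℝ) :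
    polarGauss t s s' (β - θ) =
      planeGauss t (polarCoord.symm (s, θ)) (s' * Real.cos β, s' * Real.sin β) := by
  simp only [polarGauss, planeGauss, polarCoord_symm_apply]
  congr 4
  rw [Real.cos_sub]
  linear_combination -(s ^ 2) * Real.sin_sq_add_cos_sq θ - (s' ^ 2) * Real.sin_sq_add_cos_sq β

lemma polarGauss_eq_planeGauss_right (t r s' β : ℝ) :
    polarGauss t r s' β = planeGauss t (r, 0) (s' * Real.cos β, s' * Real.sin β) := by
  simpa using polarGauss_sub_eq_planeGauss t r s' 0 β

lemma polarGauss_symm (t r s θ : ℝ) : polarGauss t r s θ = polarGauss t s r θ := by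
  unfold polarGauss; ring_nf

lemma heatKernel_symm (m : ℕ) (t r s : ℝ) : heatKernel m t r s = heatKernel m t s r := by
  simp only [heatKernel_eq, polarGauss_symm t r s]

lemma measurable_heatKernel (m : ℕ) :
    Measurable fun p : ℝ × ℝ × ℝ => heatKernel m p.1 p.2.1 p.2.2 := by
  simp only [heatKernel_eq, intervalIntegral.integral_of_le (neg_le_self Real.pi_pos.le)]
  refine StronglyMeasurable.measurable ?_
  refine StronglyMeasurable.integral_prod_right
    (f := fun (p : ℝ × ℝ × ℝ) θ => polarGauss p.1 p.2.1 p.2.2 θ * Real.cos (m * θ)) ?_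
  refine Measurable.stronglyMeasurable ?_
  unfold polarGauss Function.uncurry
  fun_prop

/-- The Gaussian is positive and the cosine is at most 1 in modulus. All absolute estimates reduce
in this way to mode 0, whose kernel is a probability density in s for r dr. -/
lemma abs_heatKernel_le (m : ℕ) {t : ℝ} (ht : 0 < t) (r s : ℝ) :
    |heatKernel m t r s| ≤ heatKernel 0 t r s := by
  rw [heatKernel_eq, heatKernel_eq, ← Real.norm_eq_abs]
  refine intervalIntegral.norm_integral_le_of_norm_le (neg_le_self Real.pi_pos.le)
    (.of_forall fun θ _ => ?_) ?_
  · rw [norm_mul, Real.norm_eq_abs, Real.norm_eq_abs, abs_of_pos (polarGauss_pos ht _ _ _)]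
    simp only [CharP.cast_eq_zero, zero_mul, Real.cos_zero]
    exact mul_le_mul_of_nonneg_left (Real.abs_cos_le_one _) (polarGauss_pos ht _ _ _).le
  · exact ((continuous_polarGauss_angle t r s).mul (by fun_prop)).intervalIntegrable _ _

lemma heatKernel_zero_nonneg {t : ℝ} (ht : 0 < t) (r s : ℝ) : 0 ≤ heatKernel 0 t r s :=
  (abs_nonneg _).trans (abs_heatKernel_le 0 ht r s)

lemma heatKernel_zero_le_exp {t : ℝ} (ht : 0 < t) {r s : ℝ} (hr : 0 ≤ r) (hs : 0 ≤ s) :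
    heatKernel 0 t r s ≤ 1 / (2 * t) * Real.exp (-(r - s) ^ 2 / (4 * t)) := by
  rw [heatKernel_eq]
  have hπ := Real.pi_pos
  have h1 : ∫ θ in (-Real.pi)..Real.pi, polarGauss t r s θ * Real.cos ((0 : ℕ) * θ) ≤
      ∫ θ in (-Real.pi)..Real.pi, 1 / (4 * Real.pi * t) * Real.exp (-(r - s) ^ 2 / (4 * t)) := by
    refine intervalIntegral.integral_mono_on (neg_le_self hπ.le)
      (((continuous_polarGauss_angle t r s).mul (by fun_prop)).intervalIntegrable _ _)
      (by simp) fun θ _ => ?_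
    simpa using polarGauss_le ht hr hs θ
  refine h1.trans (le_of_eq ?_)
  rw [intervalIntegral.integral_const, smul_eq_mul]
  field_simp
  ring

lemma heatKernel_zero_le {t : ℝ} (ht : 0 < t) {r s : ℝ} (hr : 0 ≤ r) (hs : 0 ≤ s) :
    heatKernel 0 t r s ≤ 1 / (2 * t) := by
  refine (heatKernel_zero_le_exp ht hr hs).trans (mul_le_of_le_one_right (by positivity) ?_)
  rw [Real.exp_le_one_iff]
  exact div_nonpos_of_nonpos_of_nonneg (by nlinarith [sq_nonneg (r - s)]) (by positivity)

/-! ### Gaussian integrals in the plane -/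

lemma integral_gauss_mul_gauss {t t' : ℝ} (ht : 0 < t) (ht' : 0 < t') (a b : ℝ) :
    ∫ x : ℝ, Real.exp (-(a - x) ^ 2 / (4 * t)) * Real.exp (-(x - b) ^ 2 / (4 * t')) =
      √(4 * Real.pi * t * t' / (t + t')) * Real.exp (-(a - b) ^ 2 / (4 * (t + t'))) := by
  -- Completing the square around the weighted mean of a and b.
  have h1 : ∀ x : ℝ, Real.exp (-(a - x) ^ 2 / (4 * t)) * Real.exp (-(x - b) ^ 2 / (4 * t')) =
      Real.exp (-((t + t') / (4 * t * t')) * (x - (a * t' + b * t) / (t + t')) ^ 2) *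
        Real.exp (-(a - b) ^ 2 / (4 * (t + t'))) := by
    intro x
    rw [← Real.exp_add, ← Real.exp_add]
    congr 1
    field_simp
    ring
  simp_rw [h1]
  rw [integral_mul_const, integral_sub_right_eq_self
    (fun x : ℝ => Real.exp (-((t + t') / (4 * t * t')) * x ^ 2)), integral_gaussian]
  congr 2
  field_simp

lemma integral_planeGauss_mul {t t' : ℝ} (ht : 0 < t) (ht' : 0 < t') (p q : ℝ × ℝ) :
    ∫ z, planeGauss t p z * planeGauss t' z q = planeGauss (t + t') p q := by
  have hπ := Real.pi_pos
  have h1 : ∀ z : ℝ × ℝ, planeGauss t p z * planeGauss t' z q =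
      (1 / (4 * Real.pi * t) * (1 / (4 * Real.pi * t'))) *
      ((Real.exp (-(p.1 - z.1) ^ 2 / (4 * t)) * Real.exp (-(z.1 - q.1) ^ 2 / (4 * t'))) *
      (Real.exp (-(p.2 - z.2) ^ 2 / (4 * t)) * Real.exp (-(z.2 - q.2) ^ 2 / (4 * t')))) := by
    intro z
    have e1 : Real.exp (-((p.1 - z.1) ^ 2 + (p.2 - z.2) ^ 2) / (4 * t)) =
        Real.exp (-(p.1 - z.1) ^ 2 / (4 * t)) * Real.exp (-(p.2 - z.2) ^ 2 / (4 * t)) := by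
      rw [← Real.exp_add]; ring_nf
    have e2 : Real.exp (-((z.1 - q.1) ^ 2 + (z.2 - q.2) ^ 2) / (4 * t')) =
        Real.exp (-(z.1 - q.1) ^ 2 / (4 * t')) * Real.exp (-(z.2 - q.2) ^ 2 / (4 * t')) := by
      rw [← Real.exp_add]; ring_nf
    rw [planeGauss, planeGauss, e1, e2]
    ring
  simp_rw [h1]
  rw [integral_const_mul, Measure.volume_eq_prod, integral_prod_mul
    (fun x : ℝ => Real.exp (-(p.1 - x) ^ 2 / (4 * t)) * Real.exp (-(x - q.1) ^ 2 / (4 * t')))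
    (fun x : ℝ => Real.exp (-(p.2 - x) ^ 2 / (4 * t)) * Real.exp (-(x - q.2) ^ 2 / (4 * t'))),
    integral_gauss_mul_gauss ht ht', integral_gauss_mul_gauss ht ht']
  have e3 : Real.exp (-((p.1 - q.1) ^ 2 + (p.2 - q.2) ^ 2) / (4 * (t + t'))) =
      Real.exp (-(p.1 - q.1) ^ 2 / (4 * (t + t'))) *
        Real.exp (-(p.2 - q.2) ^ 2 / (4 * (t + t'))) := by
    rw [← Real.exp_add]; ring_nf
  have e4 : √(4 * Real.pi * t * t' / (t + t')) * √(4 * Real.pi * t * t' / (t + t')) =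
      4 * Real.pi * t * t' / (t + t') := Real.mul_self_sqrt (by positivity)
  rw [planeGauss, e3]
  calc _ = 1 / (4 * Real.pi * t) * (1 / (4 * Real.pi * t')) *
      (√(4 * Real.pi * t * t' / (t + t')) * √(4 * Real.pi * t * t' / (t + t'))) *
      (Real.exp (-(p.1 - q.1) ^ 2 / (4 * (t + t'))) *
        Real.exp (-(p.2 - q.2) ^ 2 / (4 * (t + t')))) := by ring
    _ = _ := by
      rw [e4]
      field_simp

lemma integral_planeGauss {t : ℝ} (ht : 0 < t) (p : ℝ × ℝ) : ∫ z, planeGauss t p z = 1 := by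
  have hπ := Real.pi_pos
  have h1 : ∀ z : ℝ × ℝ, planeGauss t p z = 1 / (4 * Real.pi * t) *
      (Real.exp (-(1 / (4 * t)) * (z.1 - p.1) ^ 2) *
        Real.exp (-(1 / (4 * t)) * (z.2 - p.2) ^ 2)) := by
    intro z
    rw [planeGauss, ← Real.exp_add]
    ring_nf
  simp_rw [h1]
  rw [integral_const_mul, Measure.volume_eq_prod, integral_prod_mul
    (fun x : ℝ => Real.exp (-(1 / (4 * t)) * (x - p.1) ^ 2))
    (fun x : ℝ => Real.exp (-(1 / (4 * t)) * (x - p.2) ^ 2)),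
    integral_sub_right_eq_self (fun x : ℝ => Real.exp (-(1 / (4 * t)) * x ^ 2)),
    integral_sub_right_eq_self (fun x : ℝ => Real.exp (-(1 / (4 * t)) * x ^ 2)),
    integral_gaussian, Real.mul_self_sqrt (by positivity)]
  field_simp

/-- The angular measure. -/
abbrev angleMeasure : Measure ℝ := volume.restrict (Ioo (-Real.pi) Real.pi)

lemma intervalIntegral_pi_eq (f : ℝ → ℝ) :
    ∫ θ in (-Real.pi)..Real.pi, f θ = ∫ θ, f θ ∂angleMeasure := by
  rw [intervalIntegral.integral_of_le (neg_le_self Real.pi_pos.le), integral_Ioc_eq_integral_Ioo]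

lemma restrict_polarCoord_target :
    (volume : Measure (ℝ × ℝ)).restrict polarCoord.target =
      (volume.restrict (Ioi (0 : ℝ))).prod angleMeasure := by
  rw [polarCoord_target, Measure.prod_restrict, Measure.volume_eq_prod]

lemma integrable_mul_gauss {t : ℝ} (ht : 0 < t) (r : ℝ) :
    Integrable fun s : ℝ => s * Real.exp (-(r - s) ^ 2 / (4 * t)) := by
  have hb : 0 < 1 / (4 * t) := by positivity
  have h1 := (integrable_mul_exp_neg_mul_sq hb).comp_sub_right r
  have h2 := ((integrable_exp_neg_mul_sq hb).comp_sub_right r).const_mul r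
  refine (h1.add h2).congr (.of_forall fun s => ?_)
  simp only [Pi.add_apply]
  rw [← add_mul, sub_add_cancel]
  congr 2
  ring

lemma integrable_polarGauss {t : ℝ} (ht : 0 < t) {r : ℝ} (hr : 0 ≤ r) :
    Integrable (fun p : ℝ × ℝ => p.1 * polarGauss t r p.1 p.2)
      ((volume.restrict (Ioi (0 : ℝ))).prod angleMeasure) := by
  have h1 : Integrable (fun p : ℝ × ℝ => (1 / (4 * Real.pi * t)) *
      ((p.1 * Real.exp (-(r - p.1) ^ 2 / (4 * t))) * (1 : ℝ)))
      ((volume.restrict (Ioi (0 : ℝ))).prod angleMeasure) :=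
    ((integrable_mul_gauss ht r).restrict.mul_prod (integrable_const (1 : ℝ))).const_mul _
  refine h1.mono' (by unfold polarGauss; fun_prop) ?_
  have h2 : ∀ᵐ p ∂((volume.restrict (Ioi (0 : ℝ))).prod angleMeasure), p ∈ polarCoord.target := by
    rw [← restrict_polarCoord_target]
    exact ae_restrict_mem polarCoord.open_target.measurableSet
  filter_upwards [h2] with p hp
  have hp0 : 0 < p.1 := hp.1
  rw [Real.norm_eq_abs, abs_of_pos (mul_pos hp0 (polarGauss_pos ht _ _ _)), mul_one]
  calc p.1 * polarGauss t r p.1 p.2 ≤ p.1 * _ :=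
        mul_le_mul_of_nonneg_left (polarGauss_le ht hr hp0.le _) hp0.le
    _ = _ := by ring

lemma integrable_heatKernel_zero {t : ℝ} (ht : 0 < t) {r : ℝ} (hr : 0 ≤ r) :
    Integrable (fun s => heatKernel 0 t r s) ν := by
  rw [integrable_radialMeasure_iff]
  refine (integrable_polarGauss ht hr).integral_prod_left.congr (.of_forall fun s => ?_)
  simp only [heatKernel_eq, CharP.cast_eq_zero, zero_mul, Real.cos_zero, mul_one,
    intervalIntegral_pi_eq, integral_const_mul]
  ring

lemma integral_heatKernel_zero {t : ℝ} (ht : 0 < t) {r : ℝ} (hr : 0 ≤ r) :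
    ∫ s, heatKernel 0 t r s ∂ν = 1 := by
  rw [← integral_planeGauss ht (r, 0), ← integral_comp_polarCoord_symm, restrict_polarCoord_target]
  have h1 : ∀ p : ℝ × ℝ, p.1 • planeGauss t (r, 0) (polarCoord.symm p) =
      p.1 * polarGauss t r p.1 p.2 := fun p => by
    rw [polarGauss_eq_planeGauss, smul_eq_mul]
  simp_rw [h1]
  rw [integral_prod _ (integrable_polarGauss ht hr), integral_radialMeasure]
  refine integral_congr_ae (.of_forall fun s => ?_)
  simp only [heatKernel_eq, CharP.cast_eq_zero, zero_mul, Real.cos_zero, mul_one,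
    intervalIntegral_pi_eq, integral_const_mul]
  ring

lemma integral_polarGauss_mul_sin (m : ℕ) (t r s : ℝ) :
    ∫ θ in (-Real.pi)..Real.pi, polarGauss t r s θ * Real.sin (m * θ) = 0 := by
  have h := intervalIntegral.integral_comp_neg (a := -Real.pi) (b := Real.pi)
    (fun θ => polarGauss t r s θ * Real.sin (m * θ))
  rw [neg_neg] at h
  have h2 : ∀ θ, polarGauss t r s (-θ) * Real.sin (m * -θ) =
      -(polarGauss t r s θ * Real.sin (m * θ)) := by
    intro θ; simp [polarGauss, Real.cos_neg, Real.sin_neg]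
  simp only [h2, intervalIntegral.integral_neg] at h
  linarith

/-- Rotation invariance: cos(mβ) is an eigenfunction of angular convolution with an even kernel.
Periodicity allows the shift by θ, and the sine part of cos(m(β + θ)) integrates to 0 by parity. -/
lemma cos_mul_heatKernel (m : ℕ) (t s s' θ : ℝ) :
    Real.cos (m * θ) * heatKernel m t s s' =
      ∫ β in (-Real.pi)..Real.pi, polarGauss t s s' (β - θ) * Real.cos (m * β) := by
  have hc := continuous_polarGauss_angle t s s'
  have h1 : Function.Periodic
      (fun β => polarGauss t s s' (β - θ) * Real.cos (m * β)) (2 * Real.pi) := by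
    intro β
    have e1 : Real.cos (β + 2 * Real.pi - θ) = Real.cos (β - θ) := by
      rw [show β + 2 * Real.pi - θ = (β - θ) + 2 * Real.pi by ring, Real.cos_add_two_pi]
    have e2 : Real.cos (m * (β + 2 * Real.pi)) = Real.cos (m * β) := by
      rw [mul_add, Real.cos_add_nat_mul_two_pi]
    simp only [polarGauss, e1, e2]
  have h2 := h1.intervalIntegral_add_eq (-Real.pi) (-Real.pi + θ)
  have e3 : -Real.pi + 2 * Real.pi = Real.pi := by ring
  have e4 : -Real.pi + θ + 2 * Real.pi = Real.pi + θ := by ring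
  rw [e3, e4, ← intervalIntegral.integral_comp_add_right
    (fun β => polarGauss t s s' (β - θ) * Real.cos (m * β))] at h2
  rw [h2]
  simp only [add_sub_cancel_right, mul_add, Real.cos_add, mul_sub]
  rw [intervalIntegral.integral_sub]
  · have e5 : ∀ x, polarGauss t s s' x * (Real.sin (m * x) * Real.sin (m * θ)) =
        Real.sin (m * θ) * (polarGauss t s s' x * Real.sin (m * x)) := fun x => by ring
    have e6 : ∀ x, polarGauss t s s' x * (Real.cos (m * x) * Real.cos (m * θ)) =
        Real.cos (m * θ) * (polarGauss t s s' x * Real.cos (m * x)) := fun x => by ring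
    simp only [e5, e6, intervalIntegral.integral_const_mul, integral_polarGauss_mul_sin,
      heatKernel_eq]
    ring
  · exact (hc.mul (by fun_prop)).intervalIntegrable _ _
  · exact (hc.mul (by fun_prop)).intervalIntegrable _ _

/-- The Chapman-Kolmogorov identity. -/
lemma integral_heatKernel_mul (m : ℕ) {t t' : ℝ} (ht : 0 < t) (ht' : 0 < t') {r : ℝ} (hr : 0 ≤ r)
    {s' : ℝ} (hs' : 0 ≤ s') :
    ∫ s, heatKernel m t r s * heatKernel m t' s s' ∂ν = heatKernel m (t + t') r s' := by
  have hπ := Real.pi_pos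
  set μ := (volume.restrict (Ioi (0 : ℝ))).prod angleMeasure with hμ
  have htarget : ∀ᵐ p ∂μ, p ∈ polarCoord.target := by
    rw [hμ, ← restrict_polarCoord_target]
    exact ae_restrict_mem polarCoord.open_target.measurableSet
  -- Here p = (s, θ) belongs to the first kernel and β to the second. Integrating in β first gives
  -- the product of the two kernels; integrating in p first gives a planar Gaussian convolution in
  -- polar coordinates.
  set h : ℝ × ℝ → ℝ → ℝ := fun p β =>
    (p.1 * polarGauss t r p.1 p.2) * (polarGauss t' p.1 s' (β - p.2) * Real.cos (m * β)) with hh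
  have hint : Integrable (Function.uncurry h) (μ.prod angleMeasure) := by
    have h1 : Integrable (fun q : (ℝ × ℝ) × ℝ => (1 / (4 * Real.pi * t')) *
        ((q.1.1 * polarGauss t r q.1.1 q.1.2) * (1 : ℝ))) (μ.prod angleMeasure) :=
      ((integrable_polarGauss ht hr).mul_prod (integrable_const (1 : ℝ))).const_mul _
    refine h1.mono' ?_ ?_
    · simp only [hh, Function.uncurry_def]
      unfold polarGauss
      fun_prop
    · have h2 : ∀ᵐ q ∂(μ.prod angleMeasure), q.1 ∈ polarCoord.target :=
        Measure.quasiMeasurePreserving_fst.ae htarget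
      filter_upwards [h2] with q hq
      have hp0 : 0 < q.1.1 := hq.1
      have h3 : polarGauss t' q.1.1 s' (q.2 - q.1.2) ≤ 1 / (4 * Real.pi * t') := by
        refine (polarGauss_le ht' hp0.le hs' _).trans (mul_le_of_le_one_right (by positivity) ?_)
        rw [Real.exp_le_one_iff]
        exact div_nonpos_of_nonpos_of_nonneg (by nlinarith [sq_nonneg (q.1.1 - s')])
          (by positivity)
      simp only [hh, Function.uncurry_def, norm_mul, Real.norm_eq_abs]
      rw [abs_of_pos hp0, abs_of_pos (polarGauss_pos ht _ _ _),
        abs_of_pos (polarGauss_pos ht' _ _ _), mul_one, mul_comm (1 / (4 * Real.pi * t'))]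
      refine mul_le_mul_of_nonneg_left ?_ (mul_pos hp0 (polarGauss_pos ht _ _ _)).le
      calc _ ≤ 1 / (4 * Real.pi * t') * 1 :=
            mul_le_mul h3 (Real.abs_cos_le_one _) (abs_nonneg _) (by positivity)
        _ = _ := mul_one _
  have step1 : ∫ s, heatKernel m t r s * heatKernel m t' s s' ∂ν =
      ∫ p, ∫ β, h p β ∂angleMeasure ∂μ := by
    rw [hμ, integral_prod (fun p => ∫ β, h p β ∂angleMeasure) hint.integral_prod_left,
      integral_radialMeasure]
    refine integral_congr_ae (.of_forall fun s => ?_)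
    simp only [hh, integral_const_mul, ← intervalIntegral_pi_eq, ← cos_mul_heatKernel]
    rw [heatKernel_eq m t r s, ← intervalIntegral.integral_mul_const,
      ← intervalIntegral.integral_mul_const]
    congr 1
    ext θ
    ring
  rw [step1, integral_integral_swap hint, heatKernel_eq, intervalIntegral_pi_eq]
  refine integral_congr_ae (.of_forall fun β => ?_)
  simp only [hh]
  rw [polarGauss_eq_planeGauss_right, ← integral_planeGauss_mul ht ht',
    ← integral_comp_polarCoord_symm, restrict_polarCoord_target, ← integral_mul_const]
  refine integral_congr_ae (.of_forall fun ⟨s, θ⟩ => ?_)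
  simp only [smul_eq_mul]
  rw [polarGauss_sub_eq_planeGauss, polarGauss_eq_planeGauss]
  ring

/-! ### The propagator -/

/-- The integral operator with kernel `heatKernel m t`. -/
def heatInt (m : ℕ) (t : ℝ) (f : ℝ → ℝ) (r : ℝ) : ℝ := ∫ s, heatKernel m t r s * f s ∂ν

lemma heatFlow_eq (m : ℕ) {t : ℝ} (ht : t ≠ 0) (f : ℝ → ℝ) (r : ℝ) :
    heatFlow m t f r = heatInt m t f r := by
  rw [heatFlow, if_neg ht, heatInt, integral_radialMeasure]

lemma heatFlow_zero (m : ℕ) (f : ℝ → ℝ) (r : ℝ) : heatFlow m 0 f r = f r := by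
  rw [heatFlow, if_pos rfl]

lemma heatInt_congr (m : ℕ) (t : ℝ) {f g : ℝ → ℝ} (h : ∀ s, 0 < s → f s = g s) (r : ℝ) :
    heatInt m t f r = heatInt m t g r :=
  integral_radialMeasure_congr fun s hs => by rw [h s hs]

lemma aesm_heatKernel (m : ℕ) (t r : ℝ) :
    AEStronglyMeasurable (fun s => heatKernel m t r s) ν := by
  have h := (measurable_heatKernel m).comp
    (measurable_const.prodMk (measurable_const.prodMk measurable_id) :
      Measurable fun s : ℝ => (t, r, s))
  exact h.aestronglyMeasurable

lemma integrable_heatKernel (m : ℕ) {t : ℝ} (ht : 0 < t) {r : ℝ} (hr : 0 ≤ r) :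
    Integrable (fun s => heatKernel m t r s) ν :=
  (integrable_heatKernel_zero ht hr).mono' (aesm_heatKernel m t r)
    (.of_forall fun s => abs_heatKernel_le m ht r s)

lemma integrable_heatKernel_mul (m : ℕ) {t : ℝ} (ht : 0 < t) {r : ℝ} (hr : 0 ≤ r) {f : ℝ → ℝ}
    (hf : AEStronglyMeasurable f ν) {C : ℝ} (hC : ∀ s, 0 < s → |f s| ≤ C) :
    Integrable (fun s => heatKernel m t r s * f s) ν :=
  (integrable_heatKernel m ht hr).mul_bdd (c := C) hf (ae_radialMeasure_of_forall hC)

/-- The maximum principle: the mode-0 kernel dominates and has mass 1. -/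
lemma abs_heatInt_le (m : ℕ) {t : ℝ} (ht : 0 < t) {r : ℝ} (hr : 0 ≤ r) {f : ℝ → ℝ}
    {C : ℝ} (hC : ∀ s, 0 < s → |f s| ≤ C) : |heatInt m t f r| ≤ C := by
  calc |heatInt m t f r| ≤ ∫ s, heatKernel 0 t r s * C ∂ν := by
        rw [heatInt, ← Real.norm_eq_abs]
        refine norm_integral_le_of_norm_le ((integrable_heatKernel_zero ht hr).mul_const C)
          (ae_radialMeasure_of_forall fun s hs => ?_)
        rw [norm_mul]
        exact mul_le_mul (abs_heatKernel_le m ht r s) (hC s hs) (abs_nonneg _)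
          (heatKernel_zero_nonneg ht r s)
    _ = C := by rw [integral_mul_const, integral_heatKernel_zero ht hr, one_mul]

lemma measurable_heatInt {α : Type*} [MeasurableSpace α] (m : ℕ) {t r : α → ℝ} {f : α → ℝ → ℝ}
    (ht : Measurable t) (hr : Measurable r) (hf : Measurable (Function.uncurry f)) :
    Measurable fun x => heatInt m (t x) (f x) (r x) := by
  refine StronglyMeasurable.measurable ?_
  refine StronglyMeasurable.integral_prod_right
    (f := fun (x : α) s => heatKernel m (t x) (r x) s * f x s) ?_
  refine Measurable.stronglyMeasurable ?_
  have h := (measurable_heatKernel m).comp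
    ((ht.comp measurable_fst).prodMk ((hr.comp measurable_fst).prodMk measurable_snd) :
      Measurable fun p : α × ℝ => (t p.1, r p.1, p.2))
  exact h.mul hf

/-! ### Test functions -/

/-- The operator `Δ_m`. -/
def radialLaplacian (m : ℕ) (φ : ℝ → ℝ) (r : ℝ) : ℝ :=
  deriv (deriv φ) r + deriv φ r / r - (m : ℝ) ^ 2 * φ r / r ^ 2

lemma continuous_div_of_eq_zero {f g : ℝ → ℝ} {a : ℝ} (ha : 0 < a) (hf : Continuous f)
    (hg : Continuous g) (h0 : ∀ r ≠ 0, g r ≠ 0)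
    (h : ∀ r < a, f r = 0) : Continuous fun r => f r / g r := by
  refine continuous_iff_continuousAt.2 fun r => ?_
  rcases lt_or_ge r a with hr | hr
  · refine (continuousAt_const (y := (0 : ℝ))).congr ?_
    filter_upwards [Iio_mem_nhds hr] with s hs
    rw [h s hs, zero_div]
  · exact hf.continuousAt.div hg.continuousAt (h0 r (ha.trans_le hr).ne')

/-- At the endpoints a and b the derivative vanishes by continuity. These endpoint values are the
boundary terms in later integrations by parts. -/
lemma deriv_eq_zero_of_notMem_Ioo {φ : ℝ → ℝ} {a b : ℝ} (hφ : ContDiff ℝ 1 φ)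
    (h : ∀ r ∉ Ioo a b, φ r = 0) : ∀ r ∉ Ioo a b, deriv φ r = 0 := by
  have hc : Continuous (deriv φ) := hφ.continuous_deriv le_rfl
  have h1 : ∀ r ∈ Iio a ∪ Ioi b, deriv φ r = 0 := by
    intro r hr
    have h2 : φ =ᶠ[𝓝 r] fun _ => 0 := by
      filter_upwards [(isOpen_Iio.union isOpen_Ioi).mem_nhds hr] with s hs
      refine h s fun hs' => ?_
      rcases hs with hs | hs
      · exact absurd hs'.1 (not_lt.2 (le_of_lt hs))
      · exact absurd hs'.2 (not_lt.2 (le_of_lt hs))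
    rw [h2.deriv_eq, deriv_const]
  have h2 : closure (Iio a ∪ Ioi b) ⊆ {r | deriv φ r = 0} :=
    closure_minimal h1 (isClosed_eq hc continuous_const)
  intro r hr
  refine h2 ?_
  rw [closure_union, closure_Iio, closure_Ioi]
  rcases le_or_gt r a with h3 | h3
  · exact Or.inl h3
  · exact Or.inr (not_lt.1 fun h4 => hr ⟨h3, h4⟩)

lemma contDiff_one_deriv {φ : ℝ → ℝ} (h : ContDiff ℝ 2 φ) : ContDiff ℝ 1 (deriv φ) := by
  have h' : ContDiff ℝ (1 + 1) φ := h
  exact (contDiff_succ_iff_deriv.1 h').2.2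

lemma radialLaplacian_eq_zero (m : ℕ) {φ : ℝ → ℝ} {a b : ℝ} (hφ : ContDiff ℝ 2 φ)
    (h : ∀ r ∉ Ioo a b, φ r = 0) : ∀ r ∉ Ioo a b, radialLaplacian m φ r = 0 := by
  intro r hr
  have h1 := deriv_eq_zero_of_notMem_Ioo (hφ.of_le one_le_two) h
  have h2 := deriv_eq_zero_of_notMem_Ioo (contDiff_one_deriv hφ) h1
  rw [radialLaplacian, h2 r hr, h1 r hr, h r hr]
  simp

lemma continuous_radialLaplacian (m : ℕ) {φ : ℝ → ℝ} {a b : ℝ} (ha : 0 < a) (hφ : ContDiff ℝ 2 φ)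
    (h : ∀ r ∉ Ioo a b, φ r = 0) : Continuous (radialLaplacian m φ) := by
  have h1 := deriv_eq_zero_of_notMem_Ioo (hφ.of_le one_le_two) h
  have c1 : Continuous (deriv φ) := hφ.continuous_deriv one_le_two
  have c2 : Continuous (deriv (deriv φ)) := (contDiff_one_deriv hφ).continuous_deriv le_rfl
  refine (c2.add (continuous_div_of_eq_zero ha c1 continuous_id (fun r hr => hr) fun r hr =>
    h1 r fun h => absurd h.1 (not_lt.2 hr.le))).sub
    (continuous_div_of_eq_zero ha (continuous_const.mul hφ.continuous) (continuous_pow 2)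
      (fun r hr => pow_ne_zero 2 hr) fun r hr => ?_)
  rw [h r fun h => absurd h.1 (not_lt.2 hr.le), mul_zero]

lemma exists_bound_of_support {f : ℝ → ℝ} {a b : ℝ} (hf : Continuous f)
    (h : ∀ r ∉ Ioo a b, f r = 0) : ∃ C, 0 ≤ C ∧ ∀ r, |f r| ≤ C := by
  obtain ⟨C, hC⟩ := isCompact_Icc.exists_bound_of_continuousOn (hf.continuousOn (s := Icc a b))
  refine ⟨max C 0, le_max_right _ _, fun r => ?_⟩
  by_cases hr : r ∈ Ioo a b
  · exact (hC r (Ioo_subset_Icc_self hr)).trans (le_max_left _ _)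
  · rw [h r hr, abs_zero]; exact le_max_right _ _

lemma integrable_of_support {f : ℝ → ℝ} {a b : ℝ} (hf : Continuous f)
    (h : ∀ r ∉ Ioo a b, f r = 0) : Integrable f ν := by
  obtain ⟨C, hC0, hC⟩ := exists_bound_of_support hf h
  have h1 : Integrable ((Icc a b).indicator fun _ => C) ν :=
    (integrable_indicator_iff measurableSet_Icc).2
      (integrableOn_const (radialMeasure_Icc_lt_top a b).ne)
  refine h1.mono' hf.aestronglyMeasurable (.of_forall fun r => ?_)
  by_cases hr : r ∈ Ioo a b
  · rw [indicator_of_mem (Ioo_subset_Icc_self hr)]; exact hC r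
  · rw [h r hr, norm_zero]; exact indicator_nonneg (fun _ _ => hC0) r

/-! ### The heat equation for test functions -/

/-- The time derivative of `polarGauss`. -/
def polarGaussDt (t r s θ : ℝ) : ℝ :=
  polarGauss t r s θ * ((r ^ 2 + s ^ 2 - 2 * r * s * Real.cos θ) / (4 * t ^ 2) - 1 / t)

lemma hasDerivAt_polarGauss_time {t : ℝ} (ht : 0 < t) (r s θ : ℝ) :
    HasDerivAt (fun t => polarGauss t r s θ) (polarGaussDt t r s θ) t := by
  have hπ := Real.pi_pos
  set E := r ^ 2 + s ^ 2 - 2 * r * s * Real.cos θ with hE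
  have h1 : HasDerivAt (fun t : ℝ => 1 / (4 * Real.pi * t)) (-(1 / (4 * Real.pi * t ^ 2))) t := by
    have := ((hasDerivAt_id t).const_mul (4 * Real.pi)).inv (by simp; positivity)
    simp only [one_div]
    refine this.congr_deriv ?_
    simp only [id]
    field_simp
  have h2 : HasDerivAt (fun t : ℝ => Real.exp (-E / (4 * t)))
      (Real.exp (-E / (4 * t)) * (E / (4 * t ^ 2))) t := by
    have h3 : HasDerivAt (fun t : ℝ => -E / (4 * t)) (E / (4 * t ^ 2)) t := by
      have := (((hasDerivAt_id t).const_mul 4).inv (by simp; positivity)).const_mul (-E)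
      refine (this.congr_deriv ?_).congr_of_eventuallyEq (.of_forall fun x => ?_)
      · simp only [id]; field_simp
      · simp [div_eq_mul_inv]
    exact h3.exp
  refine (h1.mul h2).congr_deriv ?_
  rw [polarGaussDt, polarGauss, ← hE]
  field_simp
  ring

lemma hasDerivAt_polarGauss_radius {t : ℝ} (ht : 0 < t) (r s θ : ℝ) :
    HasDerivAt (fun s => polarGauss t r s θ)
      (polarGauss t r s θ * (-(s - r * Real.cos θ) / (2 * t))) s := by
  have h1 : HasDerivAt (fun s => -(r ^ 2 + s ^ 2 - 2 * r * s * Real.cos θ) / (4 * t))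
      (-(s - r * Real.cos θ) / (2 * t)) s := by
    have := ((((hasDerivAt_id s).pow 2).const_add (r ^ 2)).sub
      (((hasDerivAt_id s).const_mul (2 * r)).mul_const (Real.cos θ))).neg.div_const (4 * t)
    refine this.congr_deriv ?_
    simp only [id]
    field_simp
    ring
  refine (h1.exp.const_mul (1 / (4 * Real.pi * t))).congr_deriv ?_
  rw [polarGauss]; ring

lemma hasDerivAt_polarGauss_angle {t : ℝ} (ht : 0 < t) (r s θ : ℝ) :
    HasDerivAt (fun θ => polarGauss t r s θ)
      (polarGauss t r s θ * (-(r * s * Real.sin θ) / (2 * t))) θ := by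
  have h1 : HasDerivAt (fun θ => -(r ^ 2 + s ^ 2 - 2 * r * s * Real.cos θ) / (4 * t))
      (-(r * s * Real.sin θ) / (2 * t)) θ := by
    have := (((Real.hasDerivAt_cos θ).const_mul (2 * r * s)).const_sub
      (r ^ 2 + s ^ 2)).neg.div_const (4 * t)
    refine this.congr_deriv ?_
    field_simp
    ring
  refine (h1.exp.const_mul (1 / (4 * Real.pi * t))).congr_deriv ?_
  rw [polarGauss]; ring

/-- The measure `ds dθ` on a box of polar coordinates. -/
abbrev boxMeasure (a b : ℝ) : Measure (ℝ × ℝ) :=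
  (volume.restrict (Ioc a b)).prod (volume.restrict (Ioc (-Real.pi) Real.pi))

lemma integrable_box {a b : ℝ} {f : ℝ × ℝ → ℝ} (hf : Continuous f) :
    Integrable f (boxMeasure a b) := by
  rw [boxMeasure, Measure.prod_restrict, ← Measure.volume_eq_prod]
  exact (hf.continuousOn.integrableOn_compact (isCompact_Icc.prod isCompact_Icc)).mono_set
    (prod_mono Ioc_subset_Icc_self Ioc_subset_Icc_self)

/-- The Gaussian solves the heat equation in (s, θ), and the Laplacian is symmetric: the difference
of the two integrands is a total derivative in s plus a total derivative in θ. -/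
lemma integral_box_polarGaussDt (m : ℕ) {t : ℝ} (ht : 0 < t) (r : ℝ) {φ : ℝ → ℝ} {a b : ℝ}
    (ha : 0 < a) (hab : a < b) (hφ : ContDiff ℝ 2 φ) (h : ∀ r ∉ Ioo a b, φ r = 0) :
    ∫ p, polarGaussDt t r p.1 p.2 * Real.cos (m * p.2) * φ p.1 * p.1 ∂boxMeasure a b =
      ∫ p, polarGauss t r p.1 p.2 * Real.cos (m * p.2) *
        (radialLaplacian m φ p.1 * p.1) ∂boxMeasure a b := by
  have hd1 := deriv_eq_zero_of_notMem_Ioo (hφ.of_le one_le_two) h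
  have c1 : Continuous (deriv φ) := hφ.continuous_deriv one_le_two
  have c2 : Continuous (deriv (deriv φ)) := (contDiff_one_deriv hφ).continuous_deriv le_rfl
  have cφ := hφ.continuous
  have cG := continuous_polarGauss t r
  have cdiv : Continuous fun s => φ s / s :=
    continuous_div_of_eq_zero ha cφ continuous_id (fun _ h => h)
      fun s hs => h s fun h' => absurd h'.1 (not_lt.2 hs.le)
  -- X is the s-derivative of (s G_s φ - s G φ') cos(mθ), with G the Gaussian; it integrates to 0
  -- because φ and φ' vanish at a and b.
  set X : ℝ × ℝ → ℝ := fun p => polarGauss t r p.1 p.2 * Real.cos (m * p.2) *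
    ((-(2 * p.1 - r * Real.cos p.2) / (2 * t) +
      p.1 * (p.1 - r * Real.cos p.2) ^ 2 / (4 * t ^ 2)) * φ p.1
      - (deriv φ p.1 + p.1 * deriv (deriv φ) p.1)) with hX
  -- Y is the θ-derivative of (G_θ cos(mθ) + m G sin(mθ)) φ/s; it integrates to 0 because sin θ and
  -- sin(mθ) vanish at ±π.
  set Y : ℝ × ℝ → ℝ := fun p => polarGauss t r p.1 p.2 * Real.cos (m * p.2) *
    (((r * p.1 * Real.sin p.2) ^ 2 / (4 * t ^ 2) - r * p.1 * Real.cos p.2 / (2 * t)) + m ^ 2) *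
      (φ p.1 / p.1) with hY
  have cX : Continuous X := by rw [hX]; fun_prop
  have cY : Continuous Y := by
    rw [hY]
    exact (by fun_prop : Continuous fun p : ℝ × ℝ => polarGauss t r p.1 p.2 *
      Real.cos (m * p.2) * (((r * p.1 * Real.sin p.2) ^ 2 / (4 * t ^ 2) -
        r * p.1 * Real.cos p.2 / (2 * t)) + (m : ℝ) ^ 2)).mul (cdiv.comp continuous_fst)
  have hXint : ∫ p, X p ∂boxMeasure a b = 0 := by
    rw [boxMeasure, integral_prod_symm _ (integrable_box cX)]
    refine integral_eq_zero_of_ae (.of_forall fun θ => ?_)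
    simp only [Pi.zero_apply]
    rw [← intervalIntegral.integral_of_le hab.le]
    have hder : ∀ s ∈ uIcc a b, HasDerivAt (fun s => (s * (polarGauss t r s θ *
        (-(s - r * Real.cos θ) / (2 * t))) * φ s - s * polarGauss t r s θ * deriv φ s) *
        Real.cos (m * θ)) (X (s, θ)) s := by
      intro s _
      have d1 := hasDerivAt_polarGauss_radius ht r s θ
      have d2 : HasDerivAt φ (deriv φ s) s :=
        (hφ.differentiable two_ne_zero).differentiableAt.hasDerivAt
      have d3 : HasDerivAt (deriv φ) (deriv (deriv φ) s) s :=
        ((contDiff_one_deriv hφ).differentiable one_ne_zero).differentiableAt.hasDerivAt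
      have d4 : HasDerivAt (fun s => -(s - r * Real.cos θ) / (2 * t)) (-1 / (2 * t)) s :=
        ((hasDerivAt_id s).sub_const _).neg.div_const _
      refine ((((hasDerivAt_id s).mul (d1.mul d4)).mul d2).sub
        (((hasDerivAt_id s).mul d1).mul d3) |>.mul_const (Real.cos (m * θ))).congr_deriv ?_
      simp only [hX, id, Pi.mul_apply]
      field_simp
      ring
    rw [intervalIntegral.integral_eq_sub_of_hasDerivAt hder
      ((cX.comp (by fun_prop : Continuous fun s : ℝ => (s, θ))).intervalIntegrable _ _)]
    rw [h a (by simp), h b (by simp), hd1 a (by simp), hd1 b (by simp)]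
    simp
  have hYint : ∫ p, Y p ∂boxMeasure a b = 0 := by
    rw [boxMeasure, integral_prod _ (integrable_box cY)]
    refine integral_eq_zero_of_ae (.of_forall fun s => ?_)
    simp only [Pi.zero_apply]
    rw [← intervalIntegral.integral_of_le (neg_le_self Real.pi_pos.le)]
    have hder : ∀ θ ∈ uIcc (-Real.pi) Real.pi, HasDerivAt (fun θ => (polarGauss t r s θ *
        (-(r * s * Real.sin θ) / (2 * t)) * Real.cos (m * θ) +
        m * polarGauss t r s θ * Real.sin (m * θ)) * (φ s / s)) (Y (s, θ)) θ := by
      intro θ _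
      have d1 := hasDerivAt_polarGauss_angle ht r s θ
      have d2 : HasDerivAt (fun θ : ℝ => Real.cos (m * θ)) (-Real.sin (m * θ) * (m * 1)) θ :=
        ((hasDerivAt_id θ).const_mul (m : ℝ)).cos
      have d3 : HasDerivAt (fun θ : ℝ => Real.sin (m * θ)) (Real.cos (m * θ) * (m * 1)) θ :=
        ((hasDerivAt_id θ).const_mul (m : ℝ)).sin
      have d4 : HasDerivAt (fun θ : ℝ => -(r * s * Real.sin θ) / (2 * t))
        (-(r * s * Real.cos θ) / (2 * t)) θ :=
        ((Real.hasDerivAt_sin θ).const_mul (r * s)).neg.div_const _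
      refine ((((d1.mul d4).mul d2).add ((d1.const_mul (m : ℝ)).mul d3)).mul_const
        (φ s / s)).congr_deriv ?_
      simp only [hY, Pi.mul_apply]
      ring
    rw [intervalIntegral.integral_eq_sub_of_hasDerivAt hder
      ((cY.comp (by fun_prop : Continuous fun θ : ℝ => (s, θ))).intervalIntegrable _ _)]
    simp [Real.sin_nat_mul_pi]
  have cL := continuous_radialLaplacian m ha hφ h
  have hL : Continuous fun p : ℝ × ℝ => polarGauss t r p.1 p.2 * Real.cos (m * p.2) *
        (radialLaplacian m φ p.1 * p.1) := by fun_prop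
  have hkey : ∀ᵐ p ∂boxMeasure a b,
      polarGaussDt t r p.1 p.2 * Real.cos (m * p.2) * φ p.1 * p.1 =
      polarGauss t r p.1 p.2 * Real.cos (m * p.2) * (radialLaplacian m φ p.1 * p.1) +
        (X p + Y p) := by
    have hmem : ∀ᵐ p ∂boxMeasure a b, p ∈ Ioc a b ×ˢ Ioc (-Real.pi) Real.pi := by
      rw [boxMeasure, Measure.prod_restrict]
      exact ae_restrict_mem (measurableSet_Ioc.prod measurableSet_Ioc)
    filter_upwards [hmem] with p hp
    have hp0 : p.1 ≠ 0 := (ha.trans hp.1.1).ne'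
    simp only [hX, hY, polarGaussDt, radialLaplacian]
    have hs : Real.sin p.2 ^ 2 = 1 - Real.cos p.2 ^ 2 := Real.sin_sq p.2
    rw [mul_pow _ (Real.sin p.2), hs]
    field_simp
    ring
  have hXY : ∫ p, (X p + Y p) ∂boxMeasure a b = 0 := by
    rw [integral_add (integrable_box cX) (integrable_box cY), hXint, hYint, add_zero]
  have hXYi : Integrable (fun p => X p + Y p) (boxMeasure a b) := integrable_box (cX.add cY)
  rw [integral_congr_ae hkey, integral_add (integrable_box hL) hXYi, hXY, add_zero]

lemma heatInt_eq_box (m : ℕ) (t r : ℝ) {f : ℝ → ℝ} {a b : ℝ} (ha : 0 < a)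
    (hf : Continuous f) (h : ∀ r ∉ Ioo a b, f r = 0) :
    heatInt m t f r =
      ∫ p, polarGauss t r p.1 p.2 * Real.cos (m * p.2) * (f p.1 * p.1) ∂boxMeasure a b := by
  have cG := continuous_polarGauss t r
  rw [heatInt, integral_radialMeasure, boxMeasure, integral_prod _ (integrable_box (by fun_prop)),
    setIntegral_eq_of_subset_of_forall_sdiff_eq_zero measurableSet_Ioi
      (fun s hs => ha.trans hs.1 : Ioc a b ⊆ Ioi 0)]
  · refine integral_congr_ae (.of_forall fun s => ?_)
    simp only [integral_mul_const]
    rw [heatKernel_eq, intervalIntegral.integral_of_le (neg_le_self Real.pi_pos.le)]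
    ring
  · intro s hs
    rw [h s fun h' => hs.2 (Ioo_subset_Ioc_self h')]
    ring

lemma heatInt_sub_heatInt (m : ℕ) (r : ℝ) {φ : ℝ → ℝ} {a b : ℝ} (ha : 0 < a) (hab : a < b)
    (hφ : ContDiff ℝ 2 φ) (h : ∀ r ∉ Ioo a b, φ r = 0) {ε t : ℝ} (hε : 0 < ε) (hεt : ε ≤ t) :
    heatInt m t φ r - heatInt m ε φ r = ∫ τ in ε..t, heatInt m τ (radialLaplacian m φ) r := by
  have cφ := hφ.continuous
  have cG := fun t => continuous_polarGauss t r
  have cL := continuous_radialLaplacian m ha hφ h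
  have hL := radialLaplacian_eq_zero m hφ h
  set g : ℝ × ℝ → ℝ → ℝ := fun p τ =>
    polarGaussDt τ r p.1 p.2 * Real.cos (m * p.2) * φ p.1 * p.1 with hg
  have hpos : ∀ τ, 0 < max τ ε := fun τ => lt_max_of_lt_right hε
  -- Replacing τ by `max τ ε` avoids the singularity at time 0 and changes nothing on [ε, t], so
  -- integrability follows from continuity on a compact box.
  have hcont : Continuous fun q : (ℝ × ℝ) × ℝ => g q.1 (max q.2 ε) := by
    have h1 : ∀ q : (ℝ × ℝ) × ℝ, 4 * max q.2 ε ≠ 0 := fun q => by have := hpos q.2; positivity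
    have h2 : ∀ q : (ℝ × ℝ) × ℝ, 4 * Real.pi * max q.2 ε ≠ 0 :=
      fun q => by have := hpos q.2; have := Real.pi_pos; positivity
    have h3 : ∀ q : (ℝ × ℝ) × ℝ, 4 * (max q.2 ε) ^ 2 ≠ 0 :=
      fun q => by have := hpos q.2; positivity
    have h4 : ∀ q : (ℝ × ℝ) × ℝ, max q.2 ε ≠ 0 := fun q => (hpos q.2).ne'
    simp only [hg, polarGaussDt, polarGauss]
    fun_prop (disch := assumption)
  have hint : Integrable (Function.uncurry g) ((boxMeasure a b).prod (volume.restrict (Ioc ε t))) := by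
    have h1 : IntegrableOn (fun q : (ℝ × ℝ) × ℝ => g q.1 (max q.2 ε))
        ((Ioc a b ×ˢ Ioc (-Real.pi) Real.pi) ×ˢ Ioc ε t) :=
      (hcont.continuousOn.integrableOn_compact
        ((isCompact_Icc.prod isCompact_Icc).prod isCompact_Icc)).mono_set
        (prod_mono (prod_mono Ioc_subset_Icc_self Ioc_subset_Icc_self) Ioc_subset_Icc_self)
    rw [boxMeasure, Measure.prod_restrict, Measure.prod_restrict, ← Measure.volume_eq_prod,
      ← Measure.volume_eq_prod]
    refine h1.congr_fun (fun q hq => ?_)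
      ((measurableSet_Ioc.prod measurableSet_Ioc).prod measurableSet_Ioc)
    simp only [Function.uncurry_def]
    rw [max_eq_left hq.2.1.le]
  rw [heatInt_eq_box m t r ha cφ h, heatInt_eq_box m ε r ha cφ h,
    ← integral_sub (integrable_box (by fun_prop)) (integrable_box (by fun_prop))]
  have h1 : ∀ p : ℝ × ℝ, polarGauss t r p.1 p.2 * Real.cos (m * p.2) * (φ p.1 * p.1) -
      polarGauss ε r p.1 p.2 * Real.cos (m * p.2) * (φ p.1 * p.1) =
      ∫ τ in Ioc ε t, g p τ := by
    intro p
    have hder : ∀ τ ∈ uIcc ε t, HasDerivAt (fun τ => polarGauss τ r p.1 p.2 *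
        (Real.cos (m * p.2) * φ p.1 * p.1)) (g p τ) τ := by
      intro τ hτ
      rw [uIcc_of_le hεt] at hτ
      refine ((hasDerivAt_polarGauss_time (hε.trans_le hτ.1) r p.1 p.2).mul_const _).congr_deriv ?_
      simp only [hg]; ring
    have hci : IntervalIntegrable (g p) volume ε t := by
      have : ContinuousOn (g p) (uIcc ε t) := by
        refine (hcont.comp (by fun_prop : Continuous fun τ : ℝ => (p, τ))).continuousOn.congr ?_
        intro τ hτ
        rw [uIcc_of_le hεt] at hτ
        simp only [Function.comp_def]
        rw [max_eq_left hτ.1]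
      exact this.intervalIntegrable
    rw [← intervalIntegral.integral_of_le hεt,
      intervalIntegral.integral_eq_sub_of_hasDerivAt hder hci]
    ring
  simp_rw [h1]
  rw [integral_integral_swap hint, intervalIntegral.integral_of_le hεt]
  refine setIntegral_congr_fun measurableSet_Ioc fun τ hτ => ?_
  simp only [hg]
  rw [integral_box_polarGaussDt m (hε.trans hτ.1) r ha hab hφ h, heatInt_eq_box m τ r ha cL hL]

/-! ### The limit of the propagator at time zero -/

lemma planeGauss_scale {t : ℝ} (ht : 0 < t) (r : ℝ) (w : ℝ × ℝ) :
    t * planeGauss t (r, 0) ((r, 0) + √t • w) = planeGauss 1 0 w := by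
  have h1 : √t ^ 2 = t := Real.sq_sqrt ht.le
  simp only [planeGauss, Prod.fst_add, Prod.snd_add, Prod.smul_fst, Prod.smul_snd, smul_eq_mul,
    Prod.fst_zero, Prod.snd_zero]
  have h2 : -((r - (r + √t * w.1)) ^ 2 + (0 - (0 + √t * w.2)) ^ 2) / (4 * t) =
      -((0 - w.1) ^ 2 + (0 - w.2) ^ 2) / (4 * 1) := by
    rw [show (r - (r + √t * w.1)) ^ 2 + (0 - (0 + √t * w.2)) ^ 2 = √t ^ 2 * (w.1 ^ 2 + w.2 ^ 2)
      by ring, h1]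
    field_simp
    ring
  rw [h2]
  field_simp

/-- Parabolic rescaling fixes the Gaussian and moves the time into the argument of Φ, where
dominated convergence can act. -/
lemma integral_planeGauss_scale {t : ℝ} (ht : 0 < t) (r : ℝ) (Φ : ℝ × ℝ → ℝ) :
    ∫ z, planeGauss t (r, 0) z * Φ z = ∫ w, planeGauss 1 0 w * Φ ((r, 0) + √t • w) := by
  rw [← integral_add_left_eq_self (fun z => planeGauss t (r, 0) z * Φ z) (r, 0)]
  have h := Measure.integral_comp_smul_of_nonneg volume
    (fun z : ℝ × ℝ => planeGauss t (r, 0) ((r, 0) + z) * Φ ((r, 0) + z)) (√t)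
    (hR := Real.sqrt_nonneg t)
  have h2 : (√t ^ Module.finrank ℝ (ℝ × ℝ)) = t := by
    rw [Module.finrank_prod, Module.finrank_self]; exact Real.sq_sqrt ht.le
  rw [h2, smul_eq_mul] at h
  rw [show ∫ z, planeGauss t (r, 0) ((r, 0) + z) * Φ ((r, 0) + z) =
    t * ∫ w, planeGauss t (r, 0) ((r, 0) + √t • w) * Φ ((r, 0) + √t • w) by
      rw [h]; field_simp, ← integral_const_mul]
  refine integral_congr_ae (.of_forall fun w => ?_)
  simp only
  rw [← planeGauss_scale ht r w]
  ring

/-- A non-integrable function has integral 0 by convention, but this integral is 1. -/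
lemma integrable_planeGauss_one : Integrable (planeGauss 1 0) := by
  by_contra h
  have := integral_undef h
  rw [integral_planeGauss one_pos] at this
  exact one_ne_zero this

lemma measurable_polarCoord : Measurable polarCoord := by
  have : (polarCoord : ℝ × ℝ → ℝ × ℝ) = fun q =>
      (√(q.1 ^ 2 + q.2 ^ 2), Complex.arg (Complex.equivRealProdCLM.symm q)) := rfl
  rw [this]
  exact (by fun_prop : Measurable fun q : ℝ × ℝ => √(q.1 ^ 2 + q.2 ^ 2)).prodMk
    (Complex.measurable_arg.comp Complex.equivRealProdCLM.symm.continuous.measurable)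

/-- The mode-`m` function on the plane with radial profile `φ`. -/
def planeMode (m : ℕ) (φ : ℝ → ℝ) (z : ℝ × ℝ) : ℝ :=
  φ (polarCoord z).1 * Real.cos (m * (polarCoord z).2)

lemma heatInt_eq_plane (m : ℕ) {t : ℝ} (ht : 0 < t) {r : ℝ} (hr : 0 ≤ r) {φ : ℝ → ℝ}
    (hφ : Continuous φ) {C : ℝ} (hC : ∀ r, |φ r| ≤ C) :
    heatInt m t φ r = ∫ z, planeGauss t (r, 0) z * planeMode m φ z := by
  rw [← integral_comp_polarCoord_symm, heatInt, integral_radialMeasure]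
  have h1 : ∀ p ∈ polarCoord.target,
      p.1 • (planeGauss t (r, 0) (polarCoord.symm p) * planeMode m φ (polarCoord.symm p)) =
        (p.1 * polarGauss t r p.1 p.2) * (φ p.1 * Real.cos (m * p.2)) := by
    intro p hp
    rw [planeMode, polarCoord.right_inv hp, polarGauss_eq_planeGauss, smul_eq_mul]
    ring
  rw [setIntegral_congr_fun polarCoord.open_target.measurableSet h1, restrict_polarCoord_target,
    integral_prod _ ((integrable_polarGauss ht hr).mul_bdd (c := C) (by fun_prop)
      (.of_forall fun p => ?_))]
  · refine integral_congr_ae (.of_forall fun s => ?_)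
    simp only
    rw [heatKernel_eq, intervalIntegral_pi_eq, ← integral_mul_const, ← integral_mul_const]
    congr 1
    ext θ
    ring
  · rw [norm_mul, Real.norm_eq_abs, Real.norm_eq_abs]
    exact (mul_le_of_le_one_right (abs_nonneg _) (Real.abs_cos_le_one _)).trans (hC _)

/-- After rescaling, this is dominated convergence. Only continuity of the planar extension at the
single point (r, 0) is needed, and since r > 0 that point is off the branch cut of the polar angle.
-/
lemma tendsto_heatInt_zero (m : ℕ) {r : ℝ} (hr : 0 < r) {φ : ℝ → ℝ} (hφ : Continuous φ) {C : ℝ}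
    (hC : ∀ r, |φ r| ≤ C) : Tendsto (fun t => heatInt m t φ r) (𝓝[>] 0) (𝓝 (φ r)) := by
  have hmem : ((r, 0) : ℝ × ℝ) ∈ polarCoord.source := Or.inl hr
  have hval : planeMode m φ (r, 0) = φ r := by
    have h0 : polarCoord ((r, 0) : ℝ × ℝ) = (r, 0) := by
      have h1 : ((r, 0) : ℝ × ℝ) ∈ polarCoord.target :=
        ⟨hr, neg_lt_zero.2 Real.pi_pos, Real.pi_pos⟩
      have := polarCoord.right_inv h1
      simpa using this
    rw [planeMode, h0]
    simp
  have hmeas : Measurable (planeMode m φ) := by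
    have h1 := measurable_polarCoord.fst
    have h2 := measurable_polarCoord.snd
    exact (hφ.measurable.comp h1).mul (Real.measurable_cos.comp (h2.const_mul _))
  have hcont : ContinuousAt (planeMode m φ) (r, 0) := by
    have h1 := polarCoord.continuousAt hmem
    have h2 : Continuous fun p : ℝ × ℝ => φ p.1 * Real.cos (m * p.2) := by fun_prop
    exact h2.continuousAt.comp h1
  have hlim : Tendsto (fun t => ∫ w, planeGauss 1 0 w * planeMode m φ ((r, 0) + √t • w))
      (𝓝[>] 0) (𝓝 (∫ w, planeGauss 1 0 w * planeMode m φ (r, 0))) := by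
    refine tendsto_integral_filter_of_dominated_convergence (fun w => ‖planeGauss 1 0 w‖ * C) ?_ ?_
      (integrable_planeGauss_one.norm.mul_const C) ?_
    · refine .of_forall fun t => ?_
      exact integrable_planeGauss_one.aestronglyMeasurable.mul
        (hmeas.comp (by fun_prop)).aestronglyMeasurable
    · refine .of_forall fun t => .of_forall fun w => ?_
      rw [norm_mul]
      refine mul_le_mul_of_nonneg_left ?_ (norm_nonneg _)
      rw [planeMode, norm_mul, Real.norm_eq_abs, Real.norm_eq_abs]
      exact (mul_le_of_le_one_right (abs_nonneg _) (Real.abs_cos_le_one _)).trans (hC _)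
    · refine .of_forall fun w => Tendsto.const_mul _ ?_
      have h1 : Tendsto (fun t : ℝ => ((r, 0) : ℝ × ℝ) + √t • w) (𝓝[>] 0) (𝓝 (r, 0)) := by
        have : Continuous fun t : ℝ => ((r, 0) : ℝ × ℝ) + √t • w := by fun_prop
        have h2 := this.tendsto 0
        simp only [Real.sqrt_zero, zero_smul, add_zero] at h2
        exact h2.mono_left nhdsWithin_le_nhds
      exact hcont.tendsto.comp h1
  rw [integral_mul_const, integral_planeGauss one_pos, one_mul, hval] at hlim
  refine hlim.congr' ?_
  filter_upwards [self_mem_nhdsWithin] with t ht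
  rw [heatInt_eq_plane m ht hr.le hφ hC, integral_planeGauss_scale ht]

lemma intervalIntegrable_of_bound {f : ℝ → ℝ} (hf : Measurable f) {a b C : ℝ} 
    (hC : ∀ t ∈ Ioc a b, |f t| ≤ C) (hab : a ≤ b) : IntervalIntegrable f volume a b := by
  rw [intervalIntegrable_iff_integrableOn_Ioc_of_le hab]
  refine Measure.integrableOn_of_bounded (M := C) (by simp) hf.aestronglyMeasurable ?_
  exact (ae_restrict_iff' measurableSet_Ioc).2 (.of_forall hC)

/-- For test functions, `e^{tΔ} φ = φ + ∫₀ᵗ e^{τΔ} Δφ dτ`. -/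
lemma heatInt_test (m : ℕ) {r : ℝ} (hr : 0 < r) {φ : ℝ → ℝ} {a b : ℝ} (ha : 0 < a) (hab : a < b)
    (hφ : ContDiff ℝ 2 φ) (h : ∀ r ∉ Ioo a b, φ r = 0) {t : ℝ} (ht : 0 < t) :
    heatInt m t φ r = φ r + ∫ τ in (0 : ℝ)..t, heatInt m τ (radialLaplacian m φ) r := by
  obtain ⟨C, _, hC⟩ := exists_bound_of_support hφ.continuous h
  have cL := continuous_radialLaplacian m ha hφ h
  obtain ⟨D, _, hD⟩ := exists_bound_of_support cL (radialLaplacian_eq_zero m hφ h)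
  have hmeas : Measurable fun τ => heatInt m τ (radialLaplacian m φ) r :=
    measurable_heatInt m (f := fun _ => radialLaplacian m φ) measurable_id measurable_const
      (cL.measurable.comp measurable_snd)
  have hII : IntervalIntegrable (fun τ => heatInt m τ (radialLaplacian m φ) r) volume 0 t :=
    intervalIntegrable_of_bound hmeas
      (fun τ hτ => abs_heatInt_le m hτ.1 hr.le fun s _ => hD s) ht.le
  have h1 := tendsto_heatInt_zero m hr hφ.continuous hC
  have h2 : Tendsto (fun ε => heatInt m t φ r - ∫ τ in ε..t, heatInt m τ (radialLaplacian m φ) r)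
      (𝓝[>] 0) (𝓝 (heatInt m t φ r - ∫ τ in (0 : ℝ)..t, heatInt m τ (radialLaplacian m φ) r)) := by
    refine tendsto_const_nhds.sub ?_
    have h3 := intervalIntegral.continuousOn_primitive_interval_left (μ := volume)
      ((intervalIntegrable_iff_integrableOn_Icc_of_le ht.le).1 hII |> fun h => by
        rwa [← uIcc_of_le ht.le] at h)
    have h4 := h3 0 left_mem_uIcc
    rw [uIcc_of_le ht.le] at h4
    exact h4.mono_left (nhdsWithin_le_of_mem (Icc_mem_nhdsGT ht))
  have h5 : (fun ε => heatInt m t φ r - ∫ τ in ε..t, heatInt m τ (radialLaplacian m φ) r)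
      =ᶠ[𝓝[>] 0] fun ε => heatInt m ε φ r := by
    filter_upwards [Ioc_mem_nhdsGT ht] with ε hε
    rw [← heatInt_sub_heatInt m r ha hab hφ h hε.1 hε.2]
    ring
  have := tendsto_nhds_unique (h2.congr' h5) h1
  linarith

/-! ### Sources and the Duhamel term -/

/-- Bounds for a single source term: `f ∈ L¹(r dr)` and `|f| ≤ C / r²`. -/
structure SliceBound (f : ℝ → ℝ) (M C : ℝ) : Prop where
  int : Integrable f ν
  norm_le : ∫ ρ, |f ρ| ∂ν ≤ M
  bound : ∀ ρ, 0 < ρ → |f ρ| ≤ C / ρ ^ 2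

/-- A time-dependent source term, with bounds that are uniform in time. -/
structure IsSource (f : ℝ → ℝ → ℝ) (M C : ℝ) : Prop where
  meas : Measurable (Function.uncurry f)
  slice : ∀ s, SliceBound (f s) M C

lemma SliceBound.M_nonneg {f : ℝ → ℝ} {M C : ℝ} (h : SliceBound f M C) : 0 ≤ M :=
  (integral_nonneg fun _ => abs_nonneg _).trans h.norm_le

lemma SliceBound.C_nonneg {f : ℝ → ℝ} {M C : ℝ} (h : SliceBound f M C) : 0 ≤ C := by
  have := (abs_nonneg _).trans (h.bound 1 one_pos)
  simpa using this

/-- The bound is uniform in t: off the diagonal the factor exp(-r²/(16t)) is at most 16t/r², which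
absorbs the prefactor 1/(2t). -/
lemma heatKernel_zero_le_of_le_half {t : ℝ} (ht : 0 < t) {r s : ℝ} (hr : 0 < r) (hs : 0 ≤ s)
    (h : s ≤ r / 2) : heatKernel 0 t r s ≤ 8 / r ^ 2 := by
  refine (heatKernel_zero_le_exp ht hr.le hs).trans ?_
  have h1 : -(r - s) ^ 2 / (4 * t) ≤ -(r ^ 2 / (16 * t)) := by
    rw [neg_div, neg_le_neg_iff, div_le_div_iff₀ (by positivity) (by positivity)]
    have : (r / 2) ^ 2 ≤ (r - s) ^ 2 := by
      apply pow_le_pow_left₀ (by positivity); linarith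
    nlinarith
  have h2 : Real.exp (-(r ^ 2 / (16 * t))) ≤ (r ^ 2 / (16 * t))⁻¹ := by
    rw [Real.exp_neg]
    refine inv_anti₀ (by positivity) ?_
    linarith [Real.add_one_le_exp (r ^ 2 / (16 * t))]
  calc 1 / (2 * t) * Real.exp (-(r - s) ^ 2 / (4 * t))
      ≤ 1 / (2 * t) * (r ^ 2 / (16 * t))⁻¹ := by
        gcongr
        exact (Real.exp_le_exp.2 h1).trans h2
    _ = 8 / r ^ 2 := by field_simp; norm_num

/-- Split at ρ = r/2. Below it the kernel is at most 8/r² and f is integrable; above it f is at most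
4C/r² and the kernel has mass 1. The resulting bound on the propagated source does not depend on t,
so the Duhamel integral converges absolutely at every r > 0. -/
lemma SliceBound.heatKernel_mul_le {f : ℝ → ℝ} {M C : ℝ} (h : SliceBound f M C) (m : ℕ) {t : ℝ}
    (ht : 0 < t) {r ρ : ℝ} (hr : 0 < r) (hρ : 0 < ρ) :
    |heatKernel m t r ρ * f ρ| ≤ 4 * C / r ^ 2 * heatKernel 0 t r ρ + 8 / r ^ 2 * |f ρ| := by
  have hC := h.C_nonneg
  have hK := heatKernel_zero_nonneg ht r ρ
  rw [abs_mul]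
  refine (mul_le_mul_of_nonneg_right (abs_heatKernel_le m ht r ρ) (abs_nonneg _)).trans ?_
  rcases le_or_gt ρ (r / 2) with h1 | h1
  · have := mul_le_mul_of_nonneg_right (heatKernel_zero_le_of_le_half ht hr hρ.le h1)
      (abs_nonneg (f ρ))
    have : 0 ≤ 4 * C / r ^ 2 * heatKernel 0 t r ρ := by positivity
    linarith
  · have h2 : |f ρ| ≤ 4 * C / r ^ 2 := by
      refine (h.bound ρ hρ).trans ?_
      rw [div_le_div_iff₀ (by positivity) (by positivity)]
      have : r ^ 2 ≤ 4 * ρ ^ 2 := by nlinarith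
      nlinarith
    have h3 := mul_le_mul_of_nonneg_left h2 hK
    have : 0 ≤ 8 / r ^ 2 * |f ρ| := by positivity
    linarith

lemma SliceBound.abs_heatInt_le {f : ℝ → ℝ} {M C : ℝ} (h : SliceBound f M C) (m : ℕ)
    {t : ℝ} (ht : 0 < t) {r : ℝ} (hr : 0 < r) :
    |heatInt m t f r| ≤ (4 * C + 8 * M) / r ^ 2 := by
  have hi1 := (integrable_heatKernel_zero ht hr.le).const_mul (4 * C / r ^ 2)
  have hi2 := h.int.abs.const_mul (8 / r ^ 2)
  calc |heatInt m t f r|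
      ≤ ∫ ρ, (4 * C / r ^ 2 * heatKernel 0 t r ρ + 8 / r ^ 2 * |f ρ|) ∂ν := by
        rw [heatInt, ← Real.norm_eq_abs]
        exact norm_integral_le_of_norm_le (hi1.add hi2)
          (ae_radialMeasure_of_forall fun _ hρ => h.heatKernel_mul_le m ht hr hρ)
    _ = 4 * C / r ^ 2 + 8 / r ^ 2 * ∫ ρ, |f ρ| ∂ν := by
        rw [integral_add hi1 hi2, integral_const_mul, integral_const_mul,
          integral_heatKernel_zero ht hr.le, mul_one]
    _ ≤ 4 * C / r ^ 2 + 8 / r ^ 2 * M := by gcongr; exact h.norm_le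
    _ = _ := by ring

/-- The Duhamel term `∫₀ᵗ e^{(t-s)Δ} f(s) ds`. -/
def duhamelTerm (m : ℕ) (f : ℝ → ℝ → ℝ) (t r : ℝ) : ℝ :=
  ∫ s in Ioo (0 : ℝ) t, heatInt m (t - s) (f s) r

lemma measurable_heatInt_source (m : ℕ) {f : ℝ → ℝ → ℝ} (hf : Measurable (Function.uncurry f))
    (t : ℝ) : Measurable fun p : ℝ × ℝ => heatInt m (t - p.1) (f p.1) p.2 := by
  refine measurable_heatInt m (α := ℝ × ℝ) (t := fun p => t - p.1) (r := fun p => p.2)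
    (f := fun p => f p.1) (by fun_prop) measurable_snd ?_
  exact hf.comp (by fun_prop : Measurable fun q : (ℝ × ℝ) × ℝ => (q.1.1, q.2))

lemma IsSource.integrableOn_heatInt {f : ℝ → ℝ → ℝ} {M C : ℝ} (hf : IsSource f M C) (m : ℕ)
    (t : ℝ) {r : ℝ} (hr : 0 < r) :
    IntegrableOn (fun s => heatInt m (t - s) (f s) r) (Ioo 0 t) := by
  refine Measure.integrableOn_of_bounded (M := (4 * C + 8 * M) / r ^ 2) (by simp)
    ((measurable_heatInt_source m hf.meas t).comp
      (measurable_id.prodMk measurable_const : Measurable fun s : ℝ => (s, r))).aestronglyMeasurable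
    ((ae_restrict_iff' measurableSet_Ioo).2 (.of_forall fun s hs => ?_))
  exact (hf.slice s).abs_heatInt_le m (sub_pos.2 hs.2) hr

lemma measurable_duhamelTerm (m : ℕ) {f : ℝ → ℝ → ℝ} (hf : Measurable (Function.uncurry f))
    (t : ℝ) : Measurable (duhamelTerm m f t) := by
  refine StronglyMeasurable.measurable ?_
  refine StronglyMeasurable.integral_prod_right (f := fun r s => heatInt m (t - s) (f s) r) ?_
  exact ((measurable_heatInt_source m hf t).comp measurable_swap).stronglyMeasurable

lemma IsSource.abs_duhamelTerm_le {f : ℝ → ℝ → ℝ} {M C : ℝ} (hf : IsSource f M C) (m : ℕ)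
    {t : ℝ} (ht : 0 ≤ t) {r : ℝ} (hr : 0 < r) :
    |duhamelTerm m f t r| ≤ t * ((4 * C + 8 * M) / r ^ 2) := by
  have h := norm_setIntegral_le_of_norm_le_const (μ := volume) (s := Ioo 0 t)
    (f := fun s => heatInt m (t - s) (f s) r) (C := (4 * C + 8 * M) / r ^ 2) (by simp)
    fun s hs => (hf.slice s).abs_heatInt_le m (sub_pos.2 hs.2) hr
  rw [Real.norm_eq_abs] at h
  refine h.trans (le_of_eq ?_)
  rw [mul_comm, Measure.real, Real.volume_Ioo, sub_zero, ENNReal.toReal_ofReal ht]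

/-! ### The semigroup property -/

lemma integrable_heatKernel_zero_mul {t t' : ℝ} (ht : 0 < t) (ht' : 0 < t') {r s' : ℝ}
    (hr : 0 ≤ r) (hs' : 0 ≤ s') :
    Integrable (fun s => heatKernel 0 t r s * heatKernel 0 t' s s') ν := by
  refine (integrable_heatKernel_zero ht hr).mul_bdd (c := 1 / (2 * t')) ?_
    (ae_radialMeasure_of_forall fun s hs => ?_)
  · simp_rw [heatKernel_symm 0 t' _ s']
    exact aesm_heatKernel 0 t' s'
  · rw [Real.norm_eq_abs, abs_of_nonneg (heatKernel_zero_nonneg ht' _ _)]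
    exact heatKernel_zero_le ht' hs.le hs'

lemma heatInt_heatInt (m : ℕ) {t t' : ℝ} (ht : 0 < t) (ht' : 0 < t') {r : ℝ} (hr : 0 ≤ r)
    {v : ℝ → ℝ} (hv : Measurable v) {B : ℝ} (hB : ∀ s, 0 < s → |v s| ≤ B) :
    heatInt m t (heatInt m t' v) r = heatInt m (t + t') v r := by
  set g : ℝ → ℝ → ℝ := fun ρ σ => heatKernel m t r ρ * (heatKernel m t' ρ σ * v σ) with hg
  have hmeas : Measurable (Function.uncurry g) := by
    have h1 := (measurable_heatKernel m).comp (by fun_prop : Measurable fun p : ℝ × ℝ => (t, r, p.1))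
    have h2 := (measurable_heatKernel m).comp
      (by fun_prop : Measurable fun p : ℝ × ℝ => (t', p.1, p.2))
    exact h1.mul (h2.mul (hv.comp measurable_snd))
  have hle : ∀ ρ σ, 0 < σ → ‖g ρ σ‖ ≤ heatKernel 0 t r ρ * heatKernel 0 t' ρ σ * B := by
    intro ρ σ hσ
    simp only [hg, norm_mul, Real.norm_eq_abs]
    rw [mul_assoc]
    gcongr
    · exact heatKernel_zero_nonneg ht _ _
    · exact abs_heatKernel_le m ht _ _
    · exact heatKernel_zero_nonneg ht' _ _
    · exact abs_heatKernel_le m ht' _ _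
    · exact hB σ hσ
  have hint : Integrable (Function.uncurry g) (Measure.prod ν ν) := by
    rw [integrable_prod_iff' hmeas.aestronglyMeasurable]
    refine ⟨ae_radialMeasure_of_forall fun σ hσ => ?_, ?_⟩
    · exact ((integrable_heatKernel_zero_mul ht ht' hr hσ.le).mul_const B).mono'
        (hmeas.comp (by fun_prop : Measurable fun ρ : ℝ => (ρ, σ))).aestronglyMeasurable
        (.of_forall fun ρ => hle ρ σ hσ)
    · refine ((integrable_heatKernel_zero (add_pos ht ht') hr).mul_const B).mono' ?_
        (ae_radialMeasure_of_forall fun σ hσ => ?_)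
      · exact hmeas.norm.aestronglyMeasurable.prod_swap.integral_prod_right'
      · rw [Real.norm_eq_abs, abs_of_nonneg (integral_nonneg fun _ => norm_nonneg _),
          ← integral_heatKernel_mul 0 ht ht' hr hσ.le, ← integral_mul_const]
        exact integral_mono_of_nonneg (.of_forall fun _ => norm_nonneg _)
          ((integrable_heatKernel_zero_mul ht ht' hr hσ.le).mul_const B)
          (.of_forall fun ρ => hle ρ σ hσ)
  have h1 : heatInt m t (heatInt m t' v) r = ∫ ρ, ∫ σ, g ρ σ ∂ν ∂ν := by
    rw [heatInt]
    refine integral_congr_ae (.of_forall fun ρ => ?_)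
    simp only [hg, integral_const_mul]
    rfl
  rw [h1, integral_integral_swap hint, heatInt]
  refine integral_radialMeasure_congr fun σ hσ => ?_
  simp only [hg, ← mul_assoc]
  rw [integral_mul_const, integral_heatKernel_mul m ht ht' hr hσ.le]

lemma IsSource.integrable_prod {f : ℝ → ℝ → ℝ} {M C : ℝ} (hf : IsSource f M C) (t : ℝ) :
    Integrable (Function.uncurry f) ((volume.restrict (Ioo 0 t)).prod ν) := by
  rw [integrable_prod_iff hf.meas.aestronglyMeasurable]
  refine ⟨.of_forall fun s => (hf.slice s).int, ?_⟩
  refine Measure.integrableOn_of_bounded (M := M) (by simp) ?_ (.of_forall fun s => ?_)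
  · exact hf.meas.norm.stronglyMeasurable.integral_prod_right'.aestronglyMeasurable
  · rw [Real.norm_eq_abs, abs_of_nonneg (integral_nonneg fun _ => norm_nonneg _)]
    exact (hf.slice s).norm_le

lemma ae_prod_Ioo_radial (t : ℝ) {p : ℝ × ℝ → Prop}
    (h : ∀ s σ : ℝ, s ∈ Ioo 0 t → 0 < σ → p (s, σ)) :
    ∀ᵐ q ∂((volume.restrict (Ioo 0 t)).prod ν), p q := by
  have h1 : ∀ᵐ q ∂((volume.restrict (Ioo 0 t)).prod ν), q.1 ∈ Ioo 0 t :=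
    Measure.quasiMeasurePreserving_fst.ae (ae_restrict_mem measurableSet_Ioo)
  have h2 : ∀ᵐ q ∂((volume.restrict (Ioo 0 t)).prod ν), 0 < q.2 :=
    Measure.quasiMeasurePreserving_snd.ae ae_radialMeasure_pos
  filter_upwards [h1, h2] with q hq1 hq2
  exact h q.1 q.2 hq1 hq2

/-- Fubini and the Chapman-Kolmogorov identity. Absolute integrability holds because the composed
mode-0 kernel has time at least τ, hence is at most 1/(2τ), while the source is integrable. -/
lemma heatInt_duhamelTerm (m : ℕ) {f : ℝ → ℝ → ℝ} {M C : ℝ} (hf : IsSource f M C) {τ : ℝ}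
    (hτ : 0 < τ) (a : ℝ) {r : ℝ} (hr : 0 < r) :
    heatInt m τ (duhamelTerm m f a) r = ∫ s in Ioo 0 a, heatInt m (τ + (a - s)) (f s) r := by
  set κ := (volume.restrict (Ioo 0 a)).prod ν with hκ
  set g : ℝ → ℝ × ℝ → ℝ := fun ρ q =>
    heatKernel m τ r ρ * (heatKernel m (a - q.1) ρ q.2 * f q.1 q.2) with hg
  have hmeas : Measurable (Function.uncurry g) := by
    have h1 := (measurable_heatKernel m).comp
      (by fun_prop : Measurable fun p : ℝ × ℝ × ℝ => (τ, r, p.1))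
    have h2 := (measurable_heatKernel m).comp
      (by fun_prop : Measurable fun p : ℝ × ℝ × ℝ => (a - p.2.1, p.1, p.2.2))
    exact h1.mul (h2.mul (hf.meas.comp measurable_snd))
  have hle : ∀ ρ s σ, s ∈ Ioo 0 a → ‖g ρ (s, σ)‖ ≤
      heatKernel 0 τ r ρ * heatKernel 0 (a - s) ρ σ * |f s σ| := by
    intro ρ s σ hs
    simp only [hg, norm_mul, Real.norm_eq_abs]
    rw [mul_assoc]
    have hs' := sub_pos.2 hs.2
    gcongr
    · exact heatKernel_zero_nonneg hτ _ _
    · exact abs_heatKernel_le m hτ _ _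
    · exact abs_heatKernel_le m hs' _ _
  have hint : Integrable (Function.uncurry g) (Measure.prod ν κ) := by
    rw [integrable_prod_iff' hmeas.aestronglyMeasurable]
    refine ⟨ae_prod_Ioo_radial a fun s σ hs hσ => ?_, ?_⟩
    · exact ((integrable_heatKernel_zero_mul hτ (sub_pos.2 hs.2) hr.le hσ.le).mul_const _).mono'
        (hmeas.comp (by fun_prop : Measurable fun ρ : ℝ => (ρ, s, σ))).aestronglyMeasurable
        (.of_forall fun ρ => hle ρ s σ hs)
    · refine ((hf.integrable_prod a).norm.const_mul (1 / (2 * τ))).mono' ?_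
        (ae_prod_Ioo_radial a fun s σ hs hσ => ?_)
      · exact hmeas.norm.aestronglyMeasurable.prod_swap.integral_prod_right'
      · have hs' := sub_pos.2 hs.2
        have hpos : 0 < τ + (a - s) := add_pos hτ hs'
        rw [Real.norm_eq_abs, abs_of_nonneg (integral_nonneg fun _ => norm_nonneg _)]
        calc ∫ ρ, ‖g ρ (s, σ)‖ ∂ν
            ≤ ∫ ρ, heatKernel 0 τ r ρ * heatKernel 0 (a - s) ρ σ * |f s σ| ∂ν :=
              integral_mono_of_nonneg (.of_forall fun _ => norm_nonneg _)
                ((integrable_heatKernel_zero_mul hτ hs' hr.le hσ.le).mul_const _)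
                (.of_forall fun ρ => hle ρ s σ hs)
          _ = heatKernel 0 (τ + (a - s)) r σ * |f s σ| := by
              rw [integral_mul_const, integral_heatKernel_mul 0 hτ hs' hr.le hσ.le]
          _ ≤ 1 / (2 * τ) * ‖f s σ‖ := by
              rw [Real.norm_eq_abs]
              refine mul_le_mul_of_nonneg_right ?_ (abs_nonneg _)
              refine (heatKernel_zero_le hpos hr.le hσ.le).trans ?_
              gcongr
              linarith
  have h1 : heatInt m τ (duhamelTerm m f a) r = ∫ ρ, ∫ q, g ρ q ∂κ ∂ν := by
    rw [heatInt]
    refine integral_congr_ae ?_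
    filter_upwards [ae_radialMeasure_pos, hint.prod_right_ae] with ρ hρ hi
    rw [hκ, integral_prod (g ρ) hi, duhamelTerm, ← integral_const_mul]
    refine integral_congr_ae (.of_forall fun s => ?_)
    simp only [hg, integral_const_mul]
    rfl
  rw [h1, integral_integral_swap hint, hκ, integral_prod (fun q => ∫ ρ, g ρ q ∂ν)
    hint.integral_prod_right]
  refine setIntegral_congr_fun measurableSet_Ioo fun s hs => ?_
  simp only [heatInt]
  refine integral_radialMeasure_congr fun σ hσ => ?_
  simp only [hg, ← mul_assoc]
  rw [integral_mul_const, integral_heatKernel_mul m hτ (sub_pos.2 hs.2) hr.le hσ.le]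

/-! ### Duality and the weak form of the Duhamel formula -/

/-- `v` is the sum of a bounded and an integrable function, in absolute value. -/
structure IsBddAddInt (v w : ℝ → ℝ) (B : ℝ) : Prop where
  aesm : AEStronglyMeasurable v ν
  int : Integrable w ν
  nonneg : ∀ r, 0 ≤ w r
  bound : ∀ r, 0 < r → |v r| ≤ B + w r

/-- This case is for initial data, which are bounded; `of_integrable` is for the nonlinearity, which
is integrable. -/
lemma IsBddAddInt.of_bound {v : ℝ → ℝ} {B : ℝ} (hv : AEStronglyMeasurable v ν)
    (hB : ∀ r, 0 < r → |v r| ≤ B) : IsBddAddInt v 0 B :=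
  ⟨hv, integrable_zero _ _ _, fun _ => le_rfl, fun r hr => by simpa using hB r hr⟩

lemma IsBddAddInt.of_integrable {v : ℝ → ℝ} (hv : Integrable v ν) :
    IsBddAddInt v (fun r => |v r|) 0 :=
  ⟨hv.aestronglyMeasurable, hv.abs, fun _ => abs_nonneg _, fun r _ => by simp⟩

lemma integrable_mul_heatKernel_zero {w : ℝ → ℝ} (hw : Integrable w ν) {t : ℝ} (ht : 0 < t) :
    Integrable (fun p : ℝ × ℝ => w p.1 * heatKernel 0 t p.1 p.2) (Measure.prod ν ν) := by
  have hm : Measurable fun p : ℝ × ℝ => heatKernel 0 t p.1 p.2 :=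
    (measurable_heatKernel 0).comp (by fun_prop : Measurable fun p : ℝ × ℝ => (t, p.1, p.2))
  have ha : AEStronglyMeasurable (fun p : ℝ × ℝ => w p.1 * heatKernel 0 t p.1 p.2)
      (Measure.prod ν ν) := hw.aestronglyMeasurable.comp_fst.mul hm.aestronglyMeasurable
  have h0 : ∀ r, 0 < r → Integrable (fun s => w r * heatKernel 0 t r s) ν := fun r hr =>
    (integrable_heatKernel_zero ht hr.le).const_mul _
  refine (integrable_prod_iff ha).2 ⟨ae_radialMeasure_of_forall h0, ?_⟩
  have h1 : ∀ r, 0 < r → ∫ s, ‖w r * heatKernel 0 t r s‖ ∂ν = ‖w r‖ := by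
    intro r hr
    have h2 : ∀ s, ‖w r * heatKernel 0 t r s‖ = ‖w r‖ * heatKernel 0 t r s := fun s => by
      rw [norm_mul, Real.norm_of_nonneg (heatKernel_zero_nonneg ht r s)]
    rw [integral_congr_ae (.of_forall h2), integral_const_mul, integral_heatKernel_zero ht hr.le,
      mul_one]
  exact hw.norm.congr (ae_radialMeasure_of_forall fun r hr => (h1 r hr).symm)

lemma integrable_heatKernel_zero_mul_right {w : ℝ → ℝ} (hw : Integrable w ν) {t : ℝ} (ht : 0 < t) :
    Integrable (fun p : ℝ × ℝ => heatKernel 0 t p.1 p.2 * w p.2) (Measure.prod ν ν) := by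
  refine (integrable_mul_heatKernel_zero hw ht).swap.congr (.of_forall fun p => ?_)
  simp only [Function.comp_apply, Prod.fst_swap, Prod.snd_swap]
  rw [heatKernel_symm, mul_comm]

namespace IsBddAddInt

variable {v w : ℝ → ℝ} {B : ℝ} {ψ : ℝ → ℝ} {D : ℝ}

lemma integrable_prod (h : IsBddAddInt v w B) (m : ℕ) {t : ℝ} (ht : 0 < t)
    (hψ : Integrable ψ ν) (hD : ∀ r, |ψ r| ≤ D) :
    Integrable (fun p : ℝ × ℝ => v p.1 * (heatKernel m t p.1 p.2 * ψ p.2)) (Measure.prod ν ν) := by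
  have hm : Measurable fun p : ℝ × ℝ => heatKernel m t p.1 p.2 :=
    (measurable_heatKernel m).comp (by fun_prop : Measurable fun p : ℝ × ℝ => (t, p.1, p.2))
  refine (((integrable_heatKernel_zero_mul_right hψ.abs ht).const_mul B).add
    ((integrable_mul_heatKernel_zero h.int ht).mul_const D)).mono'
    ((h.aesm.comp_fst).mul (hm.aestronglyMeasurable.mul hψ.aestronglyMeasurable.comp_snd)) ?_
  have h1 : ∀ᵐ p ∂(Measure.prod ν ν), 0 < p.1 :=
    Measure.quasiMeasurePreserving_fst.ae ae_radialMeasure_pos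
  filter_upwards [h1] with p hp
  have hK := heatKernel_zero_nonneg ht p.1 p.2
  have hB := (abs_nonneg _).trans (h.bound p.1 hp)
  simp only [Pi.add_apply, norm_mul, Real.norm_eq_abs]
  calc |v p.1| * (|heatKernel m t p.1 p.2| * |ψ p.2|)
      ≤ (B + w p.1) * (heatKernel 0 t p.1 p.2 * |ψ p.2|) := by
        gcongr
        · exact h.bound _ hp
        · exact abs_heatKernel_le m ht _ _
    _ = B * (heatKernel 0 t p.1 p.2 * |ψ p.2|) + w p.1 * heatKernel 0 t p.1 p.2 * |ψ p.2| := by ring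
    _ ≤ _ := by
        gcongr
        · exact mul_nonneg (h.nonneg _) hK
        · exact hD _

/-- The kernel is symmetric, so the propagator is self-adjoint. -/
lemma integral_mul_heatInt (h : IsBddAddInt v w B) (m : ℕ) {t : ℝ} (ht : 0 < t)
    (hψ : Integrable ψ ν) (hD : ∀ r, |ψ r| ≤ D) :
    ∫ r, v r * heatInt m t ψ r ∂ν = ∫ r, heatInt m t v r * ψ r ∂ν := by
  have h1 := integral_integral_swap
    (f := fun r s => v r * (heatKernel m t r s * ψ s)) (h.integrable_prod m ht hψ hD)
  simp only [integral_const_mul] at h1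
  rw [show ∫ r, v r * heatInt m t ψ r ∂ν = ∫ r, v r * ∫ s, heatKernel m t r s * ψ s ∂ν ∂ν from rfl,
    h1]
  refine integral_congr_ae (.of_forall fun s => ?_)
  simp only [heatInt]
  rw [← integral_mul_const]
  refine integral_congr_ae (.of_forall fun r => ?_)
  simp only
  rw [heatKernel_symm]
  ring

lemma integrable_mul_heatInt (h : IsBddAddInt v w B) (m : ℕ) {t : ℝ} (ht : 0 < t)
    (hψ : Integrable ψ ν) (hD : ∀ r, |ψ r| ≤ D) :
    Integrable (fun r => v r * heatInt m t ψ r) ν := by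
  have := (h.integrable_prod m ht hψ hD).integral_prod_left
  simp only [integral_const_mul] at this
  exact this

/-- The bound is uniform in t: the bounded part of v is paired with the L¹ contraction property of
the mode-0 flow, the integrable part with the maximum principle for ψ. -/
lemma integral_abs_mul_heatInt_le (h : IsBddAddInt v w B) (m : ℕ) {t : ℝ} (ht : 0 < t)
    (hψ : Integrable ψ ν) (hD : ∀ r, |ψ r| ≤ D) :
    ∫ r, |v r * heatInt m t ψ r| ∂ν ≤ |B| * ∫ r, |ψ r| ∂ν + (∫ r, w r ∂ν) * D := by
  have i1 := (integrable_heatKernel_zero_mul_right hψ.abs ht)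
  have i2 : Integrable (fun r => |B| * ∫ s, heatKernel 0 t r s * |ψ s| ∂ν) ν :=
    i1.integral_prod_left.const_mul _
  have i3 : Integrable (fun r => w r * D) ν := h.int.mul_const D
  calc ∫ r, |v r * heatInt m t ψ r| ∂ν
      ≤ ∫ r, (|B| * ∫ s, heatKernel 0 t r s * |ψ s| ∂ν) + w r * D ∂ν := by
        refine integral_mono_ae (h.integrable_mul_heatInt m ht hψ hD).abs (i2.add i3)
          (ae_radialMeasure_of_forall fun r hr => ?_)
        simp only [abs_mul]
        have hh : |heatInt m t ψ r| ≤ ∫ s, heatKernel 0 t r s * |ψ s| ∂ν := by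
          rw [heatInt, ← Real.norm_eq_abs]
          refine norm_integral_le_of_norm_le ?_ (.of_forall fun s => ?_)
          · exact integrable_heatKernel_mul 0 ht hr.le hψ.aestronglyMeasurable.norm
              (C := D) fun s _ => by simpa using hD s
          · rw [norm_mul]
            exact mul_le_mul_of_nonneg_right (abs_heatKernel_le m ht r s) (abs_nonneg _)
        have hh2 : |heatInt m t ψ r| ≤ D := CorotationalHeatFlow.abs_heatInt_le m ht hr.le fun s _ => hD s
        calc |v r| * |heatInt m t ψ r| ≤ (|B| + w r) * |heatInt m t ψ r| := by
              gcongr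
              exact (h.bound r hr).trans (by gcongr; exact le_abs_self B)
          _ = |B| * |heatInt m t ψ r| + w r * |heatInt m t ψ r| := by ring
          _ ≤ _ := by
              gcongr
              exact h.nonneg r
    _ = |B| * ∫ r, |ψ r| ∂ν + (∫ r, w r ∂ν) * D := by
        rw [integral_add i2 i3, integral_const_mul, integral_mul_const]
        congr 2
        rw [integral_integral_swap i1]
        refine integral_radialMeasure_congr fun s hs => ?_
        rw [integral_mul_const]
        simp_rw [heatKernel_symm 0 t _ s]
        rw [integral_heatKernel_zero ht hs.le, one_mul]

/-- The weak linear equation. The propagator is moved onto φ by self-adjointness, the identity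
`heatInt_test` is applied there, and the propagator is moved back. -/
lemma integral_heatInt_mul_test (h : IsBddAddInt v w B) (m : ℕ) {φ : ℝ → ℝ} {a b : ℝ}
    (ha : 0 < a) (hab : a < b) (hφ : ContDiff ℝ 2 φ) (hs : ∀ r ∉ Ioo a b, φ r = 0) {t : ℝ}
    (ht : 0 < t) :
    ∫ r, heatInt m t v r * φ r ∂ν = ∫ r, v r * φ r ∂ν +
      ∫ τ in Ioo 0 t, ∫ r, heatInt m τ v r * radialLaplacian m φ r ∂ν ∧
    IntegrableOn (fun τ => ∫ r, heatInt m τ v r * radialLaplacian m φ r ∂ν) (Ioo 0 t) := by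
  have cL := continuous_radialLaplacian m ha hφ hs
  have hL := radialLaplacian_eq_zero m hφ hs
  obtain ⟨C, hC0, hC⟩ := exists_bound_of_support hφ.continuous hs
  obtain ⟨D, _, hD⟩ := exists_bound_of_support cL hL
  have iφ := integrable_of_support hφ.continuous hs
  have iL := integrable_of_support cL hL
  set g : ℝ → ℝ → ℝ := fun r τ => v r * heatInt m τ (radialLaplacian m φ) r with hg
  have hm : Measurable fun p : ℝ × ℝ => heatInt m p.2 (radialLaplacian m φ) p.1 :=
    measurable_heatInt m (α := ℝ × ℝ) (f := fun _ => radialLaplacian m φ) measurable_snd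
      measurable_fst (cL.measurable.comp measurable_snd)
  have hgm : AEStronglyMeasurable (Function.uncurry g)
      (Measure.prod ν (volume.restrict (Ioo 0 t))) := h.aesm.comp_fst.mul hm.aestronglyMeasurable
  have hint : Integrable (Function.uncurry g) (Measure.prod ν (volume.restrict (Ioo 0 t))) := by
    rw [integrable_prod_iff' hgm]
    refine ⟨(ae_restrict_iff' measurableSet_Ioo).2 (.of_forall fun τ hτ =>
      h.integrable_mul_heatInt m hτ.1 iL hD), ?_⟩
    refine Integrable.of_bound hgm.norm.prod_swap.integral_prod_right'
      (|B| * ∫ r, |radialLaplacian m φ r| ∂ν + (∫ r, w r ∂ν) * D)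
      ((ae_restrict_iff' measurableSet_Ioo).2 (.of_forall fun τ hτ => ?_))
    rw [Real.norm_eq_abs, abs_of_nonneg (integral_nonneg fun _ => norm_nonneg _)]
    exact h.integral_abs_mul_heatInt_le m hτ.1 iL hD
  have ivφ : Integrable (fun r => v r * φ r) ν := by
    refine ((iφ.abs.const_mul B).add (h.int.mul_const C)).mono'
      (h.aesm.mul iφ.aestronglyMeasurable) (ae_radialMeasure_of_forall fun r hr => ?_)
    simp only [Pi.add_apply, norm_mul, Real.norm_eq_abs]
    calc |v r| * |φ r| ≤ (B + w r) * |φ r| := by gcongr; exact h.bound r hr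
      _ = B * |φ r| + w r * |φ r| := by ring
      _ ≤ _ := by gcongr; exacts [h.nonneg r, hC r]
  have h1 : ∀ r, 0 < r → v r * heatInt m t φ r = v r * φ r + ∫ τ in Ioo 0 t, g r τ := by
    intro r hr
    rw [heatInt_test m hr ha hab hφ hs ht, mul_add, intervalIntegral.integral_of_le ht.le,
      integral_Ioc_eq_integral_Ioo, ← integral_const_mul]
  have h2 : ∀ τ ∈ Ioo 0 t, ∫ r, g r τ ∂ν =
      ∫ r, heatInt m τ v r * radialLaplacian m φ r ∂ν := fun τ hτ =>
    h.integral_mul_heatInt m hτ.1 iL hD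
  refine ⟨?_, hint.integral_prod_right.congr
    ((ae_restrict_iff' measurableSet_Ioo).2 (.of_forall h2))⟩
  rw [← h.integral_mul_heatInt m ht iφ hC, integral_radialMeasure_congr h1,
    integral_add (g := fun r => ∫ τ in Ioo 0 t, g r τ) ivφ hint.integral_prod_left,
    integral_integral_swap hint]
  congr 1
  exact setIntegral_congr_fun measurableSet_Ioo h2

end IsBddAddInt

/-- Fubini on the triangle 0 < s < τ < t. The bound on P is assumed only for s < τ, so P is cut off
to 0 elsewhere. -/
lemma integral_Ioo_triangle {P : ℝ → ℝ → ℝ} (hP : Measurable (Function.uncurry P)) {D : ℝ}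
    {t : ℝ} (hD : ∀ s τ, 0 < s → s < τ → |P s τ| ≤ D) :
    IntegrableOn (fun s => ∫ τ in Ioo s t, P s τ) (Ioo 0 t) ∧
    IntegrableOn (fun τ => ∫ s in Ioo 0 τ, P s τ) (Ioo 0 t) ∧
    ∫ s in Ioo 0 t, ∫ τ in Ioo s t, P s τ = ∫ τ in Ioo 0 t, ∫ s in Ioo 0 τ, P s τ := by
  set g : ℝ → ℝ → ℝ := fun s τ => {q : ℝ × ℝ | q.1 < q.2}.indicator (Function.uncurry P) (s, τ)
    with hg
  have hgm : Measurable (Function.uncurry g) :=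
    hP.indicator (measurableSet_lt measurable_fst measurable_snd)
  have hint : Integrable (Function.uncurry g)
      ((volume.restrict (Ioo 0 t)).prod (volume.restrict (Ioo 0 t))) := by
    rw [Measure.prod_restrict]
    refine Measure.integrableOn_of_bounded (M := |D|) ?_ hgm.aestronglyMeasurable ?_
    · rw [Measure.prod_prod]; simp [ENNReal.mul_eq_top]
    · refine (ae_restrict_iff' (measurableSet_Ioo.prod measurableSet_Ioo)).2
        (.of_forall fun q hq => ?_)
      simp only [hg, Function.uncurry_def, Real.norm_eq_abs]
      by_cases hlt : q.1 < q.2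
      · rw [indicator_of_mem (by exact hlt)]
        exact (hD _ _ hq.1.1 hlt).trans (le_abs_self D)
      · rw [indicator_of_notMem (by exact hlt), abs_zero]; exact abs_nonneg _
  have h1 := integral_integral_swap hint
  have h2 : ∀ s ∈ Ioo 0 t, ∫ τ in Ioo s t, P s τ = ∫ τ in Ioo 0 t, g s τ := by
    intro s hs
    have : g s = (Ioi s).indicator (P s) := by
      ext τ
      simp only [hg, indicator, mem_ofPred_eq, mem_Ioi, Function.uncurry_def]
    rw [this, setIntegral_indicator measurableSet_Ioi]
    congr 2
    ext τ
    simp only [mem_Ioo, mem_inter_iff, mem_Ioi]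
    exact ⟨fun h => ⟨⟨hs.1.trans h.1, h.2⟩, h.1⟩, fun h => ⟨h.2, h.1.2⟩⟩
  have h3 : ∀ τ ∈ Ioo 0 t, ∫ s in Ioo 0 τ, P s τ = ∫ s in Ioo 0 t, g s τ := by
    intro τ hτ
    have : (fun s => g s τ) = (Iio τ).indicator (fun s => P s τ) := by
      ext s
      simp only [hg, indicator, mem_ofPred_eq, mem_Iio, Function.uncurry_def]
    rw [this, setIntegral_indicator measurableSet_Iio]
    congr 2
    ext s
    simp only [mem_Ioo, mem_inter_iff, mem_Iio]
    exact ⟨fun h => ⟨⟨h.1, h.2.trans hτ.2⟩, h.2⟩, fun h => ⟨h.1.1, h.2⟩⟩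
  refine ⟨hint.integral_prod_left.congr ((ae_restrict_iff' measurableSet_Ioo).2
      (.of_forall fun s hs => (h2 s hs).symm)), hint.integral_prod_right.congr
      ((ae_restrict_iff' measurableSet_Ioo).2 (.of_forall fun τ hτ => (h3 τ hτ).symm)), ?_⟩
  rw [setIntegral_congr_fun measurableSet_Ioo h2, setIntegral_congr_fun measurableSet_Ioo h3]
  exact h1

namespace IsSource

variable {f : ℝ → ℝ → ℝ} {M C : ℝ}

lemma integral_duhamelTerm_mul (hf : IsSource f M C) (m : ℕ) {ψ : ℝ → ℝ} {a b : ℝ} (ha : 0 < a)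
    (hψ : Continuous ψ) (hs : ∀ r ∉ Ioo a b, ψ r = 0) (t : ℝ) :
    ∫ r, duhamelTerm m f t r * ψ r ∂ν =
      ∫ s in Ioo 0 t, ∫ r, heatInt m (t - s) (f s) r * ψ r ∂ν := by
  have iψ := integrable_of_support hψ hs
  set g : ℝ → ℝ → ℝ := fun r s => heatInt m (t - s) (f s) r * ψ r with hg
  have hgm : Measurable (Function.uncurry g) :=
    ((measurable_heatInt_source m hf.meas t).comp measurable_swap).mul
      (hψ.measurable.comp measurable_fst)
  have hint : Integrable (Function.uncurry g) (Measure.prod ν (volume.restrict (Ioo 0 t))) := by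
    refine ((iψ.abs.const_mul ((4 * C + 8 * M) / a ^ 2)).mul_prod
      (integrable_const (μ := volume.restrict (Ioo 0 t)) (1 : ℝ))).mono'
      hgm.aestronglyMeasurable ?_
    have h2 : ∀ᵐ q ∂(Measure.prod ν (volume.restrict (Ioo 0 t))), q.2 ∈ Ioo 0 t :=
      Measure.quasiMeasurePreserving_snd.ae (ae_restrict_mem measurableSet_Ioo)
    filter_upwards [h2] with q hq
    simp only [hg, Function.uncurry_def, norm_mul, Real.norm_eq_abs, mul_one]
    by_cases hr : q.1 ∈ Ioo a b
    · have hr0 : 0 < q.1 := ha.trans hr.1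
      have hMC : 0 ≤ 4 * C + 8 * M := by
        have := (hf.slice 0).C_nonneg; have := (hf.slice 0).M_nonneg; linarith
      gcongr
      refine ((hf.slice q.2).abs_heatInt_le m (sub_pos.2 hq.2) hr0).trans ?_
      gcongr
      exact hr.1.le
    · rw [hs _ hr]; simp
  have h1 := integral_integral_swap hint
  rw [← h1]
  refine integral_congr_ae (.of_forall fun r => ?_)
  simp only [hg, duhamelTerm]
  rw [integral_mul_const]

lemma integrable_duhamelTerm_mul (hf : IsSource f M C) (m : ℕ) {ψ : ℝ → ℝ} {a b : ℝ} (ha : 0 < a)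
    (hψ : Continuous ψ) (hs : ∀ r ∉ Ioo a b, ψ r = 0) {t : ℝ} (ht : 0 ≤ t) :
    Integrable (fun r => duhamelTerm m f t r * ψ r) ν := by
  have iψ := integrable_of_support hψ hs
  refine (iψ.abs.const_mul (t * ((4 * C + 8 * M) / a ^ 2))).mono'
    ((measurable_duhamelTerm m hf.meas t).aestronglyMeasurable.mul iψ.aestronglyMeasurable)
    (.of_forall fun r => ?_)
  rw [norm_mul, Real.norm_eq_abs, Real.norm_eq_abs]
  by_cases hr : r ∈ Ioo a b
  · have hr0 : 0 < r := ha.trans hr.1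
    have hMC : 0 ≤ 4 * C + 8 * M := by
      have := (hf.slice 0).C_nonneg; have := (hf.slice 0).M_nonneg; linarith
    gcongr
    refine (hf.abs_duhamelTerm_le m ht hr0).trans ?_
    gcongr
    exact hr.1.le
  · rw [hs _ hr]; simp

/-- The weak form of the Duhamel term. -/
lemma integral_duhamelTerm_test (hf : IsSource f M C) (m : ℕ) {φ : ℝ → ℝ} {a b : ℝ}
    (ha : 0 < a) (hab : a < b) (hφ : ContDiff ℝ 2 φ) (hs : ∀ r ∉ Ioo a b, φ r = 0) {t : ℝ} :
    ∫ r, duhamelTerm m f t r * φ r ∂ν = (∫ s in Ioo 0 t, ∫ r, f s r * φ r ∂ν) +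
      ∫ τ in Ioo 0 t, ∫ r, duhamelTerm m f τ r * radialLaplacian m φ r ∂ν ∧
    IntegrableOn (fun τ => ∫ r, duhamelTerm m f τ r * radialLaplacian m φ r ∂ν) (Ioo 0 t) ∧
    IntegrableOn (fun s => ∫ r, f s r * φ r ∂ν) (Ioo 0 t) := by
  have cL := continuous_radialLaplacian m ha hφ hs
  have hL := radialLaplacian_eq_zero m hφ hs
  obtain ⟨E, hE0, hE⟩ := exists_bound_of_support hφ.continuous hs
  obtain ⟨D, hD0, hD⟩ := exists_bound_of_support cL hL
  have iφ := integrable_of_support hφ.continuous hs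
  have iL := integrable_of_support cL hL
  -- P(s, τ) is the pairing of the propagated source with the Laplacian of φ, written with the
  -- propagator on the test side; this form gives joint measurability and a uniform bound.
  set P : ℝ → ℝ → ℝ := fun s τ => ∫ r, f s r * heatInt m (τ - s) (radialLaplacian m φ) r ∂ν
    with hP
  have hadm : ∀ s, IsBddAddInt (f s) (fun r => |f s r|) 0 := fun s =>
    .of_integrable (hf.slice s).int
  have hPeq : ∀ s τ, s < τ → P s τ = ∫ r, heatInt m (τ - s) (f s) r * radialLaplacian m φ r ∂ν :=
    fun s τ h => (hadm s).integral_mul_heatInt m (sub_pos.2 h) iL hD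
  have hPm : Measurable (Function.uncurry P) := by
    refine StronglyMeasurable.measurable (StronglyMeasurable.integral_prod_right
      (f := fun (p : ℝ × ℝ) r => f p.1 r * heatInt m (p.2 - p.1) (radialLaplacian m φ) r) ?_)
    refine Measurable.stronglyMeasurable (Measurable.mul ?_ ?_)
    · exact hf.meas.comp (by fun_prop : Measurable fun q : (ℝ × ℝ) × ℝ => (q.1.1, q.2))
    · exact measurable_heatInt m (α := (ℝ × ℝ) × ℝ) (t := fun q => q.1.2 - q.1.1)
        (r := fun q => q.2) (f := fun _ => radialLaplacian m φ) (by fun_prop) measurable_snd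
        (cL.measurable.comp measurable_snd)
  have hPb : ∀ s τ, 0 < s → s < τ → |P s τ| ≤ M * D := by
    intro s τ _ h
    refine (abs_integral_le_integral_abs).trans ?_
    have := (hadm s).integral_abs_mul_heatInt_le m (sub_pos.2 h) iL hD
    rw [abs_zero, zero_mul, zero_add] at this
    exact this.trans (mul_le_mul_of_nonneg_right (hf.slice s).norm_le hD0)
  have hQ : ∀ τ, ∫ r, duhamelTerm m f τ r * radialLaplacian m φ r ∂ν = ∫ s in Ioo 0 τ, P s τ := by
    intro τ
    rw [hf.integral_duhamelTerm_mul m ha cL hL]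
    exact setIntegral_congr_fun measurableSet_Ioo fun s h => (hPeq s τ h.2).symm
  have i2 : IntegrableOn (fun s => ∫ r, f s r * φ r ∂ν) (Ioo 0 t) := by
    refine Measure.integrableOn_of_bounded (M := M * E) (by simp) ?_ (.of_forall fun s => ?_)
    · refine (StronglyMeasurable.integral_prod_right (f := fun s r => f s r * φ r)
        ?_).aestronglyMeasurable
      exact (hf.meas.mul (hφ.continuous.measurable.comp measurable_snd)).stronglyMeasurable
    · calc ‖∫ r, f s r * φ r ∂ν‖ ≤ ∫ r, |f s r| * E ∂ν := by
            refine norm_integral_le_of_norm_le ((hf.slice s).int.abs.mul_const E)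
              (.of_forall fun r => ?_)
            rw [norm_mul]
            exact mul_le_mul_of_nonneg_left (hE r) (abs_nonneg _)
        _ ≤ M * E := by
            rw [integral_mul_const]
            exact mul_le_mul_of_nonneg_right (hf.slice s).norm_le hE0
  obtain ⟨i3, i4, htri⟩ := integral_Ioo_triangle hPm hPb (t := t)
  refine ⟨?_, ?_, i2⟩
  · rw [hf.integral_duhamelTerm_mul m ha hφ.continuous hs]
    -- The linear weak form for the datum f(s) over the elapsed time t - s, with its time variable
    -- shifted by s. Integrating over s then leaves an integral over the triangle.
    have h1 : ∀ s ∈ Ioo 0 t, ∫ r, heatInt m (t - s) (f s) r * φ r ∂ν =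
        ∫ r, f s r * φ r ∂ν + ∫ τ in Ioo s t, P s τ := by
      intro s hs'
      rw [((hadm s).integral_heatInt_mul_test m ha hab hφ hs (sub_pos.2 hs'.2)).1]
      congr 1
      rw [← integral_Ioc_eq_integral_Ioo, ← integral_Ioc_eq_integral_Ioo,
        ← intervalIntegral.integral_of_le (sub_pos.2 hs'.2).le,
        ← intervalIntegral.integral_of_le hs'.2.le]
      have h2 := intervalIntegral.integral_comp_sub_right (a := s) (b := t)
        (fun σ => ∫ r, heatInt m σ (f s) r * radialLaplacian m φ r ∂ν) s
      rw [sub_self] at h2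
      rw [← h2]
      refine intervalIntegral.integral_congr_ae (.of_forall fun τ hτ => ?_)
      rw [uIoc_of_le hs'.2.le] at hτ
      exact (hPeq s τ hτ.1).symm
    rw [setIntegral_congr_fun measurableSet_Ioo h1, integral_add i2 i3, htri]
    simp_rw [hQ]
  · simp_rw [hQ]
    exact i4

end IsSource

/-! ### The nonlinearity -/

/-- The function `x - sin (2 x) / 2`. -/
def nlFun (x : ℝ) : ℝ := x - Real.sin (2 * x) / 2

lemma nonlinearity_eq (m : ℕ) (u : ℝ → ℝ) (r : ℝ) :
    nonlinearity m u r = (m : ℝ) ^ 2 / r ^ 2 * nlFun (u r) := rfl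

lemma hasDerivAt_nlFun (x : ℝ) : HasDerivAt nlFun (2 * Real.sin x ^ 2) x := by
  have h := (hasDerivAt_id x).sub ((((hasDerivAt_id x).const_mul 2).sin).div_const 2)
  refine h.congr_deriv ?_
  simp only [id, mul_one]
  rw [Real.cos_two_mul, Real.cos_sq']
  ring

lemma continuous_nlFun : Continuous nlFun := by unfold nlFun; fun_prop

lemma nlFun_zero : nlFun 0 = 0 := by simp [nlFun]

lemma abs_nlFun_sub_le (x y : ℝ) : |nlFun x - nlFun y| ≤ 2 * |x - y| := by
  refine Convex.norm_image_sub_le_of_norm_hasDerivWithin_le (f := nlFun) (C := 2) (s := univ)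
    (fun z _ => (hasDerivAt_nlFun z).hasDerivWithinAt) (fun z _ => ?_) convex_univ (mem_univ _)
    (mem_univ _)
  rw [Real.norm_eq_abs, abs_of_nonneg (by positivity)]
  nlinarith [Real.sin_sq_le_one z]

/-- The derivative 2 sin² of `nlFun` vanishes to second order at 0, which gains a factor R² on
values of size R. -/
lemma abs_nlFun_sub_le_of_abs_le {x y R : ℝ} (hx : |x| ≤ R) (hy : |y| ≤ R) :
    |nlFun x - nlFun y| ≤ 2 * R ^ 2 * |x - y| := by
  refine Convex.norm_image_sub_le_of_norm_hasDerivWithin_le (f := nlFun) (C := 2 * R ^ 2)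
    (s := Icc (-R) R)
    (fun z _ => (hasDerivAt_nlFun z).hasDerivWithinAt) (fun z hz => ?_) (convex_Icc _ _)
    (abs_le.1 hy) (abs_le.1 hx)
  rw [Real.norm_eq_abs, abs_of_nonneg (by positivity)]
  have h1 : Real.sin z ^ 2 ≤ z ^ 2 := Real.sin_sq_le_sq
  have h2 : z ^ 2 ≤ R ^ 2 := sq_le_sq.2 ((abs_le.2 hz).trans (le_abs_self R))
  linarith

lemma abs_nlFun_le (x : ℝ) : |nlFun x| ≤ 2 * |x| := by
  simpa [nlFun_zero] using abs_nlFun_sub_le x 0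

/-- The cubic bound with one factor traded for A. A quadratic bound is what makes the nonlinearity
of an X² function integrable for r dr. -/
lemma abs_nlFun_le_sq {x A : ℝ} (hx : |x| ≤ A) : |nlFun x| ≤ 2 * A * x ^ 2 := by
  have := abs_nlFun_sub_le_of_abs_le (le_refl |x|) (y := 0) (by simp)
  simp only [nlFun_zero, sub_zero, sq_abs] at this
  nlinarith [sq_nonneg x]

/-! ### Functions that agree on the half-line -/

lemma jet_congr {m : ℕ} {u v : ℝ → ℝ} (h : ∀ r, 0 < r → u r = v r) {r : ℝ} (hr : 0 < r) :
    jet m u r = jet m v r := by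
  have : u =ᶠ[𝓝 r] v := by filter_upwards [Ioi_mem_nhds hr] with s hs using h s hs
  rw [jet, jet, this.deriv_eq, h r hr]

lemma jetSin_congr {m : ℕ} {u v : ℝ → ℝ} (h : ∀ r, 0 < r → u r = v r) {r : ℝ} (hr : 0 < r) :
    jetSin m u r = jetSin m v r := by
  have : u =ᶠ[𝓝 r] v := by filter_upwards [Ioi_mem_nhds hr] with s hs using h s hs
  rw [jetSin, jetSin, this.deriv_eq, h r hr]

lemma X2NormSq_congr {m : ℕ} {u v : ℝ → ℝ} (h : ∀ r, 0 < r → u r = v r) :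
    X2NormSq m u = X2NormSq m v := by
  rw [X2NormSq_eq_lintegral, X2NormSq_eq_lintegral]
  exact lintegral_radialMeasure_congr fun r hr => by rw [jet_congr h hr]

lemma energy_congr {m : ℕ} {u v : ℝ → ℝ} (h : ∀ r, 0 < r → u r = v r) :
    energy m u = energy m v := by
  rw [energy_eq_lintegral, energy_eq_lintegral]
  exact lintegral_radialMeasure_congr fun r hr => by rw [jetSin_congr h hr]

lemma MemX2.congr {m : ℕ} {u v : ℝ → ℝ} (hu : MemX2 m u) (h : ∀ r, 0 < r → v r = u r) :
    MemX2 m v := ⟨hu.1.congr h, by rw [X2NormSq_congr h]; exact hu.2⟩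

lemma jetLp_congr {m : ℕ} {u v : ℝ → ℝ} (hu : MemX2 m u) (h : ∀ r, 0 < r → v r = u r) :
    jetLp m v = jetLp m u := by
  refine Lp.ext ?_
  filter_upwards [hu.coeFn_jetLp, (hu.congr h).coeFn_jetLp, ae_radialMeasure_pos] with r h1 h2 hr
  rw [h1, h2, jet_congr h hr]

lemma integral_norm_mul_norm_le (f g : Lp ℂ 2 ν) : ∫ r, ‖f r‖ * ‖g r‖ ∂ν ≤ ‖f‖ * ‖g‖ := by
  have h := integral_mul_norm_le_Lp_mul_Lq (μ := ν) (f := f) (g := g) (p := 2) (q := 2)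
    Real.HolderConjugate.two_two (by simpa using Lp.memLp f) (by simpa using Lp.memLp g)
  have e : ∀ k : Lp ℂ 2 ν, (∫ r, ‖k r‖ ^ (2 : ℝ) ∂ν) ^ (1 / 2 : ℝ) = ‖k‖ := by
    intro k
    simp only [Real.rpow_two]
    rw [← norm_sq_Lp, ← Real.sqrt_eq_rpow, Real.sqrt_sq (norm_nonneg _)]
  rwa [e, e] at h

lemma integrable_norm_mul_norm (f g : Lp ℂ 2 ν) : Integrable (fun r => ‖f r‖ * ‖g r‖) ν :=
  (Lp.memLp f).norm.integrable_mul (Lp.memLp g).norm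

lemma abs_le_norm_jet (m : ℕ) (u : ℝ → ℝ) {r : ℝ} (hr : 0 < r) :
    m * |u r| / r ≤ ‖jet m u r‖ := by
  have h := Complex.abs_im_le_norm (jet m u r)
  rwa [jet, abs_div, abs_mul, abs_of_pos hr, Nat.abs_cast] at h

lemma mul_div_sq_le_jet (m : ℕ) (u v : ℝ → ℝ) {r : ℝ} (hr : 0 < r) :
    (m : ℝ) ^ 2 / r ^ 2 * (|u r| * |v r|) ≤ ‖jet m u r‖ * ‖jet m v r‖ := by
  calc (m : ℝ) ^ 2 / r ^ 2 * (|u r| * |v r|) = (m * |u r| / r) * (m * |v r| / r) := by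
        field_simp
    _ ≤ _ := mul_le_mul (abs_le_norm_jet m u hr) (abs_le_norm_jet m v hr) (by positivity)
        (norm_nonneg _)

/-- The pairing of the nonlinearity `F(v)` with `ψ`. -/
def nlPair (m : ℕ) (v ψ : ℝ → ℝ) : ℝ := ∫ r, nonlinearity m v r * ψ r ∂ν

lemma aesm_nonlinearity (m : ℕ) {v : ℝ → ℝ} (hv : LocAC v) :
    AEStronglyMeasurable (nonlinearity m v) ν := by
  refine aestronglyMeasurable_radial ?_
  exact (continuousOn_const.div (continuous_pow 2).continuousOn
    fun r hr => pow_ne_zero 2 (ne_of_gt hr)).mul (continuous_nlFun.comp_continuousOn hv.continuousOn)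

section nlPair

variable {m : ℕ} {v w ψ : ℝ → ℝ}

lemma integrable_nlPair (hv : MemX2 m v) (hψ : MemX2 m ψ) :
    Integrable (fun r => nonlinearity m v r * ψ r) ν := by
  refine ((integrable_norm_mul_norm (jetLp m v) (jetLp m ψ)).const_mul 2).mono'
    ((aesm_nonlinearity m hv.1).mul hψ.1.aesm) ?_
  filter_upwards [hv.coeFn_jetLp, hψ.coeFn_jetLp, ae_radialMeasure_pos] with r h1 h2 hr
  rw [h1, h2, norm_mul, Real.norm_eq_abs, Real.norm_eq_abs, nonlinearity_eq, abs_mul,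
    abs_of_nonneg (by positivity : (0 : ℝ) ≤ (m : ℝ) ^ 2 / r ^ 2)]
  have h3 := mul_div_sq_le_jet m v ψ hr
  calc (m : ℝ) ^ 2 / r ^ 2 * |nlFun (v r)| * |ψ r|
      ≤ (m : ℝ) ^ 2 / r ^ 2 * (2 * |v r|) * |ψ r| := by gcongr; exact abs_nlFun_le _
    _ = 2 * ((m : ℝ) ^ 2 / r ^ 2 * (|v r| * |ψ r|)) := by ring
    _ ≤ _ := by gcongr

lemma abs_nlPair_sub_le (hv : MemX2 m v) (hw : MemX2 m w) (hψ : MemX2 m ψ) :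
    |nlPair m v ψ - nlPair m w ψ| ≤ 2 * (‖jetLp m v - jetLp m w‖ * ‖jetLp m ψ‖) := by
  rw [nlPair, nlPair, ← integral_sub (integrable_nlPair hv hψ) (integrable_nlPair hw hψ),
    ← jetLp_sub hv hw]
  have hvw := hv.sub hw
  rw [← Real.norm_eq_abs]
  refine (norm_integral_le_of_norm_le ((integrable_norm_mul_norm
    (jetLp m fun r => v r - w r) (jetLp m ψ)).const_mul 2) ?_).trans ?_
  · filter_upwards [hvw.coeFn_jetLp, hψ.coeFn_jetLp, ae_radialMeasure_pos] with r h1 h2 hr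
    rw [h1, h2, ← sub_mul, nonlinearity_eq, nonlinearity_eq, ← mul_sub, norm_mul, norm_mul,
      Real.norm_eq_abs, Real.norm_eq_abs, Real.norm_eq_abs,
      abs_of_nonneg (by positivity : (0 : ℝ) ≤ (m : ℝ) ^ 2 / r ^ 2)]
    have h3 := mul_div_sq_le_jet m (fun r => v r - w r) ψ hr
    calc (m : ℝ) ^ 2 / r ^ 2 * |nlFun (v r) - nlFun (w r)| * |ψ r|
        ≤ (m : ℝ) ^ 2 / r ^ 2 * (2 * |v r - w r|) * |ψ r| := by
          gcongr; exact abs_nlFun_sub_le _ _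
      _ = 2 * ((m : ℝ) ^ 2 / r ^ 2 * (|v r - w r| * |ψ r|)) := by ring
      _ ≤ _ := by gcongr
  · rw [integral_const_mul]
    exact mul_le_mul_of_nonneg_left (integral_norm_mul_norm_le _ _) zero_le_two

lemma abs_nlPair_sub_right_le (hv : MemX2 m v) (hw : MemX2 m w) (hψ : MemX2 m ψ) :
    |nlPair m ψ v - nlPair m ψ w| ≤ 2 * (‖jetLp m ψ‖ * ‖jetLp m v - jetLp m w‖) := by
  rw [nlPair, nlPair, ← integral_sub (integrable_nlPair hψ hv) (integrable_nlPair hψ hw),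
    ← jetLp_sub hv hw]
  have hvw := hv.sub hw
  rw [← Real.norm_eq_abs]
  refine (norm_integral_le_of_norm_le ((integrable_norm_mul_norm
    (jetLp m ψ) (jetLp m fun r => v r - w r)).const_mul 2) ?_).trans ?_
  · filter_upwards [hvw.coeFn_jetLp, hψ.coeFn_jetLp, ae_radialMeasure_pos] with r h1 h2 hr
    rw [h1, h2, ← mul_sub, nonlinearity_eq, norm_mul, norm_mul,
      Real.norm_eq_abs, Real.norm_eq_abs, Real.norm_eq_abs,
      abs_of_nonneg (by positivity : (0 : ℝ) ≤ (m : ℝ) ^ 2 / r ^ 2)]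
    have h3 := mul_div_sq_le_jet m ψ (fun r => v r - w r) hr
    calc (m : ℝ) ^ 2 / r ^ 2 * |nlFun (ψ r)| * |v r - w r|
        ≤ (m : ℝ) ^ 2 / r ^ 2 * (2 * |ψ r|) * |v r - w r| := by
          gcongr; exact abs_nlFun_le _
      _ = 2 * ((m : ℝ) ^ 2 / r ^ 2 * (|ψ r| * |v r - w r|)) := by ring
      _ ≤ _ := by gcongr
  · rw [integral_const_mul]
    exact mul_le_mul_of_nonneg_left (integral_norm_mul_norm_le _ _) zero_le_two

/-- Bounds on the nonlinearity as a source term. -/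
lemma MemX2.sliceBound (hm : 1 ≤ m) (hv : MemX2 m v) {A : ℝ} (hA : ‖jetLp m v‖ ≤ A) :
    SliceBound (nonlinearity m v) (2 * A * A ^ 2) ((m : ℝ) ^ 2 * (2 * A)) := by
  have hA0 : 0 ≤ A := (norm_nonneg _).trans hA
  have hle : ∀ r, 0 < r → |nonlinearity m v r| ≤ 2 * A * ‖jet m v r‖ ^ 2 := by
    intro r hr
    have h1 : |v r| ≤ A := (hv.abs_le hm hr).trans hA
    rw [nonlinearity_eq, abs_mul, abs_of_nonneg (by positivity : (0 : ℝ) ≤ (m : ℝ) ^ 2 / r ^ 2)]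
    calc (m : ℝ) ^ 2 / r ^ 2 * |nlFun (v r)| ≤ (m : ℝ) ^ 2 / r ^ 2 * (2 * A * v r ^ 2) := by
          gcongr; exact abs_nlFun_le_sq h1
      _ = 2 * A * ((m : ℝ) ^ 2 / r ^ 2 * (|v r| * |v r|)) := by rw [abs_mul_abs_self]; ring
      _ ≤ _ := by
          have := mul_div_sq_le_jet m v v hr
          rw [pow_two ‖_‖]
          gcongr
  have hi := hv.integrable_sq.const_mul (2 * A)
  refine ⟨hi.mono' (aesm_nonlinearity m hv.1) (ae_radialMeasure_of_forall hle), ?_, ?_⟩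
  · calc ∫ ρ, |nonlinearity m v ρ| ∂ν ≤ ∫ ρ, 2 * A * ‖jet m v ρ‖ ^ 2 ∂ν :=
          integral_mono_of_nonneg (.of_forall fun _ => abs_nonneg _) hi
            (ae_radialMeasure_of_forall hle)
      _ = 2 * A * ‖jetLp m v‖ ^ 2 := by rw [integral_const_mul, hv.norm_sq]
      _ ≤ _ := by gcongr
  · intro r hr
    have h1 : |v r| ≤ A := (hv.abs_le hm hr).trans hA
    rw [nonlinearity_eq, abs_mul, abs_of_nonneg (by positivity : (0 : ℝ) ≤ (m : ℝ) ^ 2 / r ^ 2)]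
    calc (m : ℝ) ^ 2 / r ^ 2 * |nlFun (v r)| ≤ (m : ℝ) ^ 2 / r ^ 2 * (2 * A) := by
          gcongr; exact (abs_nlFun_le _).trans (by linarith)
      _ = _ := by ring

end nlPair

/-! ### Test functions in the energy space -/

lemma memX2_of_contDiff (m : ℕ) {φ : ℝ → ℝ} {a b : ℝ} (ha : 0 < a)
    (hφ : ContDiff ℝ 1 φ) (hs : ∀ r ∉ Ioo a b, φ r = 0) : MemX2 m φ := by
  rw [memX2_iff (LocAC.of_contDiff hφ), memLp_two_iff_integrable_sq_norm
    (aestronglyMeasurable_jet m (LocAC.of_contDiff hφ))]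
  have hd := deriv_eq_zero_of_notMem_Ioo hφ hs
  have c1 : Continuous (deriv φ) := hφ.continuous_deriv le_rfl
  have c2 : Continuous fun r => φ r / r := continuous_div_of_eq_zero ha hφ.continuous continuous_id
    (fun _ h => h) fun r hr => hs r fun h => absurd h.1 (not_lt.2 hr.le)
  have e : (fun r => ‖jet m φ r‖ ^ 2) = fun r => deriv φ r ^ 2 + (m * (φ r / r)) ^ 2 := by
    ext r; rw [norm_jet_sq]; ring
  rw [e]
  refine integrable_of_support (a := a) (b := b) (by fun_prop) fun r hr => ?_
  rw [hd r hr, hs r hr]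
  simp

/-- Integration by parts against a test function. -/
lemma integral_mul_radialLaplacian {m : ℕ} {u φ : ℝ → ℝ} {a b : ℝ} (ha : 0 < a) (hab : a < b)
    (hu : MemX2 m u) (hφ : ContDiff ℝ 2 φ) (hs : ∀ r ∉ Ioo a b, φ r = 0) :
    ∫ r, u r * radialLaplacian m φ r ∂ν = -inner ℝ (jetLp m u) (jetLp m φ) := by
  have hφ1 := hφ.of_le (one_le_two (α := WithTop ℕ∞))
  have hd1 := deriv_eq_zero_of_notMem_Ioo hφ1 hs
  have hL := radialLaplacian_eq_zero m hφ hs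
  have c1 : Continuous (deriv φ) := hφ.continuous_deriv one_le_two
  have cL := continuous_radialLaplacian m ha hφ hs
  have hsub : Ioc a b ⊆ Ioi 0 := fun r hr => ha.trans hr.1
  rw [integral_inner_jet hu (memX2_of_contDiff m ha hφ1 hs), integral_radialMeasure,
    integral_radialMeasure,
    setIntegral_eq_of_subset_of_forall_sdiff_eq_zero measurableSet_Ioi hsub,
    setIntegral_eq_of_subset_of_forall_sdiff_eq_zero (s := Ioc a b) measurableSet_Ioi hsub,
    ← intervalIntegral.integral_of_le hab.le, ← intervalIntegral.integral_of_le hab.le]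
  rotate_left
  · intro r hr
    have : r ∉ Ioo a b := fun h => hr.2 (Ioo_subset_Ioc_self h)
    rw [hs r this, hd1 r this]; simp
  · intro r hr
    have : r ∉ Ioo a b := fun h => hr.2 (Ioo_subset_Ioc_self h)
    rw [hL r this]; simp
  have hac := hu.1 a b ha hab
  have hg : AbsolutelyContinuousOnInterval (fun r => r * deriv φ r) a b :=
    (contDiff_id.mul (contDiff_one_deriv hφ)).contDiffOn.absolutelyContinuousOnInterval
  have hibp := hac.integral_deriv_mul_eq_sub hg
  rw [hd1 a (by simp), hd1 b (by simp)] at hibp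
  simp only [mul_zero, sub_zero] at hibp
  have hdg : ∀ r, deriv (fun r => r * deriv φ r) r = deriv φ r + r * deriv (deriv φ) r := by
    intro r
    have h : HasDerivAt (fun r => r * deriv φ r) (1 * deriv φ r + r * deriv (deriv φ) r) r :=
      (hasDerivAt_id' r).mul ((contDiff_one_deriv hφ).differentiable one_ne_zero r).hasDerivAt
    rw [h.deriv, one_mul]
  -- Since r Δ_m φ = (r φ')' - m² φ / r, the integrand is the derivative of u · r φ' minus the
  -- density of the inner product.
  have key : ∀ r ∈ uIcc a b, u r * radialLaplacian m φ r * r =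
      (deriv u r * (r * deriv φ r) + u r * deriv (fun r => r * deriv φ r) r) -
        (deriv u r * deriv φ r + (m : ℝ) ^ 2 * u r * φ r / r ^ 2) * r := by
    intro r hr
    rw [uIcc_of_le hab.le] at hr
    have hr0 : r ≠ 0 := (ha.trans_le hr.1).ne'
    rw [hdg, radialLaplacian]
    field_simp
    ring
  rw [intervalIntegral.integral_congr key, intervalIntegral.integral_sub, hibp, zero_sub]
  · have c2 : ContinuousOn u (uIcc a b) := hac.continuousOn
    refine (hac.intervalIntegrable_deriv.mul_continuousOn (by fun_prop)).add ?_
    simp_rw [hdg]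
    have c3 : Continuous (deriv (deriv φ)) := (contDiff_one_deriv hφ).continuous_deriv le_rfl
    exact (c2.mul (by fun_prop)).intervalIntegrable
  · have c2 : ContinuousOn u (uIcc a b) := hac.continuousOn
    have e : (fun r => (deriv u r * deriv φ r + (m : ℝ) ^ 2 * u r * φ r / r ^ 2) * r) =
      fun r => deriv u r * (deriv φ r * r) + u r * ((m : ℝ) ^ 2 * φ r / r ^ 2 * r) := by
      ext r; ring
    rw [e]
    have c4 : Continuous fun r => (m : ℝ) ^ 2 * φ r / r ^ 2 :=
      continuous_div_of_eq_zero ha (continuous_const.mul hφ.continuous) (continuous_pow 2)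
      (fun r hr => pow_ne_zero 2 hr) fun r hr => by
        rw [hs r fun h => absurd h.1 (not_lt.2 hr.le), mul_zero]
    exact (hac.intervalIntegrable_deriv.mul_continuousOn (by fun_prop)).add
      (c2.mul (by fun_prop)).intervalIntegrable

/-! ### Solutions as curves in the energy space -/

lemma zero_mem_timeInterval_of_mem {T : ℝ≥0∞} {c : ℝ} (hc : c ∈ timeInterval T) :
    (0 : ℝ) ∈ timeInterval T :=
  ⟨le_rfl, by simpa using bot_le.trans_lt hc.2⟩

lemma Icc_subset_timeInterval {T : ℝ≥0∞} {c : ℝ} (hc : c ∈ timeInterval T) :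
    Icc 0 c ⊆ timeInterval T :=
  fun _ ht => ⟨ht.1, (ENNReal.ofReal_le_ofReal ht.2).trans_lt hc.2⟩

/-- `w` is a bounded continuous curve in `X²`, defined for all times, that satisfies the Duhamel
formula on `[0, c]`. -/
structure IsMildCurve (m : ℕ) (A c : ℝ) (w : ℝ → ℝ → ℝ) : Prop where
  mem : ∀ t, MemX2 m (w t)
  cont : Continuous fun t => jetLp m (w t)
  bound : ∀ t, ‖jetLp m (w t)‖ ≤ A
  meas : Measurable (Function.uncurry w)
  duhamel : ∀ t ∈ Ioc 0 c, ∀ r, 0 < r →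
    w t r = heatInt m t (w 0) r + duhamelTerm m (fun s => nonlinearity m (w s)) t r

lemma nonlinearity_congr {m : ℕ} {u v : ℝ → ℝ} {r : ℝ} (h : u r = v r) :
    nonlinearity m u r = nonlinearity m v r := by rw [nonlinearity_eq, nonlinearity_eq, h]

namespace IsSolution

variable {m : ℕ} {u₀ : ℝ → ℝ} {T : ℝ≥0∞} {u : ℝ → ℝ → ℝ}

lemma continuousOn_jetLp (hu : IsSolution m u₀ T u) :
    ContinuousOn (fun t => jetLp m (u t)) (timeInterval T) := by
  intro t₀ ht₀
  have h := hu.cont t₀ ht₀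
  have h1 : Tendsto (fun t => ENNReal.ofReal (‖jetLp m (u t) - jetLp m (u t₀)‖ ^ 2))
      (𝓝[timeInterval T] t₀) (𝓝 0) := by
    refine h.congr' ?_
    filter_upwards [self_mem_nhdsWithin] with t ht
    rw [((hu.mem t ht).sub (hu.mem t₀ ht₀)).X2NormSq_eq, jetLp_sub (hu.mem t ht) (hu.mem t₀ ht₀)]
  have h2 := (ENNReal.tendsto_toReal ENNReal.zero_ne_top).comp h1
  have h3 : Tendsto (fun t => ‖jetLp m (u t) - jetLp m (u t₀)‖ ^ 2)
      (𝓝[timeInterval T] t₀) (𝓝 0) := by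
    refine h2.congr fun t => ?_
    simp only [Function.comp]
    rw [ENNReal.toReal_ofReal (by positivity)]
  have h4 := h3.sqrt
  simp only [Real.sqrt_sq (norm_nonneg _), Real.sqrt_zero] at h4
  exact tendsto_iff_norm_sub_tendsto_zero.2 h4

/-- The curve `t ↦ u (t)`, frozen outside `[0, c]`. -/
def clamp (u : ℝ → ℝ → ℝ) (c : ℝ) (t r : ℝ) : ℝ := if 0 < r then u (max 0 (min t c)) r else 0

lemma clamp_eq {c t r : ℝ} (ht : t ∈ Icc 0 c) (hr : 0 < r) : clamp u c t r = u t r := by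
  rw [clamp, if_pos hr, min_eq_left ht.2, max_eq_right ht.1]

lemma clamp_mem {c : ℝ} (hc : 0 ≤ c) (t : ℝ) : max 0 (min t c) ∈ Icc 0 c :=
  ⟨le_max_left _ _, max_le hc (min_le_right _ _)⟩

lemma data_eq (hu : IsSolution m u₀ T u) (h0 : (0 : ℝ) ∈ timeInterval T) {r : ℝ} (hr : 0 < r) :
    u 0 r = u₀ r := by
  have := hu.duhamel 0 h0 r hr
  simpa [heatFlow] using this

/-- Freezing the solution outside [0, c] gives a curve on the whole line that is continuous in X²
and, by compactness of [0, c], bounded. -/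
lemma isMildCurve (hm : 1 ≤ m) (hu : IsSolution m u₀ T u) {c : ℝ} (hc : c ∈ timeInterval T) :
    ∃ A, IsMildCurve m A c (clamp u c) := by
  have hsub := Icc_subset_timeInterval hc
  have hcl := clamp_mem hc.1
  have hcu : ∀ t r, 0 < r → clamp u c t r = u (max 0 (min t c)) r := fun t r hr => if_pos hr
  have hmem : ∀ t, MemX2 m (clamp u c t) := fun t => (hu.mem _ (hsub (hcl t))).congr (hcu t)
  have hjet : ∀ t, jetLp m (clamp u c t) = jetLp m (u (max 0 (min t c))) :=
    fun t => jetLp_congr (hu.mem _ (hsub (hcl t))) (hcu t)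
  have hcont : Continuous fun t => jetLp m (clamp u c t) := by
    simp_rw [hjet]
    exact hu.continuousOn_jetLp.comp_continuous (by fun_prop) fun t => hsub (hcl t)
  obtain ⟨A, hA⟩ := (isCompact_Icc (a := (0 : ℝ)) (b := c)).exists_bound_of_continuousOn
    hcont.continuousOn
  have hbd : ∀ t, ‖jetLp m (clamp u c t)‖ ≤ A := by
    intro t
    have h1 := hA _ (hcl t)
    rwa [hjet, min_eq_left (hcl t).2, max_eq_right (hcl t).1, ← hjet] at h1
  have hmeas : Measurable (Function.uncurry (clamp u c)) := by
    -- Continuity in t at fixed r comes from the sup bound, measurability in r from continuity on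
    -- the half-line together with the default value 0 for r ≤ 0.
    refine measurable_uncurry_of_continuous_of_measurable (u := clamp u c) (fun r => ?_)
      fun t => ?_
    · by_cases hr : 0 < r
      · refine continuous_iff_continuousAt.2 fun t₀ => tendsto_iff_norm_sub_tendsto_zero.2 ?_
        have h2 := tendsto_iff_norm_sub_tendsto_zero.1 (hcont.tendsto t₀)
        exact squeeze_zero (fun _ => norm_nonneg _)
          (fun t => (hmem t).abs_sub_le hm (hmem t₀) hr) h2
      · have : (fun t => clamp u c t r) = fun _ => 0 := by ext t; simp [clamp, hr]
        rw [this]; exact continuous_const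
    · have h2 : ContinuousOn (u (max 0 (min t c))) (Ioi 0) :=
        (hu.mem _ (hsub (hcl t))).1.continuousOn
      have h3 : clamp u c t = (Ioi (0 : ℝ)).piecewise (u (max 0 (min t c))) (fun _ => 0) := by
        ext r
        simp [clamp, piecewise]
      rw [h3]
      exact h2.measurable_piecewise continuousOn_const measurableSet_Ioi
  refine ⟨A, hmem, hcont, hbd, hmeas, fun t ht r hr => ?_⟩
  have ht' : t ∈ Icc 0 c := Ioc_subset_Icc_self ht
  rw [clamp_eq ht' hr, hu.duhamel t (hsub ht') r hr, heatFlow_eq m ht.1.ne', duhamelTerm,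
    intervalIntegral.integral_of_le ht.1.le, integral_Ioc_eq_integral_Ioo]
  congr 1
  · refine heatInt_congr m t (fun s hs => ?_) r
    rw [clamp_eq ⟨le_rfl, hc.1⟩ hs, hu.data_eq (hsub ⟨le_rfl, hc.1⟩) hs]
  · refine setIntegral_congr_fun measurableSet_Ioo fun s hs => ?_
    rw [heatFlow_eq m (sub_pos.2 hs.2).ne']
    refine heatInt_congr m (t - s) (fun ρ hρ => ?_) r
    exact nonlinearity_congr (clamp_eq ⟨hs.1.le, hs.2.le.trans ht.2⟩ hρ).symm

end IsSolution

namespace IsMildCurve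

variable {m : ℕ} {A c : ℝ} {w : ℝ → ℝ → ℝ}

lemma isSource (hm : 1 ≤ m) (h : IsMildCurve m A c w) :
    IsSource (fun s => nonlinearity m (w s)) (2 * A * A ^ 2) ((m : ℝ) ^ 2 * (2 * A)) where
  meas := by
    have h1 : Measurable fun p : ℝ × ℝ => w p.1 p.2 := h.meas
    have h2 : Measurable fun p : ℝ × ℝ => nlFun (w p.1 p.2) := continuous_nlFun.measurable.comp h1
    exact (by fun_prop : Measurable fun p : ℝ × ℝ => (m : ℝ) ^ 2 / p.2 ^ 2).mul h2
  slice s := (h.mem s).sliceBound hm (h.bound s)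

lemma continuous_nlPair (h : IsMildCurve m A c w) {ψ : ℝ → ℝ} (hψ : MemX2 m ψ) :
    Continuous fun t => nlPair m (w t) ψ := by
  refine continuous_iff_continuousAt.2 fun t₀ => tendsto_iff_norm_sub_tendsto_zero.2 ?_
  have h2 := (tendsto_iff_norm_sub_tendsto_zero.1 (h.cont.tendsto t₀)).mul_const (‖jetLp m ψ‖)
  have h3 := h2.const_mul 2
  simp only [zero_mul, mul_zero] at h3
  exact squeeze_zero (fun _ => norm_nonneg _)
    (fun t => abs_nlPair_sub_le (h.mem t) (h.mem t₀) hψ) h3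

/-- Weak form of the equation, against test functions. -/
lemma weak_test (hm : 1 ≤ m) (h : IsMildCurve m A c w) {φ : ℝ → ℝ} {a b : ℝ} (ha : 0 < a)
    (hab : a < b) (hφ : ContDiff ℝ 2 φ) (hs : ∀ r ∉ Ioo a b, φ r = 0) {t : ℝ} (ht : t ∈ Ioc 0 c) :
    ∫ r, (w t r - w 0 r) * φ r ∂ν =
      ∫ s in (0 : ℝ)..t, (nlPair m (w s) φ - inner ℝ (jetLp m (w s)) (jetLp m φ)) := by
  have hφX := memX2_of_contDiff m ha (hφ.of_le (one_le_two (α := WithTop ℕ∞))) hs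
  have hB : ∀ r, 0 < r → |w 0 r| ≤ A := fun r hr => ((h.mem 0).abs_le hm hr).trans (h.bound 0)
  have hbdd := IsBddAddInt.of_bound (h.mem 0).1.aesm hB
  have hsrc := h.isSource hm
  have hwφ : ∀ s {ψ : ℝ → ℝ}, Continuous ψ → (∀ r ∉ Ioo a b, ψ r = 0) →
      Integrable (fun r => w s r * ψ r) ν := by
    intro s ψ hψ hψs
    refine (integrable_of_support hψ hψs).bdd_mul (c := A) (h.mem s).1.aesm ?_
    exact ae_radialMeasure_of_forall fun r hr => ((h.mem s).abs_le hm hr).trans (h.bound s)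
  have cL := continuous_radialLaplacian m ha hφ hs
  have hL := radialLaplacian_eq_zero m hφ hs
  have e1 := hbdd.integral_heatInt_mul_test m ha hab hφ hs ht.1
  have e2 := hsrc.integral_duhamelTerm_test m ha hab hφ hs (t := t)
  have iduh : ∀ τ, 0 ≤ τ → ∀ {ψ : ℝ → ℝ}, Continuous ψ → (∀ r ∉ Ioo a b, ψ r = 0) →
      Integrable (fun r => duhamelTerm m (fun s => nonlinearity m (w s)) τ r * ψ r) ν :=
    fun τ hτ ψ hψ hψs => hsrc.integrable_duhamelTerm_mul m ha hψ hψs hτ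
  have ihe : ∀ τ ∈ Ioc 0 c, ∀ {ψ : ℝ → ℝ}, Continuous ψ → (∀ r ∉ Ioo a b, ψ r = 0) →
      Integrable (fun r => heatInt m τ (w 0) r * ψ r) ν := by
    intro τ hτ ψ hψ hψs
    refine ((hwφ τ hψ hψs).sub (iduh τ hτ.1.le hψ hψs)).congr
      (ae_radialMeasure_of_forall fun r hr => ?_)
    simp only [Pi.sub_apply]
    rw [h.duhamel τ hτ r hr]; ring
  have split : ∀ τ ∈ Ioc 0 c, ∀ {ψ : ℝ → ℝ}, Continuous ψ → (∀ r ∉ Ioo a b, ψ r = 0) →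
      ∫ r, w τ r * ψ r ∂ν = ∫ r, heatInt m τ (w 0) r * ψ r ∂ν +
        ∫ r, duhamelTerm m (fun s => nonlinearity m (w s)) τ r * ψ r ∂ν := by
    intro τ hτ ψ hψ hψs
    rw [← integral_add (ihe τ hτ hψ hψs) (iduh τ hτ.1.le hψ hψs)]
    refine integral_radialMeasure_congr fun r hr => ?_
    rw [h.duhamel τ hτ r hr]; ring
  have e3 : ∫ r, (w t r - w 0 r) * φ r ∂ν = ∫ r, w t r * φ r ∂ν - ∫ r, w 0 r * φ r ∂ν := by
    rw [← integral_sub (hwφ t hφ.continuous hs) (hwφ 0 hφ.continuous hs)]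
    simp_rw [sub_mul]
  rw [e3, split t ht hφ.continuous hs, e1.1, e2.1, intervalIntegral.integral_of_le ht.1.le,
    integral_Ioc_eq_integral_Ioo, integral_sub (f := fun s => nlPair m (w s) φ)
      e2.2.2 ((h.cont.inner continuous_const).continuousOn.integrableOn_Icc.mono_set Ioo_subset_Icc_self)]
  -- By Duhamel the two Laplacian terms recombine into the pairing of w(τ) with the Laplacian of φ,
  -- which is minus the X² inner product.
  have e4 : ∫ s in Ioo 0 t, inner ℝ (jetLp m (w s)) (jetLp m φ) =
      -((∫ τ in Ioo 0 t, ∫ r, heatInt m τ (w 0) r * radialLaplacian m φ r ∂ν) +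
        ∫ τ in Ioo 0 t, ∫ r, duhamelTerm m (fun s => nonlinearity m (w s)) τ r *
          radialLaplacian m φ r ∂ν) := by
    rw [← integral_add e1.2 e2.2.1, ← integral_neg]
    refine setIntegral_congr_fun measurableSet_Ioo fun τ hτ => ?_
    rw [← split τ ⟨hτ.1, hτ.2.le.trans ht.2⟩ cL hL,
      integral_mul_radialLaplacian ha hab (h.mem τ) hφ hs, neg_neg]
  rw [e4]
  simp only [nlPair]
  ring

end IsMildCurve

/-! ### Density of test functions -/

instance : IsFiniteMeasureOnCompacts ν where
  lt_top_of_isCompact {K} hK := by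
    obtain ⟨R, hR⟩ := hK.isBounded.subset_closedBall 0
    refine (measure_mono hR).trans_lt ?_
    rw [Real.closedBall_eq_Icc]
    exact radialMeasure_Icc_lt_top _ _

lemma contDiff_primitive {h : ℝ → ℝ} (hh : ContDiff ℝ 1 h) (a : ℝ) :
    ContDiff ℝ 2 fun r => ∫ x in a..r, h x := by
  have hd : ∀ r, HasDerivAt (fun r => ∫ x in a..r, h x) (h r) r := fun r =>
    (hh.continuous.integral_hasStrictDerivAt a r).hasDerivAt
  rw [show (2 : WithTop ℕ∞) = 1 + 1 by norm_num, contDiff_succ_iff_deriv]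
  refine ⟨fun r => (hd r).differentiableAt, by simp, ?_⟩
  rwa [funext fun r => (hd r).deriv]

/-- Zero mean is what makes the primitive of a compactly supported function compactly supported. -/
lemma primitive_eq_zero {h : ℝ → ℝ} {a b : ℝ} (hh : Continuous h) (hs : ∀ r ∉ Ioo a b, h r = 0)
    (hint : ∫ x in a..b, h x = 0) : ∀ r ∉ Ioo a b, ∫ x in a..r, h x = 0 := by
  have hz : ∀ x y, (∀ r ∈ uIcc x y, r ∉ Ioo a b) → ∫ r in x..y, h r = 0 := fun x y hxy => by
    rw [intervalIntegral.integral_congr (g := fun _ => 0) fun r hr => hs r (hxy r hr)]; simp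
  intro r hr
  rcases le_or_gt r a with h1 | h1
  · refine hz _ _ fun x hx hx' => ?_
    rw [uIcc_of_ge h1] at hx
    linarith [hx.2, hx'.1]
  · have h2 : b ≤ r := not_lt.1 fun h2 => hr ⟨h1, h2⟩
    rw [← intervalIntegral.integral_add_adjacent_intervals (hh.intervalIntegrable a b)
      (hh.intervalIntegrable b r), hint, zero_add]
    refine hz _ _ fun x hx hx' => ?_
    rw [uIcc_of_le h2] at hx
    linarith [hx.1, hx'.2]

lemma integral_sq_le_of_eLpNorm_le {f : ℝ → ℝ} (hf : MemLp f 2 ν) {δ : ℝ} (hδ : 0 ≤ δ)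
    (h : eLpNorm f 2 ν ≤ ENNReal.ofReal δ) : ∫ r, f r ^ 2 ∂ν ≤ δ ^ 2 := by
  rw [hf.eLpNorm_eq_integral_rpow_norm two_ne_zero (by simp), ENNReal.ofReal_le_ofReal_iff hδ] at h
  simp only [ENNReal.toReal_ofNat, Real.rpow_two, Real.norm_eq_abs, sq_abs] at h
  rw [show (2 : ℝ)⁻¹ = 1 / 2 by norm_num, ← Real.sqrt_eq_rpow] at h
  exact (Real.sqrt_le_left hδ).1 h

lemma deriv_eq_zero_of_support {ψ : ℝ → ℝ} {a b : ℝ} (hs : ∀ r ∉ Ioo a b, ψ r = 0) {r : ℝ}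
    (hr : r ∉ Icc a b) : deriv ψ r = 0 := by
  have : ψ =ᶠ[𝓝 r] fun _ => 0 := by
    filter_upwards [isClosed_Icc.isOpen_compl.mem_nhds hr] with s hs'
    exact hs s fun h => hs' (Ioo_subset_Icc_self h)
  rw [this.deriv_eq, deriv_const]

lemma exists_cutoff {a b : ℝ} (ha : 0 < a) (hab : a < b) : ∃ χ : ℝ → ℝ, ContDiff ℝ 1 χ ∧
    (∀ r, 0 ≤ χ r) ∧ (∀ r, χ r ≤ 1) ∧ (∀ r ∈ Icc a b, χ r = 1) ∧
    ∀ r ∉ Ioo (a / 2) (b + a / 2), χ r = 0 := by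
  -- The inner closed ball is [a, b] and the outer ball is (a/2, b + a/2), which still avoids 0.
  let f : ContDiffBump ((a + b) / 2) :=
    { rIn := (b - a) / 2, rOut := b / 2, rIn_pos := by linarith, rIn_lt_rOut := by linarith }
  refine ⟨f, f.contDiff, fun _ => f.nonneg, fun _ => f.le_one, fun r hr => ?_, fun r hr => ?_⟩
  · refine f.one_of_mem_closedBall ?_
    rw [Real.closedBall_eq_Icc]
    exact ⟨by simp only [f]; linarith [hr.1], by simp only [f]; linarith [hr.2]⟩
  · refine f.zero_of_le_dist ?_
    by_contra hlt
    rw [Real.dist_eq, not_le, abs_lt] at hlt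
    simp only [f] at hlt
    exact hr ⟨by linarith [hlt.1], by linarith [hlt.2]⟩

/-- Approximate ψ' in L² by a smooth function, cut it off, subtract a multiple of the cutoff to
restore mean zero, and integrate. On a fixed interval away from 0, closeness of derivatives in L²
gives uniform closeness of the functions, which controls the angular term. -/
lemma exists_test_approx {m : ℕ} {ψ : ℝ → ℝ} {a b : ℝ} (ha : 0 < a) (hab : a < b)
    (hψ : MemX2 m ψ) (hs : ∀ r ∉ Ioo a b, ψ r = 0) :
    ∃ C, ∀ δ, 0 < δ → ∃ φ : ℝ → ℝ, ContDiff ℝ 2 φ ∧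
      (∀ r ∉ Ioo (a / 2) (b + a / 2), φ r = 0) ∧ ‖jetLp m φ - jetLp m ψ‖ ^ 2 ≤ C * δ ^ 2 := by
  obtain ⟨χ, hχ, hχ0, hχ1, hχe, hχs⟩ := exists_cutoff ha hab
  set a' := a / 2 with ha'
  set b' := b + a / 2 with hb'
  have ha0 : 0 < a' := by positivity
  have hab' : a' < b' := by linarith
  have hIcc : Icc a b ⊆ Ioo a' b' := fun r hr => ⟨by linarith [hr.1], by linarith [hr.2]⟩
  have hψa : ψ a' = 0 := hs _ fun h => by linarith [h.1]
  have hψb : ψ b' = 0 := hs _ fun h => by linarith [h.2]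
  have hac := hψ.1 a' b' ha0 hab'
  have hg0 : ∀ r ∉ Icc a b, deriv ψ r = 0 := fun r hr => deriv_eq_zero_of_support hs hr
  have hgL : MemLp (deriv ψ) 2 ν := hψ.memLp.re
  have hX : 0 < ∫ x in a'..b', χ x := by
    refine intervalIntegral.integral_pos hab' hχ.continuous.continuousOn (fun r _ => hχ0 r) ?_
    exact ⟨a, ⟨by linarith, by linarith⟩, by rw [hχe a ⟨le_rfl, hab.le⟩]; norm_num⟩
  set X := ∫ x in a'..b', χ x
  -- C1 δ bounds the L¹ norm of the error k below: |k| ≤ δ/2 + k²/(2δ), the bound 1 ≤ x/a' changes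
  -- dx into x dx, and the integral of k² x is at most δ².
  set C1 := (b' - a' + 1 / a') / 2 with hC1
  have hC1p : 0 ≤ C1 := by
    have : 0 < b' - a' := by linarith
    positivity
  -- C3 δ bounds the L¹ distance from the corrected function h to ψ', hence the uniform distance
  -- between primitives: C1 δ from k, and the rest from the mean correction.
  set C3 := C1 + C1 / X * (b' - a') with hC3
  have hC3p : 0 ≤ C3 := by
    have : 0 < b' - a' := by linarith
    positivity
  refine ⟨2 + (Measure.real ν) (Icc a' b') * (2 * (C1 / X) ^ 2 + (m * C3 / a') ^ 2), fun δ hδ => ?_⟩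
  obtain ⟨g', hg'c, hg's, hg'e⟩ := hgL.exist_eLpNorm_sub_le (by simp) (by norm_num) hδ
  have hg'L : MemLp g' 2 ν := hg's.continuous.memLp_of_hasCompactSupport hg'c
  have hdiffL := hgL.sub hg'L
  set k : ℝ → ℝ := fun r => χ r * g' r - deriv ψ r with hk
  have hkle : ∀ r, |k r| ≤ |(deriv ψ - g') r| := by
    intro r
    simp only [hk, Pi.sub_apply]
    by_cases hr : r ∈ Icc a b
    · rw [hχe r hr, one_mul, abs_sub_comm]
    · rw [hg0 r hr, sub_zero, zero_sub, abs_neg, abs_mul, abs_of_nonneg (hχ0 r)]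
      exact mul_le_of_le_one_left (abs_nonneg _) (hχ1 r)
  have hkm : AEStronglyMeasurable k ν :=
    (hχ.continuous.mul hg's.continuous).aestronglyMeasurable.sub hgL.1
  have hkL : MemLp k 2 ν := hdiffL.mono hkm (.of_forall hkle)
  have hk2 : ∫ r, k r ^ 2 ∂ν ≤ δ ^ 2 := by
    refine le_trans ?_ (integral_sq_le_of_eLpNorm_le hdiffL hδ.le hg'e)
    exact integral_mono hkL.integrable_sq hdiffL.integrable_sq fun r => sq_le_sq.2 (hkle r)
  have hk0 : ∀ r ∉ Ioo a' b', k r = 0 := by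
    intro r hr
    simp only [hk]
    rw [hχs r hr, hg0 r fun h => hr (hIcc h)]; ring
  have hgi : IntervalIntegrable (deriv ψ) volume a' b' := hac.intervalIntegrable_deriv
  have hχg : Continuous fun r => χ r * g' r := hχ.continuous.mul hg's.continuous
  have hki : IntervalIntegrable k volume a' b' := (hχg.intervalIntegrable _ _).sub hgi
  have hk1 : ∫ x in a'..b', |k x| ≤ C1 * δ := by
    have i1 : IntegrableOn (fun r => k r ^ 2 * r) (Ioi 0) :=
      (integrable_radialMeasure_iff _).1 hkL.integrable_sq
    have i2 : IntervalIntegrable (fun r => k r ^ 2 * r) volume a' b' :=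
      (intervalIntegrable_iff_integrableOn_Ioc_of_le hab'.le).2
        (i1.mono_set fun r hr => ha0.trans hr.1)
    calc ∫ x in a'..b', |k x| ≤ ∫ x in a'..b', (δ / 2 + (1 / (2 * δ * a')) * (k x ^ 2 * x)) := by
          refine intervalIntegral.integral_mono_on hab'.le hki.abs
            (intervalIntegrable_const.add (i2.const_mul _)) fun x hx => ?_
          have h1 : k x ^ 2 * a' ≤ k x ^ 2 * x := by gcongr; exact hx.1
          have h2 : 1 / (2 * δ * a') * (k x ^ 2 * a') ≤ 1 / (2 * δ * a') * (k x ^ 2 * x) := by gcongr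
          refine le_trans ?_ (add_le_add_right h2 _)
          have h3 : δ / 2 + 1 / (2 * δ * a') * (k x ^ 2 * a') - |k x| = (|k x| - δ) ^ 2 / (2 * δ) := by
            rw [← sq_abs (k x)]; field_simp; ring
          have h4 : 0 ≤ (|k x| - δ) ^ 2 / (2 * δ) := by positivity
          linarith
      _ = δ / 2 * (b' - a') + 1 / (2 * δ * a') * ∫ x in a'..b', k x ^ 2 * x := by
          rw [intervalIntegral.integral_add intervalIntegrable_const (i2.const_mul _),
            intervalIntegral.integral_const_mul, intervalIntegral.integral_const, smul_eq_mul,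
            mul_comm (b' - a')]
      _ ≤ δ / 2 * (b' - a') + 1 / (2 * δ * a') * δ ^ 2 := by
          gcongr
          refine le_trans ?_ hk2
          rw [integral_radialMeasure, intervalIntegral.integral_of_le hab'.le]
          refine setIntegral_mono_set i1 ?_ (LE.le.eventuallyLE fun r hr => ha0.trans hr.1)
          refine (ae_restrict_iff' measurableSet_Ioi).2 (.of_forall fun r (hr : 0 < r) => ?_)
          positivity
      _ = C1 * δ := by rw [hC1]; field_simp
  set c := ∫ x in a'..b', k x with hc
  have hcle : |c| ≤ C1 * δ := (intervalIntegral.abs_integral_le_integral_abs hab'.le).trans hk1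
  have hcg : ∫ x in a'..b', χ x * g' x = c := by
    rw [hc, intervalIntegral.integral_sub (hχg.intervalIntegrable _ _) hgi,
      hac.integral_deriv_eq_sub, hψa, hψb]; ring
  -- The mean c is of order δ because ψ' has mean zero, so the correction is small.
  set h : ℝ → ℝ := fun r => χ r * g' r - c / X * χ r with hh
  have hhC : ContDiff ℝ 1 h := (hχ.mul (hg's.of_le (by exact_mod_cast le_top))).sub
    (contDiff_const.mul hχ)
  have hh0 : ∀ r ∉ Ioo a' b', h r = 0 := fun r hr => by simp only [hh]; rw [hχs r hr]; ring
  have hhint : ∫ x in a'..b', h x = 0 := by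
    rw [intervalIntegral.integral_sub (g := fun x => c / X * χ x) (hχg.intervalIntegrable _ _)
      ((continuous_const.mul hχ.continuous).intervalIntegrable _ _), hcg,
      intervalIntegral.integral_const_mul]
    change c - c / X * X = 0
    field_simp
    ring
  have hφs := primitive_eq_zero hhC.continuous hh0 hhint
  have hφC := contDiff_primitive hhC a'
  have hφX := memX2_of_contDiff m ha0 (hφC.of_le (one_le_two (α := WithTop ℕ∞))) hφs
  refine ⟨fun r => ∫ x in a'..r, h x, hφC, hφs, ?_⟩
  have hHi : IntervalIntegrable (fun x => h x - deriv ψ x) volume a' b' :=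
    (hhC.continuous.intervalIntegrable _ _).sub hgi
  have hHle : ∀ x, |h x - deriv ψ x| ≤ |k x| + C1 * δ / X := by
    intro x
    have e : h x - deriv ψ x = k x - c / X * χ x := by simp only [hh, hk]; ring
    rw [e]
    refine (abs_sub _ _).trans (add_le_add_right ?_ _)
    rw [abs_mul, abs_div, abs_of_pos hX, abs_of_nonneg (hχ0 x)]
    exact (mul_le_of_le_one_right (by positivity) (hχ1 x)).trans (by gcongr)
  have hH1 : ∫ x in a'..b', |h x - deriv ψ x| ≤ C3 * δ := by
    calc _ ≤ ∫ x in a'..b', (|k x| + C1 * δ / X) :=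
          intervalIntegral.integral_mono_on hab'.le hHi.abs
            (hki.abs.add intervalIntegrable_const) fun x _ => hHle x
      _ = (∫ x in a'..b', |k x|) + (b' - a') * (C1 * δ / X) := by
          rw [intervalIntegral.integral_add hki.abs intervalIntegrable_const,
            intervalIntegral.integral_const, smul_eq_mul]
      _ ≤ C1 * δ + (b' - a') * (C1 * δ / X) := by gcongr
      _ = C3 * δ := by rw [hC3]; ring
  have hΦ : ∀ r ∈ Icc a' b', |(∫ x in a'..r, h x) - ψ r| ≤ C3 * δ := by
    intro r hr
    have hsubI : uIcc a' r ⊆ uIcc a' b' := by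
      rw [uIcc_of_le hr.1, uIcc_of_le hab'.le]; exact Icc_subset_Icc_right hr.2
    have e1 : ψ r = ∫ x in a'..r, deriv ψ x := by
      rw [(hψ.1.ac ha0 (ha0.trans_le hr.1)).integral_deriv_eq_sub, hψa, sub_zero]
    rw [e1, ← intervalIntegral.integral_sub (hhC.continuous.intervalIntegrable _ _)
      (hgi.mono_set hsubI)]
    refine (intervalIntegral.abs_integral_le_integral_abs hr.1).trans (le_trans ?_ hH1)
    exact intervalIntegral.integral_mono_interval le_rfl hr.1 hr.2
      (.of_forall fun _ => abs_nonneg _) hHi.abs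
  have hD := hφX.sub hψ
  rw [← jetLp_sub hφX hψ, hD.norm_sq]
  have hdφ : ∀ r, HasDerivAt (fun r => ∫ x in a'..r, h x) (h r) r := fun r =>
    (hhC.continuous.integral_hasStrictDerivAt a' r).hasDerivAt
  have hi1 : Integrable ((Icc a' b').indicator fun _ : ℝ =>
      (2 * (C1 / X) ^ 2 + (m * C3 / a') ^ 2) * δ ^ 2) ν :=
    (integrable_indicator_iff measurableSet_Icc).2
      (integrableOn_const (radialMeasure_Icc_lt_top _ _).ne)
  calc _ ≤ ∫ r, (2 * k r ^ 2 + (Icc a' b').indicator (fun _ : ℝ =>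
        (2 * (C1 / X) ^ 2 + (m * C3 / a') ^ 2) * δ ^ 2) r) ∂ν := by
        refine integral_mono_ae hD.integrable_sq ((hkL.integrable_sq.const_mul 2).add hi1) ?_
        filter_upwards [hψ.1.ae_differentiableAt, ae_radialMeasure_pos] with r hr hr0
        rw [norm_jet_sq, deriv_fun_sub (hdφ r).differentiableAt hr, (hdφ r).deriv]
        by_cases hrI : r ∈ Icc a' b'
        · rw [indicator_of_mem hrI]
          have h1 : (h r - deriv ψ r) ^ 2 ≤ 2 * k r ^ 2 + 2 * (C1 * δ / X) ^ 2 := by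
            have := sq_le_sq' (by linarith [abs_nonneg (h r - deriv ψ r), abs_nonneg (k r),
              (by positivity : 0 ≤ C1 * δ / X)]) (hHle r)
            rw [sq_abs] at this
            have h5 := sq_nonneg (|k r| - C1 * δ / X)
            rw [← sq_abs (k r)]
            nlinarith
          have h2 := hΦ r hrI
          have h3 : (m : ℝ) ^ 2 * ((∫ x in a'..r, h x) - ψ r) ^ 2 / r ^ 2 ≤
              (m : ℝ) ^ 2 * (C3 * δ) ^ 2 / a' ^ 2 := by
            have h4 : ((∫ x in a'..r, h x) - ψ r) ^ 2 ≤ (C3 * δ) ^ 2 :=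
              sq_le_sq.2 (h2.trans (le_abs_self _))
            have := hrI.1
            gcongr
          calc _ ≤ 2 * k r ^ 2 + 2 * (C1 * δ / X) ^ 2 + (m : ℝ) ^ 2 * (C3 * δ) ^ 2 / a' ^ 2 :=
                add_le_add h1 h3
            _ = _ := by ring
        · have h1 : r ∉ Ioo a' b' := fun h => hrI (Ioo_subset_Icc_self h)
          rw [indicator_of_notMem hrI, hφs r h1, hh0 r h1, hg0 r fun h => h1 (hIcc h),
            hs r fun h => h1 (hIcc (Ioo_subset_Icc_self h))]
          simp only [sub_zero, ne_eq, OfNat.ofNat_ne_zero, not_false_eq_true, zero_pow, mul_zero,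
            zero_div, add_zero]
          positivity
    _ = 2 * ∫ r, k r ^ 2 ∂ν + (Measure.real ν) (Icc a' b') *
        ((2 * (C1 / X) ^ 2 + (m * C3 / a') ^ 2) * δ ^ 2) := by
        rw [integral_add (hkL.integrable_sq.const_mul 2) hi1, integral_const_mul,
          integral_indicator measurableSet_Icc, setIntegral_const, smul_eq_mul]
    _ ≤ 2 * δ ^ 2 + (Measure.real ν) (Icc a' b') *
        ((2 * (C1 / X) ^ 2 + (m * C3 / a') ^ 2) * δ ^ 2) := by gcongr
    _ = _ := by ring

/-! ### The weak form of the equation -/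

/-- Minus the derivative of the energy at `v`, in the direction of `ψ`. -/
def slope (m : ℕ) (v ψ : ℝ → ℝ) : ℝ := nlPair m v ψ - inner ℝ (jetLp m v) (jetLp m ψ)

lemma abs_slope_sub_right_le {m : ℕ} {v ψ φ : ℝ → ℝ} (hv : MemX2 m v) (hψ : MemX2 m ψ)
    (hφ : MemX2 m φ) :
    |slope m v φ - slope m v ψ| ≤ 3 * ‖jetLp m v‖ * ‖jetLp m φ - jetLp m ψ‖ := by
  have h1 := abs_nlPair_sub_right_le hφ hψ hv
  have h2 := abs_real_inner_le_norm (jetLp m v) (jetLp m φ - jetLp m ψ)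
  rw [inner_sub_right] at h2
  rw [slope, slope, show ∀ a b c d : ℝ, a - b - (c - d) = a - c - (b - d) by intros; ring]
  refine (abs_sub _ _).trans ?_
  linarith

lemma integrable_mul_of_bound {D ψ : ℝ → ℝ} {a b B : ℝ} (hD : AEStronglyMeasurable D ν)
    (hψ : AEStronglyMeasurable ψ ν) (hs : ∀ r ∉ Icc a b, ψ r = 0)
    (hB : ∀ r, 0 < r → |D r * ψ r| ≤ B) :
    Integrable (fun r => D r * ψ r) ν ∧
      |∫ r, D r * ψ r ∂ν| ≤ (Measure.real ν) (Icc a b) * B := by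
  have hi : Integrable ((Icc a b).indicator fun _ : ℝ => B) ν :=
    (integrable_indicator_iff measurableSet_Icc).2
      (integrableOn_const (radialMeasure_Icc_lt_top _ _).ne)
  have hle : ∀ r, 0 < r → ‖D r * ψ r‖ ≤ (Icc a b).indicator (fun _ : ℝ => B) r := by
    intro r hr
    by_cases hrI : r ∈ Icc a b
    · rw [indicator_of_mem hrI]; exact hB r hr
    · rw [indicator_of_notMem hrI, hs r hrI]; simp
  refine ⟨hi.mono' (hD.mul hψ) (ae_radialMeasure_of_forall hle), ?_⟩
  rw [← Real.norm_eq_abs]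
  refine (norm_integral_le_of_norm_le hi (ae_radialMeasure_of_forall hle)).trans_eq ?_
  rw [integral_indicator measurableSet_Icc, setIntegral_const, smul_eq_mul]

namespace IsMildCurve

variable {m : ℕ} {A c : ℝ} {w : ℝ → ℝ → ℝ}

lemma A_nonneg (h : IsMildCurve m A c w) : 0 ≤ A := (norm_nonneg _).trans (h.bound 0)

lemma abs_le (hm : 1 ≤ m) (h : IsMildCurve m A c w) (t : ℝ) {r : ℝ} (hr : 0 < r) : |w t r| ≤ A :=
  ((h.mem t).abs_le hm hr).trans (h.bound t)

lemma continuous_slope (h : IsMildCurve m A c w) {ψ : ℝ → ℝ} (hψ : MemX2 m ψ) :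
    Continuous fun t => slope m (w t) ψ :=
  (h.continuous_nlPair hψ).sub (h.cont.inner continuous_const)

lemma abs_sub_le (hm : 1 ≤ m) (h : IsMildCurve m A c w) (s t : ℝ) {r : ℝ} (hr : 0 < r) :
    |w t r - w s r| ≤ 2 * A :=
  (abs_sub _ _).trans (by linarith [h.abs_le hm t hr, h.abs_le hm s hr])

lemma integrable_sub_mul (hm : 1 ≤ m) (h : IsMildCurve m A c w) (s t : ℝ) {ψ : ℝ → ℝ} {a b : ℝ}
    (hψ : MemX2 m ψ) (hs : ∀ r ∉ Ioo a b, ψ r = 0) :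
    Integrable (fun r => (w t r - w s r) * ψ r) ν := by
  refine (integrable_mul_of_bound (a := a) (b := b) (B := 2 * A * ‖jetLp m ψ‖)
    ((h.mem t).1.sub (h.mem s).1).aesm hψ.1.aesm
    (fun r hr => hs r fun h => hr (Ioo_subset_Icc_self h)) fun r hr => ?_).1
  rw [abs_mul]
  exact mul_le_mul (h.abs_sub_le hm s t hr) (hψ.abs_le hm hr) (abs_nonneg _)
    (by linarith [h.A_nonneg])

lemma weak_test_interval (hm : 1 ≤ m) (h : IsMildCurve m A c w) {φ : ℝ → ℝ} {a b : ℝ} (ha : 0 < a)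
    (hab : a < b) (hφ : ContDiff ℝ 2 φ) (hs : ∀ r ∉ Ioo a b, φ r = 0) {s t : ℝ} (h0s : 0 ≤ s)
    (hst : s ≤ t) (htc : t ≤ c) :
    ∫ r, (w t r - w s r) * φ r ∂ν = ∫ x in s..t, slope m (w x) φ := by
  have hφX := memX2_of_contDiff m ha (hφ.of_le (one_le_two (α := WithTop ℕ∞))) hs
  have h0 : ∀ x, 0 ≤ x → x ≤ c →
      ∫ r, (w x r - w 0 r) * φ r ∂ν = ∫ y in (0 : ℝ)..x, slope m (w y) φ := by
    intro x hx hxc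
    rcases hx.eq_or_lt with rfl | hx
    · simp
    · exact h.weak_test hm ha hab hφ hs ⟨hx, hxc⟩
  have hcs := h.continuous_slope hφX
  rw [← intervalIntegral.integral_interval_sub_left (hcs.intervalIntegrable 0 t)
    (hcs.intervalIntegrable 0 s), ← h0 t (h0s.trans hst) htc, ← h0 s h0s (hst.trans htc),
    ← integral_sub (h.integrable_sub_mul hm 0 t hφX hs) (h.integrable_sub_mul hm 0 s hφX hs)]
  exact integral_radialMeasure_congr fun r _ => by ring

/-- The weak form of the equation, against compactly supported elements of `X²`. -/
lemma weak (hm : 1 ≤ m) (h : IsMildCurve m A c w) {ψ : ℝ → ℝ} {a b : ℝ} (ha : 0 < a)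
    (hab : a < b) (hψ : MemX2 m ψ) (hs : ∀ r ∉ Ioo a b, ψ r = 0) {s t : ℝ} (h0s : 0 ≤ s)
    (hst : s ≤ t) (htc : t ≤ c) :
    ∫ r, (w t r - w s r) * ψ r ∂ν = ∫ x in s..t, slope m (w x) ψ := by
  obtain ⟨C, hC⟩ := exists_test_approx ha hab hψ hs
  have hA := h.A_nonneg
  set a' := a / 2 with ha'
  set b' := b + a / 2 with hb'
  have hs' : ∀ r ∉ Ioo a' b', ψ r = 0 := fun r hr =>
    hs r fun h => hr ⟨by linarith [h.1], by linarith [h.2]⟩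
  -- K times the X² distance η from φ to ψ bounds the cost of exchanging them: the first term uses
  -- the sup bounds on the left side, the second the Lipschitz bound of the slope on the right.
  set K := (Measure.real ν) (Icc a' b') * (2 * A) + 3 * A * |t - s| with hK
  have hK0 : 0 ≤ K := by positivity
  refine eq_of_abs_sub_le_all fun ε hε => ?_
  -- With this δ, C δ² ≤ (ε/(K+1))² because |C| ≤ (|C| + 1)².
  have hδ : 0 < ε / ((K + 1) * (|C| + 1)) := by positivity
  obtain ⟨φ, hφ, hφs, hφe⟩ := hC _ hδ
  have hφX := memX2_of_contDiff m (half_pos ha) (hφ.of_le (one_le_two (α := WithTop ℕ∞))) hφs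
  set η := ‖jetLp m φ - jetLp m ψ‖ with hη
  have hηle : η ≤ ε / (K + 1) := by
    refine abs_le_of_sq_le_sq' ?_ (by positivity) |>.2
    calc η ^ 2 ≤ |C| * (ε / ((K + 1) * (|C| + 1))) ^ 2 := hφe.trans (by gcongr; exact le_abs_self C)
      _ = (ε / (K + 1)) ^ 2 * (|C| / (|C| + 1) ^ 2) := by field_simp
      _ ≤ (ε / (K + 1)) ^ 2 * 1 := by
          gcongr
          rw [div_le_one (by positivity)]
          nlinarith [abs_nonneg C]
      _ = _ := mul_one _
  have hw := h.weak_test_interval hm (half_pos ha) (by linarith : a' < b') hφ hφs h0s hst htc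
  have e1 : |∫ r, (w t r - w s r) * (φ r - ψ r) ∂ν| ≤
      (Measure.real ν) (Icc a' b') * (2 * A * η) := by
    refine (integrable_mul_of_bound ((h.mem t).1.sub (h.mem s).1).aesm (hφX.1.sub hψ.1).aesm
      (fun r hr => ?_) fun r hr => ?_).2
    · have hr' : r ∉ Ioo a' b' := fun h => hr (Ioo_subset_Icc_self h)
      rw [hφs r hr', hs' r hr', sub_zero]
    · rw [abs_mul]
      exact mul_le_mul (h.abs_sub_le hm s t hr) (hφX.abs_sub_le hm hψ hr) (abs_nonneg _)
        (by linarith)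
  have e2 : |(∫ x in s..t, slope m (w x) φ) - ∫ x in s..t, slope m (w x) ψ| ≤
      3 * A * η * |t - s| := by
    rw [← intervalIntegral.integral_sub ((h.continuous_slope hφX).intervalIntegrable _ _)
      ((h.continuous_slope hψ).intervalIntegrable _ _), ← Real.norm_eq_abs]
    refine intervalIntegral.norm_integral_le_of_norm_le_const fun x _ => ?_
    refine (abs_slope_sub_right_le (h.mem x) hψ hφX).trans ?_
    have := h.bound x
    gcongr
  have e3 : ∫ r, (w t r - w s r) * (φ r - ψ r) ∂ν =
      ∫ r, (w t r - w s r) * φ r ∂ν - ∫ r, (w t r - w s r) * ψ r ∂ν := by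
    rw [← integral_sub (h.integrable_sub_mul hm s t hφX hφs) (h.integrable_sub_mul hm s t hψ hs)]
    exact integral_radialMeasure_congr fun r _ => by ring
  rw [e3, hw] at e1
  have e4 : η * K ≤ ε := by
    calc η * K ≤ ε / (K + 1) * K := by gcongr
      _ ≤ ε := by
        rw [div_mul_eq_mul_div, div_le_iff₀ (by positivity)]
        nlinarith
  rw [_root_.abs_le] at e1 e2 ⊢
  constructor <;> nlinarith [e1.1, e1.2, e2.1, e2.2]

end IsMildCurve

/-! ### Cutting off elements of `X²` near `0` and infinity -/

/-- A smooth step, equal to `0` on `(-∞, 1]` and to `1` on `[2, ∞)`. -/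
def step (x : ℝ) : ℝ := Real.smoothTransition (x - 1)

lemma contDiff_step : ContDiff ℝ 1 step :=
  Real.smoothTransition.contDiff.comp (contDiff_id.sub contDiff_const)

lemma step_nonneg (x : ℝ) : 0 ≤ step x := Real.smoothTransition.nonneg _

lemma step_le_one (x : ℝ) : step x ≤ 1 := Real.smoothTransition.le_one _

lemma step_eq_zero {x : ℝ} (hx : x ≤ 1) : step x = 0 :=
  Real.smoothTransition.zero_of_nonpos (by linarith)

lemma step_eq_one {x : ℝ} (hx : 2 ≤ x) : step x = 1 :=
  Real.smoothTransition.one_of_one_le (by linarith)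

lemma deriv_step_eq_zero {x : ℝ} (hx : x ∉ Icc (1 : ℝ) 2) : deriv step x = 0 := by
  rcases not_and_or.1 hx with h | h <;> rw [not_le] at h
  · have : step =ᶠ[𝓝 x] fun _ => 0 := by
      filter_upwards [Iio_mem_nhds h] with y hy using step_eq_zero (le_of_lt hy)
    rw [this.deriv_eq, deriv_const]
  · have : step =ᶠ[𝓝 x] fun _ => 1 := by
      filter_upwards [Ioi_mem_nhds h] with y hy using step_eq_one (le_of_lt hy)
    rw [this.deriv_eq, deriv_const]

lemma exists_bound_mul_deriv_step : ∃ K, ∀ x, |x * deriv step x| ≤ K := by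
  have hc : Continuous fun x => x * deriv step x :=
    continuous_id.mul (contDiff_step.continuous_deriv le_rfl)
  obtain ⟨K, _, hK⟩ := exists_bound_of_support (a := 0) (b := 3) hc fun r hr => by
    rw [deriv_step_eq_zero fun h => hr ⟨by linarith [h.1], by linarith [h.2]⟩, mul_zero]
  exact ⟨K, hK⟩

/-- A function equal to `1` on `[2 / n, n]`, supported in `[1 / n, 2 n]`. -/
def cutoff (n : ℝ) (r : ℝ) : ℝ := step (n * r) * (1 - step (r / n))

lemma contDiff_cutoff (n : ℝ) : ContDiff ℝ 1 (cutoff n) :=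
  (contDiff_step.comp (contDiff_const.mul contDiff_id)).mul
    (contDiff_const.sub (contDiff_step.comp (contDiff_id.div_const n)))

lemma cutoff_nonneg (n r : ℝ) : 0 ≤ cutoff n r :=
  mul_nonneg (step_nonneg _) (by linarith [step_le_one (r / n)])

lemma cutoff_le_one (n r : ℝ) : cutoff n r ≤ 1 :=
  mul_le_one₀ (step_le_one _) (by linarith [step_le_one (r / n)]) (by linarith [step_nonneg (r / n)])

lemma cutoff_eq_one {n r : ℝ} (hn : 0 < n) (h1 : 2 ≤ n * r) (h2 : r ≤ n) : cutoff n r = 1 := by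
  rw [cutoff, step_eq_one h1, step_eq_zero ((div_le_one hn).2 h2)]; norm_num

lemma cutoff_eq_zero {n r : ℝ} (hn : 0 < n) (h : r ∉ Ioo (1 / n) (2 * n)) : cutoff n r = 0 := by
  rcases not_and_or.1 h with h | h <;> rw [not_lt] at h
  · rw [cutoff, step_eq_zero, zero_mul]
    rw [le_div_iff₀ hn] at h; linarith
  · rw [cutoff, step_eq_one (x := r / n), sub_self, mul_zero]
    rwa [le_div_iff₀ hn]

lemma deriv_cutoff {n : ℝ} (r : ℝ) : deriv (cutoff n) r =
    n * deriv step (n * r) * (1 - step (r / n)) - step (n * r) * (deriv step (r / n) / n) := by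
  have hd : ∀ x, HasDerivAt step (deriv step x) x := fun x =>
    (contDiff_step.differentiable one_ne_zero x).hasDerivAt
  have h1 : HasDerivAt (fun r => step (n * r)) (deriv step (n * r) * n) r :=
    (hd (n * r)).comp r (by simpa using (hasDerivAt_id r).const_mul n)
  have h2 : HasDerivAt (fun r => step (r / n)) (deriv step (r / n) * (1 / n)) r :=
    HasDerivAt.comp (h₂ := step) (h := fun r => r / n) r (hd (r / n))
      ((hasDerivAt_id' r).div_const n)
  have h3 : HasDerivAt (cutoff n) _ r := h1.mul ((hasDerivAt_const r (1 : ℝ)).sub h2)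
  rw [h3.deriv]
  ring

/-- The operator r d/dr is scale invariant, so the bound for `step` passes to both factors of the
cutoff, uniformly in n. -/
lemma exists_bound_deriv_cutoff : ∃ K, 0 ≤ K ∧ ∀ n r : ℝ, 0 < n → |r * deriv (cutoff n) r| ≤ K := by
  obtain ⟨K, hK⟩ := exists_bound_mul_deriv_step
  have hK0 : 0 ≤ K := (abs_nonneg _).trans (hK 0)
  refine ⟨2 * K, by positivity, fun n r hn => ?_⟩
  have e : r * deriv (cutoff n) r = (n * r * deriv step (n * r)) * (1 - step (r / n)) -
      step (n * r) * (r / n * deriv step (r / n)) := by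
    rw [deriv_cutoff]; ring
  rw [e]
  refine (abs_sub _ _).trans ?_
  rw [abs_mul _ (1 - step (r / n)), abs_mul (step (n * r)), abs_of_nonneg (step_nonneg _),
    abs_of_nonneg (by linarith [step_le_one (r / n)] : 0 ≤ 1 - step (r / n))]
  have h1 := mul_le_mul (hK (n * r)) (by linarith [step_nonneg (r / n)] : 1 - step (r / n) ≤ 1)
    (by linarith [step_le_one (r / n)]) hK0
  have h2 := mul_le_mul (step_le_one (n * r)) (hK (r / n)) (abs_nonneg _) zero_le_one
  linarith

section cutoff

variable {m : ℕ} {v : ℝ → ℝ}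

/-- The extra term χ' v in the derivative is at most K |v| / r, which the X² density already
contains since m ≥ 1. No Hardy inequality is needed. -/
lemma norm_jet_cutoff_sq_le (hm : 1 ≤ m) {K : ℝ} {n r : ℝ}
    (hK : |r * deriv (cutoff n) r| ≤ K) (hr : 0 < r) (hv : DifferentiableAt ℝ v r) :
    ‖jet m (fun r => cutoff n r * v r) r‖ ^ 2 ≤ 2 * (1 + K ^ 2) * ‖jet m v r‖ ^ 2 := by
  have hχ : DifferentiableAt ℝ (cutoff n) r := (contDiff_cutoff n).differentiable one_ne_zero r
  rw [norm_jet_sq, norm_jet_sq, deriv_fun_mul hχ hv]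
  have h0 := cutoff_nonneg n r
  have h1 := cutoff_le_one n r
  have hm1 : (1 : ℝ) ≤ (m : ℝ) ^ 2 := one_le_pow₀ (by exact_mod_cast hm)
  have hχ2 : cutoff n r ^ 2 ≤ 1 := pow_le_one₀ h0 h1
  have e1 : (deriv (cutoff n) r * v r) ^ 2 ≤ K ^ 2 * (v r ^ 2 / r ^ 2) := by
    have h3 : (r * deriv (cutoff n) r) ^ 2 ≤ K ^ 2 := sq_le_sq.2 (hK.trans (le_abs_self _))
    calc (deriv (cutoff n) r * v r) ^ 2 = (r * deriv (cutoff n) r) ^ 2 * (v r ^ 2 / r ^ 2) := by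
          field_simp
      _ ≤ _ := by gcongr
  have e2 : (cutoff n r * deriv v r) ^ 2 ≤ deriv v r ^ 2 := by
    rw [mul_pow]; exact mul_le_of_le_one_left (sq_nonneg _) hχ2
  have e3 : (m : ℝ) ^ 2 * (cutoff n r * v r) ^ 2 / r ^ 2 ≤ (m : ℝ) ^ 2 * v r ^ 2 / r ^ 2 := by
    rw [mul_pow]
    gcongr
    exact mul_le_of_le_one_left (sq_nonneg _) hχ2
  have e4 : v r ^ 2 / r ^ 2 ≤ (m : ℝ) ^ 2 * v r ^ 2 / r ^ 2 := by
    gcongr; exact le_mul_of_one_le_left (sq_nonneg _) hm1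
  have e5 : 0 ≤ v r ^ 2 / r ^ 2 := by positivity
  have e6 : K ^ 2 * (v r ^ 2 / r ^ 2) ≤ K ^ 2 * ((m : ℝ) ^ 2 * v r ^ 2 / r ^ 2) := by gcongr
  have e7 : 0 ≤ K ^ 2 * deriv v r ^ 2 := by positivity
  nlinarith [sq_nonneg (deriv (cutoff n) r * v r - cutoff n r * deriv v r)]

lemma MemX2.cutoff_mul (hm : 1 ≤ m) (hv : MemX2 m v) {n : ℝ} (hn : 0 < n) :
    MemX2 m fun r => cutoff n r * v r := by
  obtain ⟨K, _, hK⟩ := exists_bound_deriv_cutoff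
  have hL := (LocAC.of_contDiff (contDiff_cutoff n)).mul hv.1
  have hae := aestronglyMeasurable_jet m hL
  rw [memX2_iff hL, memLp_two_iff_integrable_sq_norm hae]
  refine (hv.integrable_sq.const_mul (2 * (1 + K ^ 2))).mono' (hae.norm.pow 2) ?_
  filter_upwards [hv.1.ae_differentiableAt, ae_radialMeasure_pos] with r h1 hr
  rw [Real.norm_eq_abs, abs_of_nonneg (by positivity)]
  exact norm_jet_cutoff_sq_le hm (hK n r hn) hr h1

lemma MemX2.tendsto_cutoff_mul (hm : 1 ≤ m) (hv : MemX2 m v) :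
    Tendsto (fun n : ℕ => ‖jetLp m (fun r => cutoff (n + 1) r * v r) - jetLp m v‖) atTop (𝓝 0) := by
  obtain ⟨K, _, hK⟩ := exists_bound_deriv_cutoff
  have hn : ∀ n : ℕ, (0 : ℝ) < n + 1 := fun n => by positivity
  have hmem := fun n : ℕ => hv.cutoff_mul hm (hn n)
  have hsq : Tendsto (fun n : ℕ => ‖jetLp m (fun r => cutoff (n + 1) r * v r) - jetLp m v‖ ^ 2)
      atTop (𝓝 (∫ _, (0 : ℝ) ∂ν)) := by
    have e : ∀ n : ℕ, ‖jetLp m (fun r => cutoff (n + 1) r * v r) - jetLp m v‖ ^ 2 =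
        ∫ r, ‖jet m (fun r => cutoff (n + 1) r * v r - v r) r‖ ^ 2 ∂ν := fun n => by
      rw [← jetLp_sub (hmem n) hv, ((hmem n).sub hv).norm_sq]
    simp_rw [e]
    have hdom : Integrable (fun r => 2 * (2 * (1 + K ^ 2) * ‖jet m v r‖ ^ 2 + ‖jet m v r‖ ^ 2)) ν := by
      have h1 := (hv.integrable_sq.const_mul (2 * (1 + K ^ 2))).add hv.integrable_sq
      exact h1.const_mul 2
    refine tendsto_integral_of_dominated_convergence
      (F := fun (n : ℕ) r => ‖jet m (fun r => cutoff (n + 1) r * v r - v r) r‖ ^ 2)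
      (f := fun _ => 0) (fun r => 2 * (2 * (1 + K ^ 2) * ‖jet m v r‖ ^ 2 + ‖jet m v r‖ ^ 2))
      (fun n => ((hmem n).sub hv).integrable_sq.1)
      hdom (fun n => ?_) ?_
    · filter_upwards [hv.1.ae_differentiableAt, ae_radialMeasure_pos,
        jet_sub_ae m (hmem n).1 hv.1] with r h1 hr h2
      rw [h2, Real.norm_eq_abs, abs_of_nonneg (by positivity)]
      have h3 := norm_jet_cutoff_sq_le (m := m) hm (hK (n + 1) r (hn n)) hr h1
      have h4 := norm_sub_le (jet m (fun r => cutoff (n + 1) r * v r) r) (jet m v r)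
      have h5 := pow_le_pow_left₀ (norm_nonneg _) h4 2
      nlinarith [sq_nonneg (‖jet m (fun r => cutoff (n + 1) r * v r) r‖ - ‖jet m v r‖)]
    · filter_upwards [ae_radialMeasure_pos] with r hr
      refine tendsto_const_nhds.congr' ?_
      -- This threshold makes the cutoff equal to 1 on all of (r/2, 2r); a neighbourhood of r is
      -- needed because the derivative enters.
      obtain ⟨N, hN⟩ := exists_nat_gt (4 / r + 2 * r)
      filter_upwards [eventually_ge_atTop N] with n hnN
      have hNn : 4 / r + 2 * r < (n : ℝ) + 1 := by
        have : (N : ℝ) ≤ n := by exact_mod_cast hnN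
        linarith
      have hp : 0 < 4 / r := by positivity
      have h1 : (fun s => cutoff (n + 1) s * v s - v s) =ᶠ[𝓝 r] fun _ => 0 := by
        filter_upwards [Ioo_mem_nhds (by linarith : r / 2 < r) (by linarith : r < 2 * r)] with s hs
        rw [cutoff_eq_one (hn n) ?_ (by linarith [hs.2]), one_mul, sub_self]
        have h6 : 4 / r * (r / 2) ≤ ((n : ℝ) + 1) * s := by
          have := hs.1
          gcongr
          linarith
        calc (2 : ℝ) = 4 / r * (r / 2) := by field_simp; norm_num
          _ ≤ _ := h6
      have h7 : cutoff ((n : ℝ) + 1) r * v r - v r = 0 := h1.self_of_nhds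
      rw [norm_jet_sq, h1.deriv_eq, h7]
      simp
  rw [integral_zero] at hsq
  have h4 := hsq.sqrt
  simpa only [Real.sqrt_sq (norm_nonneg _), Real.sqrt_zero] using h4

end cutoff

namespace IsMildCurve

variable {m : ℕ} {A c : ℝ} {w : ℝ → ℝ → ℝ}

/-- Testing the equation against the increment of the solution. -/
lemma integral_sq_sub_le (hm : 1 ≤ m) (h : IsMildCurve m A c w) {s t : ℝ} (h0s : 0 ≤ s)
    (hst : s ≤ t) (htc : t ≤ c) :
    Integrable (fun r => (w t r - w s r) ^ 2) ν ∧
      ∫ r, (w t r - w s r) ^ 2 ∂ν ≤ ∫ x in s..t, slope m (w x) fun r => w t r - w s r := by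
  set δ : ℝ → ℝ := fun r => w t r - w s r with hδ
  have hδX : MemX2 m δ := (h.mem t).sub (h.mem s)
  have hn : ∀ n : ℕ, (0 : ℝ) < n + 1 := fun n => by positivity
  set δn : ℕ → ℝ → ℝ := fun n r => cutoff (n + 1) r * δ r with hδn
  have hX : ∀ n, MemX2 m (δn n) := fun n => hδX.cutoff_mul hm (hn n)
  have hsupp : ∀ n : ℕ, ∀ r ∉ Ioo (1 / ((n : ℝ) + 1)) (2 * (n + 1)), δn n r = 0 := fun n r hr => by
    simp only [hδn]
    rw [cutoff_eq_zero (hn n) hr, zero_mul]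
  have hweak : ∀ n, ∫ r, δ r * δn n r ∂ν = ∫ x in s..t, slope m (w x) (δn n) := by
    intro n
    refine h.weak hm (one_div_pos.2 (hn n)) ?_ (hX n) (hsupp n) h0s hst htc
    rw [div_lt_iff₀ (hn n)]
    nlinarith [hn n, (Nat.cast_nonneg n : (0 : ℝ) ≤ n)]
  have hlim : Tendsto (fun n => ∫ x in s..t, slope m (w x) (δn n)) atTop
      (𝓝 (∫ x in s..t, slope m (w x) δ)) := by
    refine tendsto_iff_norm_sub_tendsto_zero.2 ?_
    have h1 := ((hδX.tendsto_cutoff_mul hm).const_mul (3 * A)).mul_const |t - s|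
    rw [mul_zero, zero_mul] at h1
    refine squeeze_zero (fun _ => norm_nonneg _) (fun n => ?_) h1
    rw [← intervalIntegral.integral_sub ((h.continuous_slope (hX n)).intervalIntegrable _ _)
      ((h.continuous_slope hδX).intervalIntegrable _ _)]
    refine intervalIntegral.norm_integral_le_of_norm_le_const fun x _ => ?_
    refine (abs_slope_sub_right_le (h.mem x) hδX (hX n)).trans ?_
    have := h.bound x
    gcongr
  have hnn : ∀ n r, 0 ≤ δ r * δn n r := fun n r => by
    have : δ r * δn n r = cutoff (n + 1) r * δ r ^ 2 := by simp only [hδn]; ring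
    rw [this]
    exact mul_nonneg (cutoff_nonneg _ _) (sq_nonneg _)
  -- The increment is not known beforehand to be square integrable for r dr. Fatou's lemma deduces
  -- it from the convergence of the right-hand sides.
  have hfatou : ∫⁻ r, ENNReal.ofReal (δ r ^ 2) ∂ν ≤
      ENNReal.ofReal (∫ x in s..t, slope m (w x) δ) := by
    have hm1 : ∀ n, AEMeasurable (fun r => ENNReal.ofReal (δ r * δn n r)) ν := fun n =>
      (hδX.1.aesm.mul (hX n).1.aesm).aemeasurable.ennreal_ofReal
    calc ∫⁻ r, ENNReal.ofReal (δ r ^ 2) ∂ν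
        = ∫⁻ r, liminf (fun n => ENNReal.ofReal (δ r * δn n r)) atTop ∂ν := by
          refine lintegral_radialMeasure_congr fun r hr => ?_
          refine (Tendsto.liminf_eq ?_).symm
          refine tendsto_const_nhds.congr' ?_
          obtain ⟨N, hN⟩ := exists_nat_gt (2 / r + r)
          filter_upwards [eventually_ge_atTop N] with n hnN
          have hNn : 2 / r + r < (n : ℝ) + 1 := by
            have : (N : ℝ) ≤ n := by exact_mod_cast hnN
            linarith
          have hp : 0 < 2 / r := by positivity
          simp only [hδn]
          rw [cutoff_eq_one (hn n) _ (by linarith), one_mul, sq]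
          rw [← div_le_iff₀ hr]
          linarith
      _ ≤ liminf (fun n => ∫⁻ r, ENNReal.ofReal (δ r * δn n r) ∂ν) atTop := lintegral_liminf_le' hm1
      _ = liminf (fun n => ENNReal.ofReal (∫ x in s..t, slope m (w x) (δn n))) atTop := by
          congr 1
          ext n
          rw [← hweak n, ofReal_integral_eq_lintegral_ofReal
            (h.integrable_sub_mul hm s t (hX n) (hsupp n)) (.of_forall (hnn n))]
      _ = _ := (ENNReal.tendsto_ofReal hlim).liminf_eq
  have hint : Integrable (fun r => δ r ^ 2) ν := by
    refine ⟨hδX.1.aesm.pow 2, ?_⟩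
    rw [hasFiniteIntegral_iff_ofReal (.of_forall fun r => sq_nonneg _)]
    exact hfatou.trans_lt ENNReal.ofReal_lt_top
  refine ⟨hint, ?_⟩
  have hlim0 : 0 ≤ ∫ x in s..t, slope m (w x) δ :=
    ge_of_tendsto' hlim fun n => by
      rw [← hweak n]; exact integral_nonneg (hnn n)
  rw [← ofReal_integral_eq_lintegral_ofReal hint (.of_forall fun r => sq_nonneg _)] at hfatou
  exact (ENNReal.ofReal_le_ofReal_iff hlim0).1 hfatou

end IsMildCurve

/-! ### The potential part of the energy -/

/-- The primitive `(x² - sin² x) / 2` of `nlFun`. -/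
def potFun (x : ℝ) : ℝ := (x ^ 2 - Real.sin x ^ 2) / 2

lemma hasDerivAt_potFun (x : ℝ) : HasDerivAt potFun (nlFun x) x := by
  have h := (((hasDerivAt_id x).pow 2).sub ((Real.hasDerivAt_sin x).pow 2)).div_const 2
  refine h.congr_deriv ?_
  rw [nlFun, Real.sin_two_mul]
  simp only [id, Nat.cast_ofNat]
  ring

/-- Mean value inequality for ξ ↦ potFun ξ - (nlFun z) ξ between x and y. The linearisation point z
is a third point, because the weak equation evaluates the nonlinearity at intermediate times while
the potential difference involves the end times. -/
lemma abs_potFun_sub_le {x y z ω : ℝ} (hx : |x - z| ≤ ω) (hy : |y - z| ≤ ω) :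
    |potFun y - potFun x - nlFun z * (y - x)| ≤ 2 * ω * (x ^ 2 + y ^ 2 + z ^ 2) * |y - x| := by
  have hd : ∀ ξ, HasDerivAt (fun ξ => potFun ξ - nlFun z * ξ) (nlFun ξ - nlFun z) ξ := fun ξ => by
    simpa using (hasDerivAt_potFun ξ).fun_sub ((hasDerivAt_id' ξ).const_mul (nlFun z))
  have key := Convex.norm_image_sub_le_of_norm_hasDerivWithin_le
    (f := fun ξ => potFun ξ - nlFun z * ξ) (C := 2 * ω * (x ^ 2 + y ^ 2 + z ^ 2)) (s := uIcc x y)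
    (fun ξ _ => (hd ξ).hasDerivWithinAt) (fun ξ hξ => ?_) (convex_uIcc _ _) left_mem_uIcc
    right_mem_uIcc
  · rw [Real.norm_eq_abs, Real.norm_eq_abs] at key
    convert key using 2
    ring
  · have hR : ∀ a, a ^ 2 ≤ x ^ 2 + y ^ 2 + z ^ 2 → |a| ≤ √(x ^ 2 + y ^ 2 + z ^ 2) :=
      fun a ha => Real.abs_le_sqrt ha
    have hxx := hR x (by nlinarith [sq_nonneg y, sq_nonneg z])
    have hyy := hR y (by nlinarith [sq_nonneg x, sq_nonneg z])
    have hzz := hR z (by nlinarith [sq_nonneg y, sq_nonneg x])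
    have h1 : |ξ| ≤ √(x ^ 2 + y ^ 2 + z ^ 2) :=
      abs_le.2 (ordConnected_Icc.uIcc_subset (abs_le.1 hxx) (abs_le.1 hyy) hξ)
    have h2 : |ξ - z| ≤ ω := by
      rw [abs_le] at hx hy ⊢
      have : ξ ∈ Icc (z - ω) (z + ω) := ordConnected_Icc.uIcc_subset
        ⟨by linarith [hx.1], by linarith [hx.2]⟩ ⟨by linarith [hy.1], by linarith [hy.2]⟩ hξ
      exact ⟨by linarith [this.1], by linarith [this.2]⟩
    rw [Real.norm_eq_abs]
    refine (abs_nlFun_sub_le_of_abs_le h1 hzz).trans ?_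
    rw [Real.sq_sqrt (by positivity)]
    calc 2 * (x ^ 2 + y ^ 2 + z ^ 2) * |ξ - z| ≤ 2 * (x ^ 2 + y ^ 2 + z ^ 2) * ω := by gcongr
      _ = _ := by ring

/-- The integral of `m² (v² - sin² v) / (2 r²)`. -/
def potential (m : ℕ) (v : ℝ → ℝ) : ℝ := 1 / 2 * ‖jetLp m v‖ ^ 2 - 1 / 2 * ‖jetSinLp m v‖ ^ 2

lemma MemX2.norm_sin_sq {m : ℕ} {v : ℝ → ℝ} (hv : MemX2 m v) :
    ‖jetSinLp m v‖ ^ 2 = ∫ r, ‖jetSin m v r‖ ^ 2 ∂ν := by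
  rw [norm_sq_Lp]
  refine integral_congr_ae ?_
  filter_upwards [hv.coeFn_jetSinLp] with r hr
  rw [hr]

lemma MemX2.potential_eq {m : ℕ} {v : ℝ → ℝ} (hv : MemX2 m v) :
    Integrable (fun r => (m : ℝ) ^ 2 / r ^ 2 * potFun (v r)) ν ∧
      ∫ r, (m : ℝ) ^ 2 / r ^ 2 * potFun (v r) ∂ν = potential m v := by
  have i1 : Integrable (fun r => 1 / 2 * ‖jet m v r‖ ^ 2) ν := hv.integrable_sq.const_mul _
  have i2 : Integrable (fun r => 1 / 2 * ‖jetSin m v r‖ ^ 2) ν :=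
    hv.memLp_sin.norm.integrable_sq.const_mul _
  have e : (fun r => (m : ℝ) ^ 2 / r ^ 2 * potFun (v r)) =
      fun r => 1 / 2 * ‖jet m v r‖ ^ 2 - 1 / 2 * ‖jetSin m v r‖ ^ 2 := by
    ext r
    rw [norm_jet_sq, norm_jetSin_sq, potFun]
    ring
  rw [e, potential, integral_sub i1 i2, integral_const_mul, integral_const_mul, hv.norm_sq,
    hv.norm_sin_sq]
  exact ⟨i1.sub i2, rfl⟩

/-- The integral of `(v / r)⁴`. -/
def quartic (v : ℝ → ℝ) : ℝ := ∫ r, (v r / r) ^ 4 ∂ν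

/-- The pointwise linearisation error is 2ω (m²/r²)(x² + y² + z²)|y - x|. Young's inequality with
weight h splits it: averaging over a window of length h later turns the first part into half of the
squared increment, and the second part is quartic with the small factor ω². -/
lemma nlPair_sub_le {m : ℕ} {x y z : ℝ → ℝ} (hx : MemX2 m x) (hy : MemX2 m y) (hz : MemX2 m z)
    {h ω : ℝ} (hh : 0 < h) (hxz : ∀ r, 0 < r → |x r - z r| ≤ ω)
    (hyz : ∀ r, 0 < r → |y r - z r| ≤ ω)
    (hδ : Integrable (fun r => (y r - x r) ^ 2) ν) (qx : Integrable (fun r => (x r / r) ^ 4) ν)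
    (qy : Integrable (fun r => (y r / r) ^ 4) ν) (qz : Integrable (fun r => (z r / r) ^ 4) ν) :
    nlPair m z (fun r => y r - x r) ≤ potential m y - potential m x +
      1 / (2 * h) * ∫ r, (y r - x r) ^ 2 ∂ν +
      6 * h * m ^ 4 * ω ^ 2 * (quartic x + quartic y + quartic z) := by
  obtain ⟨iy, ey⟩ := hy.potential_eq
  obtain ⟨ix, ex⟩ := hx.potential_eq
  have i1 : Integrable (fun r => (m : ℝ) ^ 2 / r ^ 2 * potFun (y r) -
      (m : ℝ) ^ 2 / r ^ 2 * potFun (x r)) ν := iy.sub ix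
  have i2 : Integrable (fun r => (m : ℝ) ^ 2 / r ^ 2 * potFun (y r) -
      (m : ℝ) ^ 2 / r ^ 2 * potFun (x r) + 1 / (2 * h) * (y r - x r) ^ 2) ν :=
    i1.add (hδ.const_mul _)
  have i3 : Integrable (fun r => (x r / r) ^ 4 + (y r / r) ^ 4) ν := qx.add qy
  have i4 : Integrable (fun r => (x r / r) ^ 4 + (y r / r) ^ 4 + (z r / r) ^ 4) ν := i3.add qz
  rw [← ey, ← ex, ← integral_sub iy ix, ← integral_const_mul, ← integral_add i1 (hδ.const_mul _),
    quartic, quartic, quartic, ← integral_add qx qy, ← integral_add i3 qz, ← integral_const_mul,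
    ← integral_add i2 (i4.const_mul _), nlPair]
  refine integral_mono_ae (integrable_nlPair hz (hy.sub hx)) (i2.add (i4.const_mul _))
    (ae_radialMeasure_of_forall fun r hr => ?_)
  have h1 := abs_potFun_sub_le (hxz r hr) (hyz r hr)
  simp only [nonlinearity_eq]
  set X := x r
  set Y := y r
  set Z := z r
  have h2 : nlFun Z * (Y - X) ≤ potFun Y - potFun X + 2 * ω * (X ^ 2 + Y ^ 2 + Z ^ 2) * |Y - X| := by
    linarith [neg_abs_le (potFun Y - potFun X - nlFun Z * (Y - X))]
  have h3 := mul_le_mul_of_nonneg_left h2 (by positivity : 0 ≤ (m : ℝ) ^ 2 / r ^ 2)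
  set S := X ^ 2 + Y ^ 2 + Z ^ 2 with hS
  set a := 2 * ω * ((m : ℝ) ^ 2 / r ^ 2 * S) with ha
  have h4 : (m : ℝ) ^ 2 / r ^ 2 * (2 * ω * S * |Y - X|) ≤
      1 / (2 * h) * (Y - X) ^ 2 + h / 2 * a ^ 2 := by
    have h5 : 0 ≤ (|Y - X| - h * a) ^ 2 / (2 * h) := by positivity
    have h6 : (|Y - X| - h * a) ^ 2 / (2 * h) =
        1 / (2 * h) * (Y - X) ^ 2 + h / 2 * a ^ 2 - a * |Y - X| := by
      rw [← sq_abs (Y - X)]; field_simp; ring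
    have h7 : (m : ℝ) ^ 2 / r ^ 2 * (2 * ω * S * |Y - X|) = a * |Y - X| := by rw [ha]; ring
    linarith
  -- The constant 6 is 2 · 3: h a²/2 = 2 h m⁴ ω² S²/r⁴, and S² is at most three times the sum of the
  -- fourth powers.
  have h5 : h / 2 * a ^ 2 ≤
      6 * h * m ^ 4 * ω ^ 2 * ((X / r) ^ 4 + (Y / r) ^ 4 + (Z / r) ^ 4) := by
    have h6 : S ^ 2 ≤ 3 * (X ^ 4 + Y ^ 4 + Z ^ 4) := by
      rw [hS]
      nlinarith [sq_nonneg (X ^ 2 - Y ^ 2), sq_nonneg (X ^ 2 - Z ^ 2), sq_nonneg (Y ^ 2 - Z ^ 2)]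
    calc h / 2 * a ^ 2 = 2 * h * m ^ 4 * ω ^ 2 / r ^ 4 * S ^ 2 := by rw [ha]; ring
      _ ≤ 2 * h * m ^ 4 * ω ^ 2 / r ^ 4 * (3 * (X ^ 4 + Y ^ 4 + Z ^ 4)) := by gcongr
      _ = _ := by ring
  calc (m : ℝ) ^ 2 / r ^ 2 * nlFun Z * (Y - X) = (m : ℝ) ^ 2 / r ^ 2 * (nlFun Z * (Y - X)) := by ring
    _ ≤ _ := by linarith

/-! ### Averages over short times -/

section average

variable {E : Type*} [NormedAddCommGroup E] [NormedSpace ℝ E] [CompleteSpace E] {f : ℝ → E}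

lemma tendsto_average_right (hf : Continuous f) (a : ℝ) :
    Tendsto (fun h => h⁻¹ • ∫ x in a..a + h, f x) (𝓝[>] 0) (𝓝 (f a)) := by
  have h := (hf.integral_hasStrictDerivAt a a).hasDerivAt.tendsto_slope_zero_right
  simpa using h

lemma hasDerivAt_window (hf : Continuous f) (h t : ℝ) :
    HasDerivAt (fun t => ∫ x in t..t + h, f x) (f (t + h) - f t) t := by
  have h1 : HasDerivAt (fun t => ∫ x in (0 : ℝ)..t, f x) (f t) t :=
    (hf.integral_hasStrictDerivAt 0 t).hasDerivAt
  have h2 : HasDerivAt (fun t => ∫ x in (0 : ℝ)..t + h, f x) (f (t + h)) t :=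
    HasDerivAt.comp_add_const t h (hf.integral_hasStrictDerivAt 0 (t + h)).hasDerivAt
  refine (h2.sub h1).congr_of_eventuallyEq (.of_forall fun s => ?_)
  exact (intervalIntegral.integral_interval_sub_left (hf.intervalIntegrable _ _)
    (hf.intervalIntegrable _ _)).symm

/-- Differences over a step h telescope in the integral, leaving the two end windows. -/
lemma integral_shift_sub {g : ℝ → ℝ} (hg : Continuous g) (h b : ℝ) :
    ∫ t in (0 : ℝ)..b, (g (t + h) - g t) = (∫ t in b..b + h, g t) - ∫ t in (0 : ℝ)..h, g t := by
  have hi := hg.intervalIntegrable (μ := volume)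
  rw [intervalIntegral.integral_sub ((by fun_prop : Continuous fun t => g (t + h)).intervalIntegrable
    _ _) (hi _ _), intervalIntegral.integral_comp_add_right, zero_add,
    intervalIntegral.integral_interval_sub_interval_comm' (hi _ _) (hi _ _) (hi _ _)]

end average

/-! ### The energy inequality over short times -/

namespace IsMildCurve

variable {m : ℕ} {A c : ℝ} {w : ℝ → ℝ → ℝ}

lemma integrable_quartic_prod (h : IsMildCurve m A c w)
    (hq : ∫⁻ t in Icc 0 c, ∫⁻ r in Ioi (0 : ℝ), ENNReal.ofReal (|w t r / r| ^ 4 * r) < ⊤) :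
    Integrable (fun p : ℝ × ℝ => (w p.1 p.2 / p.2) ^ 4) ((volume.restrict (Icc 0 c)).prod ν) := by
  have hm : Measurable fun p : ℝ × ℝ => (w p.1 p.2 / p.2) ^ 4 :=
    ((h.meas : Measurable fun p : ℝ × ℝ => w p.1 p.2).div measurable_snd).pow_const 4
  refine ⟨hm.aestronglyMeasurable, ?_⟩
  rw [hasFiniteIntegral_iff_ofReal (.of_forall fun p => by positivity),
    lintegral_prod _ hm.ennreal_ofReal.aemeasurable]
  refine lt_of_eq_of_lt (lintegral_congr fun t => ?_) hq
  rw [lintegral_radialMeasure]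
  refine setLIntegral_congr_fun measurableSet_Ioi fun r (hr : 0 < r) => ?_
  rw [← ENNReal.ofReal_mul hr.le, mul_comm, Even.pow_abs (by decide)]

lemma ae_integrable_quartic (h : IsMildCurve m A c w)
    (hq : ∫⁻ t in Icc 0 c, ∫⁻ r in Ioi (0 : ℝ), ENNReal.ofReal (|w t r / r| ^ 4 * r) < ⊤) :
    ∀ᵐ t, t ∈ Icc 0 c → Integrable (fun r => (w t r / r) ^ 4) ν :=
  (ae_restrict_iff' measurableSet_Icc).1 (h.integrable_quartic_prod hq).prod_right_ae

lemma integrableOn_quartic (h : IsMildCurve m A c w)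
    (hq : ∫⁻ t in Icc 0 c, ∫⁻ r in Ioi (0 : ℝ), ENNReal.ofReal (|w t r / r| ^ 4 * r) < ⊤) :
    IntegrableOn (fun t => quartic (w t)) (Icc 0 c) :=
  (h.integrable_quartic_prod hq).integral_prod_left

lemma continuous_jetSinLp (h : IsMildCurve m A c w) : Continuous fun t => jetSinLp m (w t) := by
  refine continuous_iff_continuousAt.2 fun t₀ => tendsto_iff_norm_sub_tendsto_zero.2 ?_
  exact squeeze_zero (fun _ => norm_nonneg _)
    (fun t => norm_jetSinLp_sub_le (h.mem t) (h.mem t₀))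
    (tendsto_iff_norm_sub_tendsto_zero.1 (h.cont.tendsto t₀))

lemma continuous_potential (h : IsMildCurve m A c w) : Continuous fun t => potential m (w t) :=
  ((h.cont.norm.pow 2).const_mul _).sub ((h.continuous_jetSinLp.norm.pow 2).const_mul _)

/-- The equation over [t, t+h] is tested against the increment. The nonlinear term is linearised at
each intermediate time; integrating 1/(2h) over the window absorbs half of the squared increment.
The linear term pairs the window integral of the jet with its own t-derivative. -/
lemma half_integral_sq_sub_le (hm : 1 ≤ m) (H : IsMildCurve m A c w) {t h ω : ℝ} (ht : 0 ≤ t)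
    (hh : 0 < h) (htc : t + h ≤ c)
    (hω : ∀ s ∈ Icc 0 c, ∀ s' ∈ Icc 0 c, |s - s'| ≤ h → ‖jetLp m (w s) - jetLp m (w s')‖ ≤ ω)
    (qt : Integrable (fun r => (w t r / r) ^ 4) ν)
    (qth : Integrable (fun r => (w (t + h) r / r) ^ 4) ν)
    (hq : ∫⁻ t in Icc 0 c, ∫⁻ r in Ioi (0 : ℝ), ENNReal.ofReal (|w t r / r| ^ 4 * r) < ⊤) :
    1 / 2 * ∫ r, (w (t + h) r - w t r) ^ 2 ∂ν ≤
      -inner ℝ (∫ x in t..t + h, jetLp m (w x)) (jetLp m (w (t + h)) - jetLp m (w t)) +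
        h * (potential m (w (t + h)) - potential m (w t)) +
        6 * h * m ^ 4 * ω ^ 2 * (h * quartic (w t) + h * quartic (w (t + h)) +
          ∫ x in t..t + h, quartic (w x)) := by
  have hle : t ≤ t + h := by linarith
  obtain ⟨hi, hD⟩ := H.integral_sq_sub_le hm ht hle htc
  have hδX : MemX2 m fun r => w (t + h) r - w t r := (H.mem _).sub (H.mem t)
  set D := ∫ r, (w (t + h) r - w t r) ^ 2 ∂ν with hDdef
  have hsub : Icc t (t + h) ⊆ Icc 0 c := Icc_subset_Icc ht htc
  have hqi : IntervalIntegrable (fun x => quartic (w x)) volume t (t + h) :=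
    (intervalIntegrable_iff_integrableOn_Icc_of_le hle).2 ((H.integrableOn_quartic hq).mono_set hsub)
  have e1 : ∫ x in t..t + h, slope m (w x) (fun r => w (t + h) r - w t r) =
      (∫ x in t..t + h, nlPair m (w x) fun r => w (t + h) r - w t r) -
        inner ℝ (∫ x in t..t + h, jetLp m (w x)) (jetLp m (w (t + h)) - jetLp m (w t)) := by
    simp only [slope]
    rw [intervalIntegral.integral_sub ((H.continuous_nlPair hδX).intervalIntegrable _ _)
      ((H.cont.inner continuous_const).intervalIntegrable _ _), jetLp_sub (H.mem _) (H.mem _)]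
    congr 1
    have := (innerSL ℝ (jetLp m (w (t + h)) - jetLp m (w t))).intervalIntegral_comp_comm
      (H.cont.intervalIntegrable (μ := volume) t (t + h))
    simp only [innerSL_apply_apply] at this
    rw [real_inner_comm, ← this]
    exact intervalIntegral.integral_congr fun x _ => real_inner_comm _ _
  set K := 6 * h * m ^ 4 * ω ^ 2 with hK
  have e2 : ∫ x in t..t + h, nlPair m (w x) (fun r => w (t + h) r - w t r) ≤
      ∫ x in t..t + h, ((potential m (w (t + h)) - potential m (w t) + 1 / (2 * h) * D +
        K * (quartic (w t) + quartic (w (t + h)))) + K * quartic (w x)) := by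
    refine intervalIntegral.integral_mono_ae_restrict hle
      ((H.continuous_nlPair hδX).intervalIntegrable _ _)
      (intervalIntegrable_const.add (hqi.const_mul K)) ?_
    refine (ae_restrict_iff' measurableSet_Icc).2 ?_
    filter_upwards [H.ae_integrable_quartic hq] with x hx hxI
    have hω' : ∀ s ∈ Icc t (t + h), ∀ r, 0 < r → |w s r - w x r| ≤ ω := fun s hs r hr =>
      ((H.mem s).abs_sub_le hm (H.mem x) hr).trans (hω s (hsub hs) x (hsub hxI)
        (_root_.abs_le.2 ⟨by linarith [hs.1, hxI.2], by linarith [hs.2, hxI.1]⟩))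
    have := nlPair_sub_le (H.mem t) (H.mem (t + h)) (H.mem x) hh (hω' t ⟨le_rfl, hle⟩)
      (hω' (t + h) ⟨hle, le_rfl⟩) hi qt qth (hx (hsub hxI))
    rw [← hDdef, ← hK] at this
    linarith
  rw [intervalIntegral.integral_add intervalIntegrable_const (hqi.const_mul K),
    intervalIntegral.integral_const, intervalIntegral.integral_const_mul, smul_eq_mul,
    add_sub_cancel_left] at e2
  have e3 : h * (1 / (2 * h) * D) = 1 / 2 * D := by field_simp
  rw [e1] at hD
  nlinarith

/-- Integrating the previous inequality over [0, b], the linear term becomes an exact derivative and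
the potential telescopes, so only windows at 0 and b remain. The bound by κ is needed only on [t₁,
t₂], because the right-hand side is nonnegative at almost every other time. -/
lemma integrated_energy_ineq (hm : 1 ≤ m) (H : IsMildCurve m A c w) {b h ω t₁ t₂ κ : ℝ}
    (hh : 0 < h) (hbc : b + h ≤ c) (ht₁ : 0 ≤ t₁) (ht : t₁ ≤ t₂) (ht₂ : t₂ ≤ b)
    (hω : ∀ s ∈ Icc 0 c, ∀ s' ∈ Icc 0 c, |s - s'| ≤ h → ‖jetLp m (w s) - jetLp m (w s')‖ ≤ ω)
    (hκ : ∀ t ∈ Icc t₁ t₂, κ * h ^ 2 ≤ ∫ r, (w (t + h) r - w t r) ^ 2 ∂ν)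
    (hq : ∫⁻ t in Icc 0 c, ∫⁻ r in Ioi (0 : ℝ), ENNReal.ofReal (|w t r / r| ^ 4 * r) < ⊤) :
    (t₂ - t₁) * (κ / 2 * h ^ 2) ≤
      -(1 / 2 * (‖∫ x in b..b + h, jetLp m (w x)‖ ^ 2 - ‖∫ x in (0 : ℝ)..h, jetLp m (w x)‖ ^ 2)) +
        h * ((∫ x in b..b + h, potential m (w x)) - ∫ x in (0 : ℝ)..h, potential m (w x)) +
        18 * h ^ 2 * m ^ 4 * ω ^ 2 * ∫ x in Icc 0 c, quartic (w x) := by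
  have hb : 0 ≤ b := (ht₁.trans ht).trans ht₂
  -- Extension by 0 makes the quartic integral integrable on the whole line, so that shifts and
  -- primitives need no case distinction.
  set q : ℝ → ℝ := (Icc 0 c).indicator fun t => quartic (w t) with hqdef
  have hqI : Integrable q := (integrable_indicator_iff measurableSet_Icc).2 (H.integrableOn_quartic hq)
  have hq0 : ∀ t, 0 ≤ q t := fun t =>
    indicator_nonneg (fun t _ => integral_nonneg fun r => by positivity) t
  have hqw : ∀ t ∈ Icc 0 c, q t = quartic (w t) := fun t ht => indicator_of_mem ht _
  have hqi : ∀ x y, IntervalIntegrable q volume x y := fun x y => hqI.intervalIntegrable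
  rw [show ∫ x in Icc 0 c, quartic (w x) = ∫ x, q x from
    (integral_indicator measurableSet_Icc).symm]
  set Q : ℝ → ℝ := fun t => ∫ x in (0 : ℝ)..t, q x with hQ
  have hQc : Continuous Q := intervalIntegral.continuous_primitive hqi 0
  have hqle : ∀ x y, x ≤ y → ∫ t in x..y, q t ≤ ∫ t, q t := fun x y hxy => by
    rw [intervalIntegral.integral_of_le hxy]
    exact setIntegral_le_integral hqI (.of_forall hq0)
  set q₀ := ∫ t, q t with hq₀
  set U : ℝ → Lp ℂ 2 ν := fun t => ∫ x in t..t + h, jetLp m (w x) with hU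
  have hUd : ∀ t, HasDerivAt U (jetLp m (w (t + h)) - jetLp m (w t)) t :=
    hasDerivAt_window H.cont h
  have hUc : Continuous U := continuous_iff_continuousAt.2 fun t => (hUd t).continuousAt
  have hU'c : Continuous fun t => jetLp m (w (t + h)) - jetLp m (w t) :=
    (H.cont.comp (continuous_add_const h)).sub H.cont
  set G : ℝ → ℝ := fun t => potential m (w t) with hG
  have hGc : Continuous G := H.continuous_potential
  have hG'c : Continuous fun t => G (t + h) - G t := (hGc.comp (continuous_add_const h)).sub hGc
  have hQ'c : Continuous fun t => Q (t + h) - Q t := (hQc.comp (continuous_add_const h)).sub hQc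
  set K := 6 * h * m ^ 4 * ω ^ 2 with hK
  have hK0 : 0 ≤ K := by positivity
  have i1 : IntervalIntegrable
      (fun t => -inner ℝ (U t) (jetLp m (w (t + h)) - jetLp m (w t))) volume 0 b :=
    (hUc.inner hU'c).neg.intervalIntegrable _ _
  have i2 : IntervalIntegrable (fun t => h * (G (t + h) - G t)) volume 0 b :=
    (hG'c.const_mul h).intervalIntegrable _ _
  have hqs : IntervalIntegrable (fun t => q (t + h)) volume 0 b :=
    (hqI.comp_add_right h).intervalIntegrable
  have i3 : IntervalIntegrable (fun t => h * q t + h * q (t + h)) volume 0 b :=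
    ((hqi 0 b).const_mul h).add (hqs.const_mul h)
  have i4 : IntervalIntegrable (fun t => h * q t + h * q (t + h) + (Q (t + h) - Q t)) volume 0 b :=
    i3.add (hQ'c.intervalIntegrable _ _)
  set R : ℝ → ℝ := fun t => -inner ℝ (U t) (jetLp m (w (t + h)) - jetLp m (w t)) +
    h * (G (t + h) - G t) + K * (h * q t + h * q (t + h) + (Q (t + h) - Q t)) with hR
  have hRi : IntervalIntegrable R volume 0 b := (i1.add i2).add (i4.const_mul K)
  -- The L⁴ bound makes the quartic integral finite only at almost every time; the exceptional set
  -- is null for t and for t + h alike.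
  have hae : ∀ᵐ t, t ∈ Icc 0 b → 1 / 2 * ∫ r, (w (t + h) r - w t r) ^ 2 ∂ν ≤ R t := by
    filter_upwards [H.ae_integrable_quartic hq, (measurePreserving_add_right volume
      h).quasiMeasurePreserving.ae (H.ae_integrable_quartic hq)] with t h1 h2 htb
    have ht0c : t ∈ Icc 0 c := ⟨htb.1, by linarith [htb.2]⟩
    have hthc : t + h ∈ Icc 0 c := ⟨by linarith [htb.1], by linarith [htb.2]⟩
    refine (H.half_integral_sq_sub_le hm htb.1 hh hthc.2 hω (h1 ht0c) (h2 hthc) hq).trans_eq ?_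
    simp only [hR, hG, hU, hQ]
    rw [hqw t ht0c, hqw _ hthc, intervalIntegral.integral_interval_sub_left (hqi _ _) (hqi _ _)]
    congr 3
    refine intervalIntegral.integral_congr fun x hx => (hqw x ?_).symm
    rw [uIcc_of_le (by linarith)] at hx
    exact ⟨htb.1.trans hx.1, hx.2.trans hthc.2⟩
  have hR0 : ∀ᵐ t, t ∈ Icc 0 b → 0 ≤ R t := by
    filter_upwards [hae] with t h1 htb
    refine le_trans ?_ (h1 htb)
    have : 0 ≤ ∫ r, (w (t + h) r - w t r) ^ 2 ∂ν := integral_nonneg fun r => sq_nonneg _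
    positivity
  have hlow : (t₂ - t₁) * (κ / 2 * h ^ 2) ≤ ∫ t in (0 : ℝ)..b, R t := by
    calc (t₂ - t₁) * (κ / 2 * h ^ 2) = ∫ _ in t₁..t₂, κ / 2 * h ^ 2 := by
          rw [intervalIntegral.integral_const, smul_eq_mul]
      _ ≤ ∫ t in t₁..t₂, R t := by
          refine intervalIntegral.integral_mono_ae_restrict ht intervalIntegrable_const
            (hRi.mono_set ?_) ((ae_restrict_iff' measurableSet_Icc).2 ?_)
          · rw [uIcc_of_le ht, uIcc_of_le hb]; exact Icc_subset_Icc ht₁ ht₂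
          · filter_upwards [hae] with t h1 htI
            have := hκ t htI
            have h2 := h1 ⟨ht₁.trans htI.1, htI.2.trans ht₂⟩
            linarith
      _ ≤ ∫ t in (0 : ℝ)..b, R t := by
          refine intervalIntegral.integral_mono_interval ht₁ ht ht₂ ?_ hRi
          refine (ae_restrict_iff' measurableSet_Ioc).2 ?_
          filter_upwards [hR0] with t h1 htI using h1 (Ioc_subset_Icc_self htI)
  refine hlow.trans ?_
  have c1 : ∫ t in (0 : ℝ)..b, -inner ℝ (U t) (jetLp m (w (t + h)) - jetLp m (w t)) =
      -(1 / 2 * (‖U b‖ ^ 2 - ‖U 0‖ ^ 2)) := by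
    rw [intervalIntegral.integral_neg]
    have h1 := intervalIntegral.integral_eq_sub_of_hasDerivAt (a := 0) (b := b)
      (f := fun t => ‖U t‖ ^ 2) (fun t _ => (hUd t).norm_sq)
      (((hUc.inner hU'c).const_mul 2).intervalIntegrable _ _)
    rw [intervalIntegral.integral_const_mul] at h1
    linarith
  have c2 : ∫ t in (0 : ℝ)..b, h * (G (t + h) - G t) =
      h * ((∫ x in b..b + h, G x) - ∫ x in (0 : ℝ)..h, G x) := by
    rw [intervalIntegral.integral_const_mul, integral_shift_sub hGc]
  -- Each of the three contributions is at most h q₀, whence 18 = 3 · 6 in the conclusion.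
  have c3 : ∫ t in (0 : ℝ)..b, (h * q t + h * q (t + h) + (Q (t + h) - Q t)) ≤ 3 * h * q₀ := by
    rw [intervalIntegral.integral_add i3 (hQ'c.intervalIntegrable _ _),
      intervalIntegral.integral_add ((hqi 0 b).const_mul h) (hqs.const_mul h),
      intervalIntegral.integral_const_mul, intervalIntegral.integral_const_mul,
      intervalIntegral.integral_comp_add_right, integral_shift_sub hQc]
    have d1 := hqle 0 b hb
    have d2 := hqle (0 + h) (b + h) (by linarith)
    have d3 : ∫ x in b..b + h, Q x ≤ h * q₀ := by
      calc ∫ x in b..b + h, Q x ≤ ∫ _ in b..b + h, q₀ :=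
            intervalIntegral.integral_mono_on (by linarith) (hQc.intervalIntegrable _ _)
              intervalIntegrable_const fun x hx => hqle 0 x (hb.trans hx.1)
        _ = h * q₀ := by rw [intervalIntegral.integral_const, smul_eq_mul, add_sub_cancel_left]
    have d4 : 0 ≤ ∫ x in (0 : ℝ)..h, Q x :=
      intervalIntegral.integral_nonneg hh.le fun x hx =>
        intervalIntegral.integral_nonneg hx.1 fun t _ => hq0 t
    nlinarith
  rw [intervalIntegral.integral_add (i1.add i2) (i4.const_mul K), intervalIntegral.integral_add i1 i2,
    c1, c2, intervalIntegral.integral_const_mul]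
  have c4 := mul_le_mul_of_nonneg_left c3 hK0
  have c5 : U 0 = ∫ x in (0 : ℝ)..h, jetLp m (w x) := by simp only [hU, zero_add]
  rw [← c5]
  have c6 : K * (3 * h * q₀) = 18 * h ^ 2 * m ^ 4 * ω ^ 2 * q₀ := by rw [hK]; ring
  linarith

end IsMildCurve

/-! ### Strict decrease of the energy -/

/-- Cauchy-Schwarz, from the nonnegativity of the integral of (N f - I g)². The added 1 keeps N
positive even when g vanishes. -/
lemma sq_integral_mul_le {f g : ℝ → ℝ} (hf : Integrable (fun r => f r ^ 2) ν)
    (hg : Integrable (fun r => g r ^ 2) ν) (hfg : Integrable (fun r => f r * g r) ν) :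
    (∫ r, f r * g r ∂ν) ^ 2 ≤ ((∫ r, g r ^ 2 ∂ν) + 1) * ∫ r, f r ^ 2 ∂ν := by
  set I := ∫ r, f r * g r ∂ν
  set N := (∫ r, g r ^ 2 ∂ν) + 1 with hN
  have hN0 : 0 < N := by
    have : 0 ≤ ∫ r, g r ^ 2 ∂ν := integral_nonneg fun r => sq_nonneg _
    linarith
  have h1 : 0 ≤ ∫ r, (N * f r - I * g r) ^ 2 ∂ν := integral_nonneg fun r => sq_nonneg _
  have h2 : ∫ r, (N * f r - I * g r) ^ 2 ∂ν =
      N ^ 2 * (∫ r, f r ^ 2 ∂ν) - 2 * N * I * I + I ^ 2 * (N - 1) := by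
    have e : (fun r => (N * f r - I * g r) ^ 2) =
        fun r => N ^ 2 * f r ^ 2 - 2 * N * I * (f r * g r) + I ^ 2 * g r ^ 2 := by
      ext r; ring
    have i1 : Integrable (fun r => N ^ 2 * f r ^ 2 - 2 * N * I * (f r * g r)) ν :=
      (hf.const_mul _).sub (hfg.const_mul _)
    rw [e, integral_add i1 (hg.const_mul _), integral_sub (hf.const_mul _) (hfg.const_mul _),
      integral_const_mul, integral_const_mul, integral_const_mul, hN]
    ring
  rw [h2] at h1
  have h3 : 0 ≤ N * (N * (∫ r, f r ^ 2 ∂ν) - I ^ 2) := by nlinarith [sq_nonneg I]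
  linarith [nonneg_of_mul_nonneg_right h3 hN0]

namespace IsMildCurve

variable {m : ℕ} {A c : ℝ} {w : ℝ → ℝ → ℝ}

/-- By continuity the slope along φ stays within half its size of its value at t₀ for a short time,
so the increment paired with φ is at least of order h. Cauchy-Schwarz concludes; compact support
puts φ in L². -/
lemma exists_le_integral_sq_sub (hm : 1 ≤ m) (H : IsMildCurve m A c w) {φ : ℝ → ℝ} {a b t₀ : ℝ}
    (ha : 0 < a) (hab : a < b) (hφ : MemX2 m φ) (hs : ∀ r ∉ Ioo a b, φ r = 0) (ht₀ : 0 ≤ t₀)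
    (hne : slope m (w t₀) φ ≠ 0) :
    ∃ κ > 0, ∃ ρ > 0, ∀ t h, t₀ ≤ t → 0 < h → t + h ≤ t₀ + ρ → t + h ≤ c →
      κ * h ^ 2 ≤ ∫ r, (w (t + h) r - w t r) ^ 2 ∂ν := by
  have hcs := H.continuous_slope hφ
  set σ := slope m (w t₀) φ with hσ
  have hσ0 : 0 < |σ| := abs_pos.2 hne
  have hφ2 : Integrable (fun r => φ r ^ 2) ν := by
    have := (integrable_mul_of_bound (a := a) (b := b) (B := ‖jetLp m φ‖ ^ 2) hφ.1.aesm hφ.1.aesm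
      (fun r hr => hs r fun h => hr (Ioo_subset_Icc_self h)) fun r hr => ?_).1
    · simpa only [sq] using this
    · rw [abs_mul, ← sq]
      have := hφ.abs_le hm hr
      gcongr
  set N := (∫ r, φ r ^ 2 ∂ν) + 1 with hN
  have hN0 : 0 < N := by
    have : 0 ≤ ∫ r, φ r ^ 2 ∂ν := integral_nonneg fun r => sq_nonneg _
    linarith
  obtain ⟨ρ, hρ, hball⟩ := Metric.continuousAt_iff.1 (hcs.continuousAt (x := t₀)) (|σ| / 2)
    (by positivity)
  refine ⟨(|σ| / 2) ^ 2 / N, by positivity, ρ / 2, by positivity, fun t h htt hh hρh hc => ?_⟩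
  have hle : t ≤ t + h := by linarith
  have hw := H.weak hm ha hab hφ hs (ht₀.trans htt) hle hc
  have hI : |σ| / 2 * h ≤ |∫ r, (w (t + h) r - w t r) * φ r ∂ν| := by
    have h1 : |(∫ x in t..t + h, slope m (w x) φ) - ∫ _ in t..t + h, σ| ≤ |σ| / 2 * |t + h - t| := by
      rw [← intervalIntegral.integral_sub (hcs.intervalIntegrable _ _) intervalIntegrable_const,
        ← Real.norm_eq_abs]
      refine intervalIntegral.norm_integral_le_of_norm_le_const fun x hx => ?_
      rw [uIoc_of_le hle] at hx
      have := hball (x := x) (by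
        rw [Real.dist_eq, _root_.abs_lt]; constructor <;> linarith [hx.1, hx.2])
      exact this.le
    rw [intervalIntegral.integral_const, smul_eq_mul, add_sub_cancel_left, abs_of_pos hh] at h1
    rw [hw]
    have h2 : |h * σ| = |σ| * h := by rw [abs_mul, abs_of_pos hh, mul_comm]
    have h3 := abs_sub_abs_le_abs_sub (h * σ) (∫ x in t..t + h, slope m (w x) φ)
    rw [abs_sub_comm, h2] at h3
    linarith
  have hCS := sq_integral_mul_le (H.integral_sq_sub_le hm (ht₀.trans htt) hle hc).1 hφ2
    (H.integrable_sub_mul hm t (t + h) hφ hs)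
  rw [← hN] at hCS
  rw [div_mul_eq_mul_div, div_le_iff₀ hN0]
  calc (|σ| / 2) ^ 2 * h ^ 2 = (|σ| / 2 * h) ^ 2 := by ring
    _ ≤ |∫ r, (w (t + h) r - w t r) * φ r ∂ν| ^ 2 := by gcongr
    _ ≤ _ := by rw [sq_abs, mul_comm _ N]; exact hCS

/-- The energy decreases strictly as soon as `w` is not stationary. -/
lemma norm_jetSinLp_lt (hm : 1 ≤ m) (H : IsMildCurve m A c w) {φ : ℝ → ℝ} {a a' b t₀ : ℝ}
    (ha : 0 < a) (haa : a < a') (hφ : MemX2 m φ) (hs : ∀ r ∉ Ioo a a', φ r = 0) (ht₀ : 0 ≤ t₀)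
    (htb : t₀ < b) (hbc : b < c) (hne : slope m (w t₀) φ ≠ 0)
    (hq : ∫⁻ t in Icc 0 c, ∫⁻ r in Ioi (0 : ℝ), ENNReal.ofReal (|w t r / r| ^ 4 * r) < ⊤) :
    ‖jetSinLp m (w b)‖ ^ 2 < ‖jetSinLp m (w 0)‖ ^ 2 := by
  by_contra! hcon
  obtain ⟨κ, hκ, ρ, hρ, hlow⟩ := H.exists_le_integral_sq_sub hm ha haa hφ hs ht₀ hne
  set d := min (ρ / 2) (b - t₀) with hd
  have hd0 : 0 < d := lt_min (by positivity) (by linarith)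
  set S := 18 * (m : ℝ) ^ 4 * ∫ x in Icc 0 c, quartic (w x) with hS
  have hS0 : 0 ≤ S := by
    have : 0 ≤ ∫ x in Icc 0 c, quartic (w x) :=
      integral_nonneg fun x => integral_nonneg fun r => by positivity
    positivity
  set κ₀ := d * (κ / 2) with hκ₀
  have hκ₀0 : 0 < κ₀ := by positivity
  -- Chosen so that S ω² ≤ κ₀/2: the quartic error takes at most half of the gain. Uniform
  -- continuity in X² on [0, c] then fixes how short the step h must be.
  set ω := √(κ₀ / (2 * (S + 1))) with hω
  have hω0 : 0 < ω := Real.sqrt_pos.2 (by positivity)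
  have hSω : S * ω ^ 2 ≤ κ₀ / 2 := by
    rw [hω, Real.sq_sqrt (by positivity)]
    calc S * (κ₀ / (2 * (S + 1))) = κ₀ / 2 * (S / (S + 1)) := by field_simp
      _ ≤ κ₀ / 2 * 1 := by gcongr; rw [div_le_one (by positivity)]; linarith
      _ = _ := mul_one _
  obtain ⟨η, hη, hunif⟩ := Metric.uniformContinuousOn_iff_le.1
    (isCompact_Icc.uniformContinuousOn_of_continuous (H.cont.continuousOn (s := Icc 0 c))) ω hω0
  -- The boundary terms divided by h². As h → 0 the quadratic and potential parts combine to half of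
  -- ‖jetSin(0)‖² - ‖jetSin(b)‖², the loss of energy, which is therefore at least κ₀/2.
  set Ψ : ℝ → ℝ := fun h => -(1 / 2 * (‖h⁻¹ • ∫ x in b..b + h, jetLp m (w x)‖ ^ 2 -
      ‖h⁻¹ • ∫ x in (0 : ℝ)..0 + h, jetLp m (w x)‖ ^ 2)) +
      (h⁻¹ • (∫ x in b..b + h, potential m (w x)) -
        h⁻¹ • ∫ x in (0 : ℝ)..0 + h, potential m (w x)) with hΨ
  have hlim : Tendsto Ψ (𝓝[>] 0) (𝓝 (-(1 / 2 * (‖jetLp m (w b)‖ ^ 2 - ‖jetLp m (w 0)‖ ^ 2)) +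
      (potential m (w b) - potential m (w 0)))) :=
    (((((tendsto_average_right H.cont b).norm.pow 2).sub
      ((tendsto_average_right H.cont 0).norm.pow 2)).const_mul _).neg).add
      ((tendsto_average_right H.continuous_potential b).sub
        (tendsto_average_right H.continuous_potential 0))
  have hev : ∀ᶠ h in 𝓝[>] (0 : ℝ), κ₀ / 2 ≤ Ψ h := by
    have hpos : 0 < min η (min (c - b) (ρ / 2)) := lt_min hη (lt_min (by linarith) (by positivity))
    filter_upwards [Ioo_mem_nhdsGT hpos] with h hh
    have hh0 : 0 < h := hh.1
    have hh1 : h ≤ η := hh.2.le.trans (min_le_left _ _)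
    have hh2 : h ≤ c - b := (hh.2.le.trans (min_le_right _ _)).trans (min_le_left _ _)
    have hh3 : h ≤ ρ / 2 := (hh.2.le.trans (min_le_right _ _)).trans (min_le_right _ _)
    have hd1 : d ≤ ρ / 2 := min_le_left _ _
    have hd2 : d ≤ b - t₀ := min_le_right _ _
    have hineq := H.integrated_energy_ineq hm (b := b) (t₁ := t₀) (t₂ := t₀ + d) (κ := κ) (ω := ω)
      hh0 (by linarith) ht₀ (by linarith) (by linarith)
      (fun s hs' s' hs'' hss => by
        rw [← dist_eq_norm]; exact hunif s hs' s' hs'' (by rw [Real.dist_eq]; exact hss.trans hh1))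
      (fun t ht => hlow t h ht.1 hh0 (by linarith [ht.2]) (by linarith [ht.2])) hq
    rw [add_sub_cancel_left] at hineq
    have e1 : h ^ 2 * Ψ h = -(1 / 2 * (‖∫ x in b..b + h, jetLp m (w x)‖ ^ 2 -
        ‖∫ x in (0 : ℝ)..h, jetLp m (w x)‖ ^ 2)) +
        h * ((∫ x in b..b + h, potential m (w x)) - ∫ x in (0 : ℝ)..h, potential m (w x)) := by
      simp only [hΨ, norm_smul, norm_inv, Real.norm_eq_abs, abs_of_pos hh0, smul_eq_mul, zero_add]
      field_simp
    have e2 : h ^ 2 * κ₀ ≤ h ^ 2 * (Ψ h + κ₀ / 2) := by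
      have e3 : 18 * h ^ 2 * m ^ 4 * ω ^ 2 * (∫ x in Icc 0 c, quartic (w x)) = h ^ 2 * (S * ω ^ 2) := by
        rw [hS]; ring
      have e4 := mul_le_mul_of_nonneg_left hSω (sq_nonneg h)
      have e5 : d * (κ / 2 * h ^ 2) = h ^ 2 * κ₀ := by rw [hκ₀]; ring
      rw [mul_add, e1]
      linarith
    have := le_of_mul_le_mul_left e2 (by positivity)
    linarith
  have hfin := ge_of_tendsto hlim hev
  simp only [potential] at hfin
  linarith

end IsMildCurve

/-! ### Stationary elements of the energy space -/

/-- The bounds 1/2 and 5/2 make the interval contain the support of the fixed cutoff around [1, 2]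
used below. -/
lemma exists_Ioo_of_isCompact {K : Set ℝ} (hK : IsCompact K) (hK0 : K ⊆ Ioi 0) :
    ∃ a b : ℝ, 0 < a ∧ a < 1 / 2 ∧ 5 / 2 < b ∧ K ⊆ Ioo a b := by
  obtain ⟨B, hB⟩ := hK.bddAbove
  rcases K.eq_empty_or_nonempty with rfl | hne
  · exact ⟨1 / 4, 3, by norm_num, by norm_num, by norm_num, empty_subset _⟩
  · obtain ⟨x, hx, hmin⟩ := hK.exists_isMinOn hne continuousOn_id
    have hx0 : 0 < x := hK0 hx
    refine ⟨min (x / 2) (1 / 4), max B 3 + 1, lt_min (by linarith) (by norm_num),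
      (min_le_right _ _).trans_lt (by norm_num), ?_, fun y hy => ⟨?_, ?_⟩⟩
    · linarith [le_max_right B 3]
    · have : x ≤ y := hmin hy
      exact (min_le_left _ _).trans_lt (by linarith)
    · linarith [hB hy, le_max_left B 3]

/-- The function `m² sin v cos v / r`. -/
def angular (m : ℕ) (v : ℝ → ℝ) (r : ℝ) : ℝ := (m : ℝ) ^ 2 * (Real.sin (v r) * Real.cos (v r)) / r

/-- The primitive of `angular m v` that vanishes at `1`. -/
def angularPrim (m : ℕ) (v : ℝ → ℝ) (r : ℝ) : ℝ := ∫ x in (1 : ℝ)..r, angular m v x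

/-- `v` is a critical point of the energy. -/
def IsStationary (m : ℕ) (v : ℝ → ℝ) : Prop :=
  ∀ (φ : ℝ → ℝ) (a b : ℝ), 0 < a → a < b → MemX2 m φ → (∀ r ∉ Ioo a b, φ r = 0) → slope m v φ = 0

section stationary

variable {m : ℕ} {v : ℝ → ℝ}

lemma continuousOn_angular (hv : LocAC v) : ContinuousOn (angular m v) (Ioi 0) := by
  have hc := hv.continuousOn
  exact (continuousOn_const.mul ((Real.continuous_sin.comp_continuousOn hc).mul
    (Real.continuous_cos.comp_continuousOn hc))).div continuousOn_id fun r hr => ne_of_gt hr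

lemma uIcc_subset_Ioi {a b : ℝ} (ha : 0 < a) (hb : 0 < b) : uIcc a b ⊆ Ioi 0 :=
  ordConnected_Ioi.uIcc_subset ha hb

lemma hasDerivAt_angularPrim (hv : LocAC v) {r : ℝ} (hr : 0 < r) :
    HasDerivAt (angularPrim m v) (angular m v r) r := by
  have hc := continuousOn_angular (m := m) hv
  refine intervalIntegral.integral_hasDerivAt_right
    (hc.mono (uIcc_subset_Ioi one_pos hr)).intervalIntegrable
    (hc.stronglyMeasurableAtFilter isOpen_Ioi r hr) (hc.continuousAt (Ioi_mem_nhds hr))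

lemma continuousOn_angularPrim (hv : LocAC v) : ContinuousOn (angularPrim m v) (Ioi 0) :=
  fun _ hr => (hasDerivAt_angularPrim hv hr).continuousAt.continuousWithinAt

/-- The du Bois-Reymond method: stationarity is tested against the primitive of a mean-zero h, and
the angular term is integrated by parts, so that only h itself appears. -/
lemma IsStationary.integral_mul_eq_zero (hst : IsStationary m v) (hv : MemX2 m v) {h : ℝ → ℝ}
    {a b : ℝ} (ha : 0 < a) (hab : a < b) (hh : ContDiff ℝ 1 h) (hs : ∀ r ∉ Ioo a b, h r = 0)
    (hint : ∫ x in a..b, h x = 0) :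
    ∫ r in a..b, (r * deriv v r - angularPrim m v r) * h r = 0 := by
  set φ : ℝ → ℝ := fun r => ∫ x in a..r, h x with hφdef
  have hφ : ContDiff ℝ 2 φ := contDiff_primitive hh a
  have hφs : ∀ r ∉ Ioo a b, φ r = 0 := primitive_eq_zero hh.continuous hs hint
  have hdφ : ∀ r, HasDerivAt φ (h r) r := fun r =>
    (hh.continuous.integral_hasStrictDerivAt a r).hasDerivAt
  have hφX := memX2_of_contDiff m ha (hφ.of_le (one_le_two (α := WithTop ℕ∞))) hφs
  have hsl := hst φ a b ha hab hφX hφs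
  have hac := hv.1 a b ha hab
  have hI : uIcc a b ⊆ Ioi 0 := uIcc_subset_Ioi ha (ha.trans hab)
  have hcv : ContinuousOn v (uIcc a b) := hv.1.continuousOn.mono hI
  have hcφ : ContinuousOn φ (uIcc a b) := hφ.continuous.continuousOn
  have hsub : Ioc a b ⊆ Ioi 0 := fun r hr => ha.trans hr.1
  have hcinv : ContinuousOn (fun r : ℝ => (m : ℝ) ^ 2 / r ^ 2) (uIcc a b) :=
    continuousOn_const.div (continuous_pow 2).continuousOn fun r hr => pow_ne_zero 2 (ne_of_gt (hI hr))
  have e1 : nlPair m v φ = ∫ r in a..b, nonlinearity m v r * φ r * r := by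
    rw [nlPair, integral_radialMeasure, setIntegral_eq_of_subset_of_forall_sdiff_eq_zero
      measurableSet_Ioi hsub, ← intervalIntegral.integral_of_le hab.le]
    intro r hr
    rw [hφs r fun h => hr.2 (Ioo_subset_Ioc_self h)]; ring
  have e2 : inner ℝ (jetLp m v) (jetLp m φ) =
      ∫ r in a..b, (deriv v r * h r + (m : ℝ) ^ 2 * v r * φ r / r ^ 2) * r := by
    rw [integral_inner_jet hv hφX, integral_radialMeasure,
      setIntegral_eq_of_subset_of_forall_sdiff_eq_zero measurableSet_Ioi hsub,
      ← intervalIntegral.integral_of_le hab.le]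
    · simp_rw [fun r => (hdφ r).deriv]
    · intro r hr
      have : r ∉ Ioo a b := fun h => hr.2 (Ioo_subset_Ioc_self h)
      rw [(hdφ r).deriv, hφs r this, hs r this]; ring
  have i0 : IntervalIntegrable (fun r => deriv v r * (h r * r)) volume a b :=
    hac.intervalIntegrable_deriv.mul_continuousOn (hh.continuous.mul continuous_id).continuousOn
  have i1 : IntervalIntegrable (fun r => nonlinearity m v r * φ r * r) volume a b := by
    refine ContinuousOn.intervalIntegrable ?_
    exact ((hcinv.mul (continuous_nlFun.comp_continuousOn hcv)).mul hcφ).mul continuousOn_id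
  have i2 : IntervalIntegrable (fun r => (deriv v r * h r + (m : ℝ) ^ 2 * v r * φ r / r ^ 2) * r)
      volume a b := by
    have i3 : IntervalIntegrable (fun r => (m : ℝ) ^ 2 / r ^ 2 * v r * φ r * r) volume a b :=
      (((hcinv.mul hcv).mul hcφ).mul continuousOn_id).intervalIntegrable
    refine (i0.add i3).congr fun r _ => ?_
    ring
  have hcJ : ContinuousOn (angularPrim m v) (uIcc a b) := (continuousOn_angularPrim hv.1).mono hI
  have hcg : ContinuousOn (angular m v) (uIcc a b) := (continuousOn_angular hv.1).mono hI
  have e3 := intervalIntegral.integral_mul_deriv_eq_deriv_mul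
    (fun r hr => hasDerivAt_angularPrim (m := m) hv.1 (hI hr)) (fun r _ => hdφ r)
    hcg.intervalIntegrable (hh.continuous.intervalIntegrable a b)
  rw [hφs a (by simp), hφs b (by simp), mul_zero, mul_zero, sub_zero, zero_sub] at e3
  rw [slope, e1, e2, ← intervalIntegral.integral_sub i1 i2] at hsl
  -- The terms m² v φ / r cancel, since v - nlFun v = sin v cos v. The last bracket is the
  -- derivative of `angularPrim` times φ, whose integral vanishes.
  have e4 : ∀ r ∈ uIcc a b, (r * deriv v r - angularPrim m v r) * h r =
      -(nonlinearity m v r * φ r * r - (deriv v r * h r + (m : ℝ) ^ 2 * v r * φ r / r ^ 2) * r) -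
        (angular m v r * φ r + angularPrim m v r * h r) := by
    intro r hr
    have hr0 : r ≠ 0 := ne_of_gt (hI hr)
    rw [nonlinearity_eq, nlFun, angular, Real.sin_two_mul]
    field_simp
    ring
  have i4 : IntervalIntegrable (fun r => angular m v r * φ r) volume a b :=
    (hcg.mul hcφ).intervalIntegrable
  have i5 : IntervalIntegrable (fun r => angularPrim m v r * h r) volume a b :=
    (hcJ.mul hh.continuous.continuousOn).intervalIntegrable
  have i6 : IntervalIntegrable (fun r => -(nonlinearity m v r * φ r * r -
      (deriv v r * h r + (m : ℝ) ^ 2 * v r * φ r / r ^ 2) * r)) volume a b := (i1.sub i2).neg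
  rw [intervalIntegral.integral_congr e4, intervalIntegral.integral_sub i6 (i4.add i5),
    intervalIntegral.integral_neg, hsl, intervalIntegral.integral_add i4 i5, e3]
  ring

/-- A function orthogonal to all mean-zero test functions is a constant almost everywhere. The
constant is its mean against the cutoff χ, and an arbitrary ψ is made mean-zero by subtracting a
multiple of χ. -/
lemma IsStationary.exists_ae_eq (hst : IsStationary m v) (hv : MemX2 m v) :
    ∃ c, ∀ᵐ r, 0 < r → r * deriv v r = angularPrim m v r + c := by
  obtain ⟨χ, hχ, hχ0, _, hχe, hχs⟩ := exists_cutoff one_pos one_lt_two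
  rw [show (2 : ℝ) + 1 / 2 = 5 / 2 by norm_num] at hχs
  set f : ℝ → ℝ := fun r => r * deriv v r - angularPrim m v r with hf
  have hfi : ∀ {a b : ℝ}, 0 < a → 0 < b → IntervalIntegrable f volume a b := fun {a b} ha hb =>
    ((hv.1.ac ha hb).intervalIntegrable_deriv.continuousOn_mul continuousOn_id).sub
      ((continuousOn_angularPrim hv.1).mono (uIcc_subset_Ioi ha hb)).intervalIntegrable
  set X := ∫ x in (1 / 2 : ℝ)..5 / 2, χ x with hX
  have hX0 : 0 < X := by
    refine intervalIntegral.integral_pos (by norm_num) hχ.continuous.continuousOn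
      (fun r _ => hχ0 r) ⟨1, ⟨by norm_num, by norm_num⟩, ?_⟩
    rw [hχe 1 ⟨le_rfl, one_le_two⟩]; norm_num
  have hext : ∀ {a b : ℝ} {k : ℝ → ℝ}, a ≤ 1 / 2 → 5 / 2 ≤ b →
      ∫ x in a..b, k x * χ x = ∫ x in (1 / 2 : ℝ)..5 / 2, k x * χ x := by
    intro a b k ha hb
    rw [intervalIntegral.integral_of_le (by linarith), intervalIntegral.integral_of_le (by norm_num)]
    refine setIntegral_eq_of_subset_of_forall_sdiff_eq_zero measurableSet_Ioc
      (Ioc_subset_Ioc ha hb) fun r hr => ?_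
    rw [hχs r fun h => hr.2 (Ioo_subset_Ioc_self h), mul_zero]
  set c := (∫ x in (1 / 2 : ℝ)..5 / 2, f x * χ x) / X with hc
  refine ⟨c, ?_⟩
  have hloc : LocallyIntegrableOn (fun r => f r - c) (Ioi 0) := by
    refine (locallyIntegrableOn_iff isOpen_Ioi.isLocallyClosed).2 fun K hK hKc => ?_
    obtain ⟨a, b, ha, ha2, hb2, hab⟩ := exists_Ioo_of_isCompact hKc hK
    have := (hfi ha (by linarith : 0 < b)).sub (intervalIntegrable_const (c := c))
    exact ((intervalIntegrable_iff_integrableOn_Icc_of_le (by linarith)).1 this).mono_set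
      (hab.trans Ioo_subset_Icc_self)
  have hzero := isOpen_Ioi.ae_eq_zero_of_integral_contDiff_smul_eq_zero hloc ?_
  · filter_upwards [hzero] with r hr hr0
    have := hr hr0
    simp only [hf] at this
    linarith
  · intro ψ hψ hψc hψs
    obtain ⟨a, b, ha, ha2, hb2, hab⟩ := exists_Ioo_of_isCompact hψc hψs
    have hb0 : 0 < b := by linarith
    have hle : a ≤ b := by linarith
    have hψ0 : ∀ r ∉ Ioo a b, ψ r = 0 := fun r hr => image_eq_zero_of_notMem_tsupport fun h => hr (hab h)
    have hψi : IntervalIntegrable ψ volume a b := hψ.continuous.intervalIntegrable _ _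
    have hχi : IntervalIntegrable χ volume a b := hχ.continuous.intervalIntegrable _ _
    set d := (∫ x in a..b, ψ x) / X with hd
    have hχX : ∫ x in a..b, χ x = X := by
      simpa only [one_mul] using hext (k := fun _ => 1) ha2.le hb2.le
    have key := hst.integral_mul_eq_zero hv ha (by linarith : a < b) (h := fun r => ψ r - d * χ r)
      ((hψ.of_le (by exact_mod_cast le_top)).sub (contDiff_const.mul hχ)) (fun r hr => by
        rw [hψ0 r hr, hχs r fun h => hr ⟨ha2.trans h.1, h.2.trans hb2⟩]; ring) (by
        rw [intervalIntegral.integral_sub hψi (hχi.const_mul d), intervalIntegral.integral_const_mul,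
          hχX, hd]
        field_simp
        ring)
    have hfψ : IntervalIntegrable (fun r => f r * ψ r) volume a b :=
      (hfi ha hb0).mul_continuousOn hψ.continuous.continuousOn
    have hfχ : IntervalIntegrable (fun r => f r * χ r) volume a b :=
      (hfi ha hb0).mul_continuousOn hχ.continuous.continuousOn
    have key2 : (∫ x in a..b, f x * ψ x) - d * ∫ x in a..b, f x * χ x = 0 := by
      rw [← key, ← intervalIntegral.integral_const_mul,
        ← intervalIntegral.integral_sub hfψ (hfχ.const_mul d)]
      exact intervalIntegral.integral_congr fun x _ => by simp only [hf]; ring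
    rw [hext ha2.le hb2.le] at key2
    have e1 : ∫ x, ψ x • (f x - c) = ∫ x in a..b, (f x * ψ x - c * ψ x) := by
      rw [intervalIntegral.integral_of_le hle, ← setIntegral_univ,
        setIntegral_eq_of_subset_of_forall_sdiff_eq_zero (s := Ioc a b) MeasurableSet.univ
          (subset_univ _)]
      · exact setIntegral_congr_fun measurableSet_Ioc fun x _ => by simp only [smul_eq_mul]; ring
      · intro r hr
        rw [hψ0 r fun h => hr.2 (Ioo_subset_Ioc_self h), zero_smul]
    rw [e1, intervalIntegral.integral_sub hfψ (hψi.const_mul c), intervalIntegral.integral_const_mul,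
      hc, ← key2, hd]
    ring

/-- Bootstrap: r v' agrees almost everywhere with a continuous function, and v is the integral of
its derivative, so v is differentiable everywhere. With p = r v' this is the first-order form of the
harmonic map equation. -/
lemma IsStationary.exists_momentum (hst : IsStationary m v) (hv : MemX2 m v) :
    ∃ p : ℝ → ℝ, (∀ r, 0 < r → HasDerivAt v (p r / r) r) ∧
      ∀ r, 0 < r → HasDerivAt p (angular m v r) r := by
  obtain ⟨c, hc⟩ := hst.exists_ae_eq hv
  have hp : ∀ r, 0 < r → HasDerivAt (fun r => angularPrim m v r + c) (angular m v r) r :=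
    fun r hr => (hasDerivAt_angularPrim hv.1 hr).add_const c
  refine ⟨fun r => angularPrim m v r + c, fun r hr => ?_, hp⟩
  have hcont : ContinuousOn (fun r => (angularPrim m v r + c) / r) (Ioi 0) := fun s hs =>
    ((hp s hs).continuousAt.div continuousAt_id (ne_of_gt hs)).continuousWithinAt
  have hint : HasDerivAt (fun s => v 1 + ∫ x in (1 : ℝ)..s, (angularPrim m v x + c) / x)
      ((angularPrim m v r + c) / r) r :=
    (intervalIntegral.integral_hasDerivAt_right
      (hcont.mono (uIcc_subset_Ioi one_pos hr)).intervalIntegrable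
      (hcont.stronglyMeasurableAtFilter isOpen_Ioi r hr)
      (hcont.continuousAt (Ioi_mem_nhds hr))).const_add (v 1)
  refine hint.congr_of_eventuallyEq ?_
  filter_upwards [Ioi_mem_nhds hr] with s (hs : 0 < s)
  have h1 := (hv.1.ac one_pos hs).integral_deriv_eq_sub
  have h2 : ∫ x in (1 : ℝ)..s, deriv v x = ∫ x in (1 : ℝ)..s, (angularPrim m v x + c) / x := by
    refine intervalIntegral.integral_congr_ae ?_
    filter_upwards [hc] with x hx hxI
    have hx0 : 0 < x := uIcc_subset_Ioi one_pos hs (uIoc_subset_uIcc hxI)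
    rw [eq_div_iff hx0.ne', mul_comm]
    exact hx hx0
  rw [← h2, h1]
  ring

/-- In the variable log r the system is an autonomous pendulum with this conserved quantity. A
nonzero constant would make 1/r integrable at infinity, against finite energy. -/
lemma sq_momentum_eq (hv : MemX2 m v) {p : ℝ → ℝ} (h1 : ∀ r, 0 < r → HasDerivAt v (p r / r) r)
    (h2 : ∀ r, 0 < r → HasDerivAt p (angular m v r) r) {r : ℝ} (hr : 0 < r) :
    p r ^ 2 = (m : ℝ) ^ 2 * Real.sin (v r) ^ 2 := by
  set e : ℝ → ℝ := fun r => p r ^ 2 - (m : ℝ) ^ 2 * Real.sin (v r) ^ 2 with he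
  have hd : ∀ s, 0 < s → HasDerivAt e 0 s := by
    intro s hs
    have h := ((h2 s hs).fun_pow 2).fun_sub ((((h1 s hs).sin).fun_pow 2).const_mul ((m : ℝ) ^ 2))
    refine h.congr_deriv ?_
    rw [angular]
    field_simp
    ring
  have hconst : ∀ s, 0 < s → e s = e 1 := by
    intro s hs
    have h := intervalIntegral.integral_eq_sub_of_hasDerivAt (a := 1) (b := s) (f := e)
      (f' := fun _ => 0) (fun x hx => hd x (uIcc_subset_Ioi one_pos hs hx)) intervalIntegrable_const
    rw [intervalIntegral.integral_zero] at h
    linarith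
  have hzero : e 1 = 0 := by
    by_contra hne
    have hi : IntegrableOn (fun s => e 1 * s⁻¹) (Ioi 1) := by
      refine (hv.integrableOn.mono_set (Ioi_subset_Ioi zero_le_one)).mono'
        (by fun_prop : Measurable fun s : ℝ => e 1 * s⁻¹).aestronglyMeasurable ?_
      refine (ae_restrict_iff' measurableSet_Ioi).2 (.of_forall fun s (hs : 1 < s) => ?_)
      have hs0 : 0 < s := by linarith
      rw [← hconst s hs0, norm_mul, norm_inv, Real.norm_eq_abs, Real.norm_eq_abs, abs_of_pos hs0,
        norm_jet_sq, (h1 s hs0).deriv]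
      have h3 : Real.sin (v s) ^ 2 ≤ v s ^ 2 := Real.sin_sq_le_sq
      have h4 : |e s| ≤ p s ^ 2 + (m : ℝ) ^ 2 * v s ^ 2 := by
        simp only [he]
        refine (abs_sub _ _).trans ?_
        rw [abs_of_nonneg (by positivity), abs_of_nonneg (by positivity)]
        gcongr
      calc |e s| * s⁻¹ ≤ (p s ^ 2 + (m : ℝ) ^ 2 * v s ^ 2) * s⁻¹ := by gcongr
        _ = _ := by field_simp
    refine not_integrableOn_Ioi_inv (a := 1) ?_
    have h5 := hi.const_mul (e 1)⁻¹
    refine h5.congr (.of_forall fun s => ?_)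
    simp only
    field_simp
  have := hconst r hr
  rw [hzero] at this
  simp only [he] at this
  linarith

/-- The only critical point of the energy in `X²` is `0`. -/
theorem IsStationary.eq_zero (hm : 1 ≤ m) (hst : IsStationary m v) (hv : MemX2 m v) {r₀ : ℝ}
    (hr₀ : 0 < r₀) : v r₀ = 0 := by
  by_contra hne
  obtain ⟨p, h1, h2⟩ := hst.exists_momentum hv
  have hpos : 0 < |v r₀| := abs_pos.2 hne
  have hz := (hv.tendsto_zero hm).abs
  have hi := (hv.tendsto_infty hm).abs
  rw [abs_zero] at hz hi
  -- Near 0 and near infinity |v| is below |v r₀|, so its maximum over the compact interval [a, b]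
  -- is a global one.
  obtain ⟨a, ha, haz⟩ := (mem_nhdsGT_iff_exists_Ioo_subset).1 (hz.eventually (gt_mem_nhds hpos))
  obtain ⟨b, hb⟩ := (hi.eventually (gt_mem_nhds hpos)).exists_forall_of_atTop
  have ha0 : (0 : ℝ) < a := ha
  have har : a ≤ r₀ := by
    by_contra! h
    exact lt_irrefl |v r₀| (haz ⟨hr₀, h⟩)
  have hrb : r₀ ≤ b := by
    by_contra! h
    exact lt_irrefl |v r₀| (hb r₀ h.le)
  have hca : ContinuousOn (fun r => |v r|) (Icc a b) := fun x hx =>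
    ((h1 x (ha0.trans_le hx.1)).continuousAt.abs).continuousWithinAt
  obtain ⟨x, hx, hmax⟩ := isCompact_Icc.exists_isMaxOn ⟨r₀, har, hrb⟩ hca
  have hx0 : 0 < x := ha0.trans_le hx.1
  have hvx : |v r₀| ≤ |v x| := hmax ⟨har, hrb⟩
  have hglob : ∀ s, 0 < s → |v s| ≤ |v x| := by
    intro s hs
    rcases lt_or_ge s a with h | h
    · exact (le_of_lt (haz ⟨hs, h⟩)).trans hvx
    rcases le_or_gt s b with h' | h'
    · exact hmax ⟨h, h'⟩
    · exact (le_of_lt (hb s h'.le)).trans hvx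
  -- The square is differentiable, unlike |v|; criticality gives v(x) p(x) = 0, and v(x) is not 0.
  have hsq : IsLocalMax (fun s => v s ^ 2) x := by
    filter_upwards [Ioi_mem_nhds hx0] with s hs using sq_le_sq.2 (hglob s hs)
  have hd := hsq.hasDerivAt_eq_zero ((h1 x hx0).fun_pow 2)
  have hvx0 : v x ≠ 0 := abs_pos.1 (hpos.trans_le hvx)
  have hpx : p x = 0 := by
    have h3 : v x * (p x / x) = 0 := by
      simp only [Nat.cast_ofNat, Nat.add_one_sub_one, pow_one] at hd
      linarith
    rcases mul_eq_zero.1 h3 with h | h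
    · exact absurd h hvx0
    · exact (div_eq_zero_iff.1 h).resolve_right hx0.ne'
  have hm0 : (m : ℝ) ≠ 0 := by positivity
  have hsin : Real.sin (v x) = 0 := by
    have := sq_momentum_eq hv h1 h2 hx0
    rw [hpx] at this
    have h4 : (m : ℝ) ^ 2 * Real.sin (v x) ^ 2 = 0 := by linarith
    exact pow_eq_zero_iff two_ne_zero |>.1 ((mul_eq_zero.1 h4).resolve_left (by positivity))
  have hp : ∀ s, 0 < s → |p s| = m * |Real.sin (v s)| := by
    intro s hs
    have := sq_momentum_eq hv h1 h2 hs
    rw [← mul_pow, sq_eq_sq_iff_abs_eq_abs, abs_mul, Nat.abs_cast] at this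
    exact this
  -- Gronwall: since |p| = m |sin v|, the derivative of sin v is bounded by (m/x) |sin v| to the
  -- right of x.
  have hsin0 : ∀ s, x ≤ s → Real.sin (v s) = 0 := by
    intro s hs
    refine eq_zero_of_abs_deriv_le_mul_abs_self_of_eq_zero_right (a := x) (b := s) (K := m / x)
      (f := fun s => Real.sin (v s)) (f' := fun s => Real.cos (v s) * (p s / s))
      (fun y hy => ((h1 y (hx0.trans_le hy.1)).sin.continuousAt).continuousWithinAt)
      (fun y hy => (h1 y (hx0.trans_le hy.1)).sin.hasDerivWithinAt) hsin (fun y hy => ?_) s ⟨hs, le_rfl⟩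
    have hy0 : 0 < y := hx0.trans_le hy.1
    rw [Real.norm_eq_abs, Real.norm_eq_abs, abs_mul, abs_div, hp y hy0, abs_of_pos hy0]
    calc |Real.cos (v y)| * (m * |Real.sin (v y)| / y) ≤ 1 * (m * |Real.sin (v y)| / x) := by
          have := hy.1
          have := Real.abs_cos_le_one (v y)
          gcongr
      _ = _ := by ring
  have hvconst : ∀ s, x ≤ s → v s = v x := by
    intro s hs
    have h := intervalIntegral.integral_eq_sub_of_hasDerivAt (a := x) (b := s) (f := v)
      (f' := fun _ => 0) (fun y hy => ?_) intervalIntegrable_const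
    · rw [intervalIntegral.integral_zero] at h
      linarith
    · rw [uIcc_of_le hs] at hy
      have hy0 : 0 < y := hx0.trans_le hy.1
      have hpy : p y = 0 := by
        rw [← abs_eq_zero, hp y hy0, hsin0 y hy.1, abs_zero, mul_zero]
      simpa [hpy] using h1 y hy0
  have hlim : Tendsto v atTop (𝓝 (v x)) := by
    refine tendsto_const_nhds.congr' ?_
    filter_upwards [eventually_ge_atTop x] with s hs using (hvconst s hs).symm
  exact hvx0 (tendsto_nhds_unique hlim (hv.tendsto_infty hm))

end stationary

/-! ### Restarting and gluing solutions -/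

/-- The propagator applied to the Duhamel formula at time a yields the formula at time τ + a with
the sources stopped at a. Restarting and gluing both rest on this. -/
lemma IsMildCurve.heatInt_eq {m : ℕ} {A c : ℝ} {w : ℝ → ℝ → ℝ} (hm : 1 ≤ m)
    (H : IsMildCurve m A c w) {a τ : ℝ} (ha : a ∈ Ioc 0 c) (hτ : 0 < τ) {r : ℝ} (hr : 0 < r) :
    heatInt m τ (w a) r = heatInt m (τ + a) (w 0) r +
      ∫ s in Ioo 0 a, heatInt m (τ + (a - s)) (nonlinearity m (w s)) r := by
  have hw0 : Measurable (w 0) := H.meas.comp (measurable_const.prodMk measurable_id)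
  have hwa : AEStronglyMeasurable (w a) ν := (H.mem a).1.aesm
  have hB : ∀ a s, 0 < s → |w a s| ≤ A := fun a s hs => H.abs_le hm a hs
  have hm1 : Measurable fun s => heatInt m a (w 0) s :=
    measurable_heatInt (α := ℝ) (t := fun _ => a) (r := fun s => s) (f := fun _ => w 0) m
      measurable_const measurable_id (hw0.comp measurable_snd)
  have hb1 : ∀ s, 0 < s → |heatInt m a (w 0) s| ≤ A := fun s hs =>
    CorotationalHeatFlow.abs_heatInt_le m ha.1 hs.le (hB 0)
  have hb2 : ∀ s, 0 < s → |w a s - heatInt m a (w 0) s| ≤ A + A := fun s hs =>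
    (abs_sub _ _).trans (add_le_add (hB a s hs) (hb1 s hs))
  have i1 := integrable_heatKernel_mul m hτ hr.le hm1.aestronglyMeasurable hb1
  have i2 := integrable_heatKernel_mul m (f := fun s => w a s - heatInt m a (w 0) s) hτ hr.le
    (hwa.sub hm1.aestronglyMeasurable) hb2
  rw [← heatInt_duhamelTerm m (H.isSource hm) hτ a hr, ← heatInt_heatInt m hτ ha.1 hr.le hw0 (hB 0)]
  -- The Duhamel term is rewritten as a difference of bounded functions, so that linearity of the
  -- integral applies without a separate integrability proof.
  have e : heatInt m τ (duhamelTerm m (fun s => nonlinearity m (w s)) a) r =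
      ∫ s, heatKernel m τ r s * (w a s - heatInt m a (w 0) s) ∂ν := by
    refine integral_radialMeasure_congr fun s hs => ?_
    rw [H.duhamel a ha s hs, add_sub_cancel_left]
  rw [e, heatInt, heatInt, ← integral_add i1 i2]
  exact integral_radialMeasure_congr fun s _ => by ring

lemma integral_heatFlow_eq (m : ℕ) {t : ℝ} (ht : 0 ≤ t) (f : ℝ → ℝ → ℝ) (r : ℝ) :
    ∫ s in (0 : ℝ)..t, heatFlow m (t - s) (f s) r = ∫ s in Ioo 0 t, heatInt m (t - s) (f s) r := by
  rw [intervalIntegral.integral_of_le ht, integral_Ioc_eq_integral_Ioo]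
  exact setIntegral_congr_fun measurableSet_Ioo fun s hs => heatFlow_eq m (sub_pos.2 hs.2).ne' _ _

namespace IsSolution

variable {m : ℕ} {u₀ : ℝ → ℝ} {T : ℝ≥0∞} {u : ℝ → ℝ → ℝ}

lemma duhamel_of_pos (hu : IsSolution m u₀ T u) {t : ℝ} (ht : t ∈ timeInterval T) (ht0 : 0 < t)
    {r : ℝ} (hr : 0 < r) : u t r = heatInt m t u₀ r +
      ∫ s in Ioo 0 t, heatInt m (t - s) (nonlinearity m (u s)) r := by
  rw [hu.duhamel t ht r hr, integral_heatFlow_eq m ht0.le, heatFlow_eq m ht0.ne']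

lemma heatInt_eq (hm : 1 ≤ m) (hu : IsSolution m u₀ T u) {a τ : ℝ} (ha : a ∈ timeInterval T)
    (hτ : 0 < τ) {r : ℝ} (hr : 0 < r) : heatInt m τ (u a) r = heatInt m (τ + a) u₀ r +
      ∫ s in Ioo 0 a, heatInt m (τ + (a - s)) (nonlinearity m (u s)) r := by
  have h0 := zero_mem_timeInterval_of_mem ha
  rcases ha.1.eq_or_lt with rfl | ha0
  · rw [heatInt_congr m τ (fun s hs => hu.data_eq h0 hs)]
    simp
  · obtain ⟨A, H⟩ := hu.isMildCurve hm ha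
    have h1 := H.heatInt_eq hm ⟨ha0, le_rfl⟩ hτ hr
    rw [heatInt_congr m τ fun s hs => clamp_eq (u := u) ⟨ha0.le, le_rfl⟩ hs] at h1
    rw [h1]
    congr 1
    · refine heatInt_congr m _ (fun s hs => ?_) r
      rw [clamp_eq ⟨le_rfl, ha0.le⟩ hs, hu.data_eq h0 hs]
    · refine setIntegral_congr_fun measurableSet_Ioo fun s hs => ?_
      refine heatInt_congr m _ (fun ρ hρ => ?_) r
      exact nonlinearity_congr (clamp_eq (Ioo_subset_Icc_self hs) hρ)

lemma integrableOn_heatInt (hm : 1 ≤ m) (hu : IsSolution m u₀ T u) {a τ : ℝ}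
    (ha : a ∈ timeInterval T) (hτ : 0 ≤ τ) {r : ℝ} (hr : 0 < r) :
    IntegrableOn (fun s => heatInt m (τ + a - s) (nonlinearity m (u s)) r) (Ioo 0 a) := by
  obtain ⟨A, H⟩ := hu.isMildCurve hm ha
  have h1 := ((H.isSource hm).integrableOn_heatInt m (τ + a) hr).mono_set
    (Ioo_subset_Ioo_right (by linarith : a ≤ τ + a))
  refine h1.congr_fun (fun s hs => heatInt_congr m _ (fun ρ hρ => ?_) r) measurableSet_Ioo
  exact nonlinearity_congr (clamp_eq (Ioo_subset_Icc_self hs) hρ)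

end IsSolution

/-! ### Translations in time -/

lemma mem_timeInterval_sub {T : ℝ≥0∞} {a s : ℝ} (ha : 0 ≤ a) :
    s ∈ timeInterval (T - ENNReal.ofReal a) ↔ 0 ≤ s ∧ a + s ∈ timeInterval T := by
  constructor
  · rintro ⟨h1, h2⟩
    refine ⟨h1, by positivity, ?_⟩
    rw [ENNReal.ofReal_add ha h1]
    exact lt_tsub_iff_left.1 h2
  · rintro ⟨h1, _, h2⟩
    refine ⟨h1, ?_⟩
    rw [ENNReal.ofReal_add ha h1] at h2
    exact lt_tsub_iff_left.2 h2

lemma setIntegral_shift (a t : ℝ) (F : ℝ → ℝ) :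
    ∫ s in Ioo 0 t, F (a + s) = ∫ s in Ioo a (a + t), F s := by
  have h := (measurePreserving_add_left volume a).setIntegral_preimage_emb
    (measurableEmbedding_addLeft a) F (Ioo a (a + t))
  rw [← h]
  congr 2
  ext s
  simp

lemma setLIntegral_shift (a : ℝ) (K : Set ℝ) (F : ℝ → ℝ≥0∞) :
    ∫⁻ s in K, F (a + s) = ∫⁻ s in (fun s => a + s) '' K, F s := by
  have h := (measurePreserving_add_left volume a).setLIntegral_comp_emb
    (measurableEmbedding_addLeft a) F K
  exact h

/-- The fourth power of the space-time norm. -/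
def spaceTimeInt (I : Set ℝ) (u : ℝ → ℝ → ℝ) : ℝ≥0∞ :=
  ∫⁻ t in I, ∫⁻ r in Ioi (0 : ℝ), ENNReal.ofReal (|u t r / r| ^ 4 * r)

lemma L4rL4Norm_lt_top_iff {I : Set ℝ} {u : ℝ → ℝ → ℝ} :
    L4rL4Norm I u < ⊤ ↔ spaceTimeInt I u < ⊤ := by
  rw [L4rL4Norm, ENNReal.rpow_lt_top_iff_of_pos (by norm_num), spaceTimeInt]

lemma L4rL4Norm_eq_top_iff {I : Set ℝ} {u : ℝ → ℝ → ℝ} :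
    L4rL4Norm I u = ⊤ ↔ spaceTimeInt I u = ⊤ := by
  rw [← not_lt_top_iff, ← not_lt_top_iff, L4rL4Norm_lt_top_iff]

lemma spaceTimeInt_shift (a : ℝ) (K : Set ℝ) (u : ℝ → ℝ → ℝ) :
    spaceTimeInt K (fun t => u (a + t)) = spaceTimeInt ((fun s => a + s) '' K) u :=
  setLIntegral_shift a K fun t => ∫⁻ r in Ioi (0 : ℝ), ENNReal.ofReal (|u t r / r| ^ 4 * r)

namespace IsSolution

variable {m : ℕ} {u₀ : ℝ → ℝ} {T : ℝ≥0∞} {u : ℝ → ℝ → ℝ}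

/-- Solutions can be restarted at later times. -/
lemma restart (hm : 1 ≤ m) (hu : IsSolution m u₀ T u) {a : ℝ} (ha : a ∈ timeInterval T) :
    IsSolution m (u a) (T - ENNReal.ofReal a) fun t => u (a + t) where
  data_mem := hu.mem a ha
  mem t ht := hu.mem _ ((mem_timeInterval_sub ha.1).1 ht).2
  cont t ht := by
    have h := hu.cont _ ((mem_timeInterval_sub ha.1).1 ht).2
    refine h.comp ?_
    refine tendsto_nhdsWithin_of_tendsto_nhds_of_eventually_within _
      ((continuous_const_add a).tendsto t |>.mono_left nhdsWithin_le_nhds) ?_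
    filter_upwards [self_mem_nhdsWithin] with s hs using ((mem_timeInterval_sub ha.1).1 hs).2
  norm_lt_top K hK hKT := by
    rw [L4rL4Norm_lt_top_iff, spaceTimeInt_shift, ← L4rL4Norm_lt_top_iff]
    refine hu.norm_lt_top _ (hK.image (continuous_const_add a)) ?_
    rintro _ ⟨s, hs, rfl⟩
    exact ((mem_timeInterval_sub ha.1).1 (hKT hs)).2
  duhamel t ht r hr := by
    have hat := ((mem_timeInterval_sub ha.1).1 ht).2
    rcases ht.1.eq_or_lt with rfl | ht0
    · simp [heatFlow_zero]
    have hpos : 0 < a + t := by linarith [ha.1]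
    rw [integral_heatFlow_eq m ht0.le, heatFlow_eq m ht0.ne', hu.duhamel_of_pos hat hpos hr,
      hu.heatInt_eq hm ha ht0 hr, add_comm t a, add_assoc]
    congr 1
    have hi := hu.integrableOn_heatInt hm hat le_rfl hr
    rw [zero_add] at hi
    have e1 : ∫ s in Ioo 0 t, heatInt m (t - s) (nonlinearity m (u (a + s))) r =
        ∫ s in Ioo a (a + t), heatInt m (a + t - s) (nonlinearity m (u s)) r := by
      rw [← setIntegral_shift a t fun s => heatInt m (a + t - s) (nonlinearity m (u s)) r]
      simp only [add_sub_add_left_eq_sub]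
    have e2 : ∀ s, t + (a - s) = a + t - s := fun s => by ring
    simp_rw [e1, e2]
    rw [← integral_Ioc_eq_integral_Ioo, ← integral_Ioc_eq_integral_Ioo,
      ← integral_Ioc_eq_integral_Ioo, ← setIntegral_union (Ioc_disjoint_Ioc_of_le le_rfl)
        measurableSet_Ioc, Ioc_union_Ioc_eq_Ioc ha.1 (by linarith)]
    · rw [integrableOn_Ioc_iff_integrableOn_Ioo]
      exact hi.mono_set (Ioo_subset_Ioo_right (by linarith))
    · rw [integrableOn_Ioc_iff_integrableOn_Ioo]
      exact hi.mono_set (Ioo_subset_Ioo_left ha.1)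

/-- The function equal to `u` up to time `a`, and to `v (· - a)` afterwards. -/
def glued (a : ℝ) (u v : ℝ → ℝ → ℝ) (t : ℝ) : ℝ → ℝ := if t ≤ a then u t else v (t - a)

lemma glued_of_le {a t : ℝ} (v : ℝ → ℝ → ℝ) (h : t ≤ a) : glued a u v t = u t := if_pos h

lemma glued_of_ge {T' : ℝ≥0∞} {v : ℝ → ℝ → ℝ} {a t : ℝ} (hv : IsSolution m (u a) T' v)
    (hT' : 0 < T') (h : a ≤ t) {r : ℝ} (hr : 0 < r) : glued a u v t r = v (t - a) r := by
  rcases h.eq_or_lt with rfl | h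
  · rw [glued_of_le v le_rfl, sub_self, hv.data_eq ⟨le_rfl, by simpa using hT'⟩ hr]
  · rw [glued, if_neg (not_le.2 h)]

lemma sub_mem_timeInterval {T' : ℝ≥0∞} {a t : ℝ} (ha : 0 ≤ a)
    (ht : t ∈ timeInterval (ENNReal.ofReal a + T')) (hat : a ≤ t) : t - a ∈ timeInterval T' := by
  refine ⟨sub_nonneg.2 hat, ?_⟩
  have h := ht.2
  rw [← add_sub_cancel a t, ENNReal.ofReal_add ha (sub_nonneg.2 hat)] at h
  exact (ENNReal.add_lt_add_iff_left ENNReal.ofReal_ne_top).1 h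

/-- A solution can be continued by any solution that starts from one of its values. -/
lemma glue (hm : 1 ≤ m) (hu : IsSolution m u₀ T u) {a : ℝ} (ha : a ∈ timeInterval T) {T' : ℝ≥0∞}
    {v : ℝ → ℝ → ℝ} (hv : IsSolution m (u a) T' v) (hT' : 0 < T') :
    IsSolution m u₀ (ENNReal.ofReal a + T') (glued a u v) where
  data_mem := hu.data_mem
  mem t ht := by
    rcases le_total t a with h | h
    · rw [glued_of_le v h]
      exact hu.mem t (Icc_subset_timeInterval ha ⟨ht.1, h⟩)
    · exact (hv.mem _ (sub_mem_timeInterval ha.1 ht h)).congr fun r hr => hv.glued_of_ge hT' h hr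
  cont t₁ ht₁ := by
    set S := timeInterval (ENNReal.ofReal a + T') with hS
    -- Continuity is checked on each closed half separately. At t₁ = a both halves count; otherwise
    -- the half that misses t₁ gives the trivial filter.
    have hSu : S = (S ∩ Iic a) ∪ (S ∩ Ici a) := by
      rw [← inter_union_distrib_left, Iic_union_Ici, inter_univ]
    have hbot : ∀ C : Set ℝ, IsClosed C → t₁ ∉ C → 𝓝[S ∩ C] t₁ = ⊥ := fun C hC ht => by
      refine le_bot_iff.1 ((nhdsWithin_mono t₁ inter_subset_right).trans_eq ?_)
      exact notMem_closure_iff_nhdsWithin_eq_bot.1 (by rwa [hC.closure_eq])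
    have hpart : ∀ t, t ∈ S → t ≤ a → t ∈ timeInterval T := fun t ht h =>
      Icc_subset_timeInterval ha ⟨ht.1, h⟩
    rw [hSu, nhdsWithin_union, tendsto_sup]
    constructor
    · rcases le_or_gt t₁ a with h | h
      · refine ((hu.cont t₁ (hpart t₁ ht₁ h)).mono_left (nhdsWithin_mono t₁
          fun t ht => hpart t ht.1 ht.2)).congr' ?_
        filter_upwards [self_mem_nhdsWithin] with t ht
        rw [glued_of_le v h, glued_of_le v ht.2]
      · rw [hbot _ isClosed_Iic (not_le.2 h)]
        exact tendsto_bot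
    · rcases lt_or_ge t₁ a with h | h
      · rw [hbot _ isClosed_Ici (not_le.2 h)]
        exact tendsto_bot
      · have h1 : Tendsto (fun t => t - a) (𝓝[S ∩ Ici a] t₁) (𝓝[timeInterval T'] (t₁ - a)) := by
          refine tendsto_nhdsWithin_of_tendsto_nhds_of_eventually_within _
            ((continuous_sub_right a).tendsto t₁ |>.mono_left nhdsWithin_le_nhds) ?_
          filter_upwards [self_mem_nhdsWithin] with s hs using sub_mem_timeInterval ha.1 hs.1 hs.2
        refine ((hv.cont _ (sub_mem_timeInterval ha.1 ht₁ h)).comp h1).congr' ?_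
        filter_upwards [self_mem_nhdsWithin] with t ht
        exact X2NormSq_congr fun r hr => by
          rw [hv.glued_of_ge hT' h hr, hv.glued_of_ge hT' ht.2 hr]
  norm_lt_top K hK hKT := by
    rw [L4rL4Norm_lt_top_iff]
    have h1 : spaceTimeInt (K ∩ Iic a) (glued a u v) < ⊤ := by
      have hc : IsCompact (K ∩ Iic a) := hK.inter_right isClosed_Iic
      have h2 := L4rL4Norm_lt_top_iff.1 (hu.norm_lt_top _ hc fun t ht =>
        Icc_subset_timeInterval ha ⟨(hKT ht.1).1, ht.2⟩)
      refine lt_of_eq_of_lt (setLIntegral_congr_fun hc.measurableSet fun t ht => ?_) h2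
      rw [glued_of_le v ht.2]
    have h2 : spaceTimeInt (K ∩ Ici a) (glued a u v) < ⊤ := by
      have hc : IsCompact ((fun t => t - a) '' (K ∩ Ici a)) :=
        (hK.inter_right isClosed_Ici).image (continuous_sub_right a)
      have h3 := L4rL4Norm_lt_top_iff.1 (hv.norm_lt_top _ hc (by
        rintro _ ⟨t, ht, rfl⟩
        exact sub_mem_timeInterval ha.1 (hKT ht.1) ht.2))
      have e : K ∩ Ici a = (fun s => a + s) '' ((fun t => t - a) '' (K ∩ Ici a)) := by
        rw [image_image]
        simp
      rw [e, ← spaceTimeInt_shift]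
      refine lt_of_eq_of_lt (setLIntegral_congr_fun hc.measurableSet fun s hs => ?_) h3
      obtain ⟨t, ht, rfl⟩ := hs
      refine setLIntegral_congr_fun measurableSet_Ioi fun r hr => ?_
      simp only [add_sub_cancel]
      rw [hv.glued_of_ge hT' ht.2 hr]
    refine lt_of_le_of_lt ?_ (ENNReal.add_lt_top.2 ⟨h1, h2⟩)
    refine le_trans (lintegral_mono_set fun t ht => ?_) (lintegral_union_le _ (K ∩ Iic a) (K ∩ Ici a))
    exact (le_total t a).imp (fun h => ⟨ht, h⟩) fun h => ⟨ht, h⟩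
  duhamel t ht r hr := by
    rcases le_or_gt t a with h | h
    · rw [glued_of_le v h, hu.duhamel t (Icc_subset_timeInterval ha ⟨ht.1, h⟩) r hr]
      congr 1
      refine intervalIntegral.integral_congr fun s hs => ?_
      rw [uIcc_of_le ht.1] at hs
      simp only [glued_of_le v (hs.2.trans h)]
    · have hτ : 0 < t - a := sub_pos.2 h
      have hτT := sub_mem_timeInterval ha.1 ht h.le
      have ht0 : 0 < t := ha.1.trans_lt h
      rw [hv.glued_of_ge hT' h.le hr, hv.duhamel_of_pos hτT hτ hr, hu.heatInt_eq hm ha hτ hr,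
        integral_heatFlow_eq m ht0.le, heatFlow_eq m ht0.ne', sub_add_cancel, add_assoc]
      congr 1
      -- On (0, a) the source is that of u, with (t - a) + (a - s) = t - s; on (a, t) it is that of
      -- v shifted by a. The two integrals join into one.
      set F : ℝ → ℝ := fun s => heatInt m (t - s) (nonlinearity m (glued a u v s)) r with hF
      have e1 : EqOn (fun s => heatInt m (t - a + (a - s)) (nonlinearity m (u s)) r) F (Ioo 0 a) :=
        fun s hs => by simp only [hF, glued_of_le v hs.2.le, sub_add_sub_cancel]
      have e2 : EqOn (fun s => heatInt m (t - a - s) (nonlinearity m (v s)) r)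
          (fun s => F (a + s)) (Ioo 0 (t - a)) := fun s hs => by
        simp only [hF, sub_sub]
        refine heatInt_congr m _ (fun ρ hρ => nonlinearity_congr ?_) r
        rw [hv.glued_of_ge hT' (by linarith [hs.1]) hρ, add_sub_cancel_left]
      have i1 : IntegrableOn F (Ioo 0 a) := by
        refine (hu.integrableOn_heatInt hm ha hτ.le hr).congr_fun (fun s hs => ?_) measurableSet_Ioo
        rw [← e1 hs]
        simp only [add_sub_assoc]
      have i2 : IntegrableOn F (Ioo a t) := by
        have h1 := (hv.integrableOn_heatInt hm hτT le_rfl hr)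
        rw [zero_add] at h1
        have h2 := h1.congr_fun e2 measurableSet_Ioo
        have h3 := (measurePreserving_add_left volume a).integrableOn_comp_preimage
          (measurableEmbedding_addLeft a) (f := F) (s := Ioo a t)
        refine h3.1 ?_
        have e3 : (fun s => a + s) ⁻¹' Ioo a t = Ioo 0 (t - a) := by
          ext s
          simp [lt_sub_iff_add_lt']
        rw [e3]
        exact h2
      rw [setIntegral_congr_fun measurableSet_Ioo e1, setIntegral_congr_fun measurableSet_Ioo e2,
        setIntegral_shift, add_sub_cancel, ← integral_Ioc_eq_integral_Ioo,
        ← integral_Ioc_eq_integral_Ioo, ← integral_Ioc_eq_integral_Ioo,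
        ← setIntegral_union (Ioc_disjoint_Ioc_of_le le_rfl) measurableSet_Ioc
          (integrableOn_Ioc_iff_integrableOn_Ioo (by finiteness) |>.2 i1)
          (integrableOn_Ioc_iff_integrableOn_Ioo (by finiteness) |>.2 i2),
        Ioc_union_Ioc_eq_Ioc ha.1 h.le]

/-- Restarting shows that the remaining time is attained. Gluing shows that no solution from u(a)
lasts longer, since it would prolong the one from u₀. -/
lemma maximalTime_eq (hm : 1 ≤ m) (hu : IsSolution m u₀ (maximalTime m u₀) u) {a : ℝ}
    (ha : a ∈ timeInterval (maximalTime m u₀)) :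
    maximalTime m (u a) = maximalTime m u₀ - ENNReal.ofReal a := by
  refine le_antisymm (sSup_le ?_) (le_sSup ⟨_, hu.restart hm ha⟩)
  rintro T' ⟨v, hv⟩
  rcases eq_zero_or_pos T' with rfl | hT'
  · exact bot_le
  · exact ENNReal.le_sub_of_add_le_left ENNReal.ofReal_ne_top (le_sSup ⟨_, hu.glue hm ha hv hT'⟩)

/-- The norm over the compact interval [0, a] is finite, so the infinite part lies after time a, and
the restarted solution is again maximal. -/
lemma hasInfiniteNorm_restart (hm : 1 ≤ m) (hu : HasInfiniteNorm m u₀ u) {a : ℝ}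
    (ha : a ∈ timeInterval (maximalTime m u₀)) :
    HasInfiniteNorm m (u a) fun t => u (a + t) := by
  refine ⟨?_, ?_⟩
  · rw [hu.1.maximalTime_eq hm ha]
    exact hu.1.restart hm ha
  · rw [hu.1.maximalTime_eq hm ha, L4rL4Norm_eq_top_iff, spaceTimeInt_shift]
    have h1 := L4rL4Norm_eq_top_iff.1 hu.2
    have h2 := L4rL4Norm_lt_top_iff.1 (hu.1.norm_lt_top _ isCompact_Icc (Icc_subset_timeInterval ha))
    by_contra hne
    refine (ENNReal.add_lt_top.2 ⟨h2, lt_top_iff_ne_top.2 hne⟩).not_ge ?_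
    rw [← h1]
    refine le_trans (lintegral_mono_set fun t ht => ?_) (lintegral_union_le _ _ _)
    rcases le_total t a with h | h
    · exact Or.inl ⟨ht.1, h⟩
    · refine Or.inr ⟨t - a, (mem_timeInterval_sub ha.1).2 ⟨sub_nonneg.2 h, ?_⟩, by simp⟩
      rwa [add_sub_cancel]

/-! ### Absence of critical elements -/

lemma exists_gt_mem_timeInterval {t : ℝ} (ht : t ∈ timeInterval T) : ∃ c ∈ timeInterval T, t < c := by
  obtain ⟨q, hq1, hq2⟩ := ENNReal.lt_iff_exists_nnreal_btwn.1 ht.2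
  have h : t < q := by
    by_contra! h
    rw [← ENNReal.ofReal_coe_nnreal] at hq1
    exact hq1.not_ge (ENNReal.ofReal_le_ofReal h)
  exact ⟨q, ⟨q.2, by rwa [ENNReal.ofReal_coe_nnreal]⟩, h⟩

/-- A solution whose energy never drops below its initial value vanishes. -/
lemma eq_zero_of_energy_ge (hm : 1 ≤ m) (hu : IsSolution m u₀ T u)
    (hE : ∀ t ∈ timeInterval T, energy m u₀ ≤ energy m (u t)) {t : ℝ} (ht : t ∈ timeInterval T)
    {r : ℝ} (hr : 0 < r) : u t r = 0 := by
  obtain ⟨c, hc, htc⟩ := exists_gt_mem_timeInterval ht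
  have h0 := zero_mem_timeInterval_of_mem ht
  have htI : t ∈ Icc 0 c := ⟨ht.1, htc.le⟩
  obtain ⟨A, H⟩ := hu.isMildCurve hm hc
  rw [← clamp_eq (u := u) htI hr]
  refine IsStationary.eq_zero hm ?_ (H.mem t) hr
  intro φ a a' ha haa hφ hs
  by_contra hne
  have hq : ∫⁻ t in Icc 0 c, ∫⁻ r in Ioi (0 : ℝ), ENNReal.ofReal (|clamp u c t r / r| ^ 4 * r) < ⊤ := by
    refine lt_of_eq_of_lt ?_ (L4rL4Norm_lt_top_iff.1
      (hu.norm_lt_top _ isCompact_Icc (Icc_subset_timeInterval hc)))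
    refine setLIntegral_congr_fun measurableSet_Icc fun s hs => ?_
    refine setLIntegral_congr_fun measurableSet_Ioi fun ρ hρ => ?_
    rw [clamp_eq hs hρ]
  -- The strict loss of energy needs a comparison time after t and room beyond it inside [0, c]; the
  -- midpoint of t and c provides both.
  have hlt := H.norm_jetSinLp_lt hm (b := (t + c) / 2) ha haa hφ hs ht.1 (by linarith)
    (by linarith) hne hq
  have hb : (t + c) / 2 ∈ Icc 0 c := ⟨by linarith [ht.1, hc.1], by linarith⟩
  have hE' := hE _ (Icc_subset_timeInterval hc hb)
  rw [energy_congr (u := u₀) (v := clamp u c 0) fun r hr => by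
      rw [clamp_eq ⟨le_rfl, hc.1⟩ hr, hu.data_eq h0 hr],
    energy_congr (u := u ((t + c) / 2)) (v := clamp u c ((t + c) / 2)) fun r hr =>
      (clamp_eq hb hr).symm, (H.mem _).energy_eq, (H.mem _).energy_eq,
    ENNReal.ofReal_le_ofReal_iff (by positivity)] at hE'
  linarith

end IsSolution

/-- The dichotomy: either some value of the solution undercuts the infimum defining E_c, or the
solution is identically 0. -/
theorem not_isCriticalElement {m : ℕ} (hm : 1 ≤ m) (u₀ : ℝ → ℝ) (u : ℝ → ℝ → ℝ) :
    ¬ IsCriticalElement m u₀ u := by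
  rintro ⟨hX, hEc, hu⟩
  -- Finiteness shows that the infimum is not over the empty set, so an element of E₀ exists that
  -- places E_c below 2E(Q).
  have htop : criticalEnergy m < ⊤ := hEc ▸ hX.energy_lt_top
  obtain ⟨_, ⟨u₁, v, hu₁, hv, rfl⟩, -⟩ := sInf_lt_iff.1 htop
  have hthr : criticalEnergy m < 2 * energy m (harmonicMap m) :=
    (sInf_le ⟨u₁, v, hu₁, hv, rfl⟩ : criticalEnergy m ≤ _).trans_lt hu₁.2.1
  by_cases hdrop : ∃ t ∈ timeInterval (maximalTime m u₀), energy m (u t) < energy m u₀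
  · obtain ⟨t, ht, hlt⟩ := hdrop
    rw [hEc] at hlt
    have hmem := hu.1.mem t ht
    have hE0 : MemE0 m (u t) :=
      ⟨hmem.1, hlt.trans hthr, hmem.tendsto_zero hm, hmem.tendsto_infty hm⟩
    exact hlt.not_ge (sInf_le ⟨_, _, hE0, IsSolution.hasInfiniteNorm_restart hm hu ht, rfl⟩)
  · push Not at hdrop
    have hzero : spaceTimeInt (timeInterval (maximalTime m u₀)) u = 0 := by
      have hle : spaceTimeInt (timeInterval (maximalTime m u₀)) u ≤
          ∫⁻ _ in timeInterval (maximalTime m u₀), 0 := by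
        refine setLIntegral_mono measurable_const fun t ht => ?_
        refine le_of_eq ?_
        rw [← lintegral_zero (μ := volume.restrict (Ioi (0 : ℝ)))]
        refine setLIntegral_congr_fun measurableSet_Ioi fun r hr => ?_
        simp [hu.1.eq_zero_of_energy_ge hm hdrop ht hr]
      simpa using hle
    have := L4rL4Norm_eq_top_iff.1 hu.2
    rw [hzero] at this
    exact ENNReal.zero_ne_top this

end CorotationalHeatFlow

end

theorem mainTheorem8 (m : ℕ) (hm : 2 ≤ m) :
    ¬ ∃ (u₀ : ℝ → ℝ) (u : ℝ → ℝ → ℝ), CorotationalHeatFlow.IsCriticalElement m u₀ u := by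
  rintro ⟨u₀, u, h⟩
  exact CorotationalHeatFlow.not_isCriticalElement (one_le_two.trans hm) u₀ u h
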